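/- Let $a>0$, let $n\ge 3$ be an integer, $m_n\in\mathbb R$, and let $\mathcal M$ be a mass function that is $C^n$ near $0$ with $\mathcal M(r)=m_n r^n+O(r^{n+1})$ as $r\to0^+$. In Kerr–Schild coordinates $(\tilde t,x,y,z)$ let $g=\eta+2H\,k\otimes k$, where $\eta$ is the Minkowski metric, $r=r(x,y,z)\ge 0$ is the largest root of $r^4-r^2(x^2+y^2+z^2-a^2)-a^2z^2=0$, $H=\dfrac{\mathcal M(r)r^3}{r^4+a^2z^2}$ (with $H=0$ where $r=z=0$) and $k=-\dfrac{r(x\,dx+y\,dy)-a(x\,dy-y\,dx)}{r^2+a^2}-\dfrac{z\,dz}{r}-d\tilde t$. Let $(\tilde t,\rho,\psi,\varphi)$ be toroidal coordinates around the ring $x^2+y^2=a^2$, $z=0$: $x=(a+\rho\cos\psi)\cos\varphi$, $y=(a+\rho\cos\psi)\sin\varphi$, $z=\rho\sin\psi$. Put $\Delta=r^2-2\mathcal M(r)r+a^2$ and $\Sigma=r^2+a^2\cos^2\theta$. Under the change to Boyer–Lindquist coordinates $x+iy=(r+ia)\sin\theta\,e^{i(\phi+\int_0^r a/\Delta)}$,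 $z=r\cos\theta$, $\tilde t=t+\int_0^r\frac{s^2+a^2}{\Delta(s)}ds-r$, the metric takes, for small $r>0$ and $0<\theta<\pi$, the form $$-\tfrac{\Delta}{\Sigma}(dt-a\sin^2\theta\,d\phi)^2+\tfrac{\Sigma}{\Delta}dr^2+\Sigma\,d\theta^2+\tfrac{\sin^2\theta}{\Sigma}(a\,dt-(r^2+a^2)d\phi)^2 .$$ Every point with $\rho>0$ has coordinates $r\ge0$, $\theta\in[0,\pi]$ with $r\cos\theta=\rho\sin\psi$ and $(r^2+a^2)\sin^2\theta=(a+\rho\cos\psi)^2$, and for small $\rho>0$ the displayed metric is $C^2$ and non-degenerate there. Let $\mathcal R$ be its curvature scalar and $T=\mathrm{Ric}-\frac12\mathcal R g$ its effective energy-momentum tensor. Let $\mathbf l=\frac1\Delta((r^2+a^2)\partial_t+\Delta\partial_r+a\partial_\phi)$, $\mathbf n=\frac1{2\Sigma}((r^2+a^2)\partial_t-\Delta\partial_r+a\partial_\phi)$, $\mathbf m=\frac{1}{\sqrt2(r+ia\cos\theta)}(ia\sin\theta\,\partial_t+\partial_\theta+i\csc\theta\,\partial_\phi)$, and $\mathbf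 t,\mathbf z=(\mathbf l\pm\mathbf n)/\sqrt2$, $\mathbf x=(\mathbf m+\bar{\mathbf m})/\sqrt2$, $\mathbf y=i(\mathbf m-\bar{\mathbf m})/\sqrt2$. The effective density and pressures are $\mu=T(\mathbf t,\mathbf t)$, $p_x=T(\mathbf x,\mathbf x)$, $p_y=T(\mathbf y,\mathbf y)$, $p_z=T(\mathbf z,\mathbf z)$. Then: 1. (Leading order is flat.) In the coframe $(d\tilde t,\,d\rho,\,\rho\,d\psi,\,a\,d\varphi)$ the components of $g$ differ from those of $-d\tilde t^2+d\rho^2+\rho^2d\psi^2+a^2d\varphi^2$ by $O(\rho)$ as $\rho\to0^+$, uniformly in all directions. 2. (No conical singularity.) For constant $\tilde t,\varphi$, the length of the loop $\rho=\delta\rho$, $0\le\psi\le2\pi$, is $2\pi\,\delta\rho\,(1+o(1))$ as $\delta\rho\to0^+$, and its ratio to the length of any radial curve $\psi=\psi_0$, $0\le\rho\le\delta\rho$, tends to $2\pi$. 3. (Scaling.) As $\rho\to0^+$, uniformly in $\psi$, $$\rho^{-\frac{n-3}2}\mathcal R\to m_n n(n+1)(1+\cos\psi)^{\frac{n-1}2}a^{\frac{n-3}2},\qquad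 \rho^{-\frac{n-3}2}\mu,\ -\rho^{-\frac{n-3}2}p_z\to \tfrac{n m_n}{2}(1+\cos\psi)^{\frac{n+1}2}a^{\frac{n-3}2},$$ $$\rho^{-\frac{n-3}2}p_x,\ \rho^{-\frac{n-3}2}p_y\to \tfrac{n m_n}{2}(\cos\psi-n)(1+\cos\psi)^{\frac{n-1}2}a^{\frac{n-3}2}.$$ 4. If $n>3$, then $\mathcal R,\mu,p_x,p_y,p_z$ tend to $0$ at the ring, uniformly in $\psi$. 5. If $n=3$, then, uniformly in $\psi$, they have the finite, direction-dependent limits $\mathcal R\to12\,m_3(1+\cos\psi)$, $\mu=-p_z\to6m_3\cos^4(\psi/2)$, $p_x=p_y\to3m_3\cos^2(\psi/2)(\cos\psi-3)$ (the equalities being between the limits); if moreover $m_3\ne0$, none of the five extends continuously to the ring. -/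

import Mathlib

open Filter Topology Asymptotics

noncomputable section

namespace RotatingBH

/-! ### Metrics in a coordinate patch of `ℝ⁴` and their curvature -/

/-- Points of a four-dimensional coordinate patch. -/
abbrev Pt := Fin 4 → ℝ

/-- A field of bilinear forms, given by its components in the coordinates. -/
abbrev MetricField := Pt → Matrix (Fin 4) (Fin 4) ℝ

/-- The partial derivative `∂ᵢ f` at `p`. -/
def pd (i : Fin 4) (f : Pt → ℝ) (p : Pt) : ℝ :=
  deriv (fun s => f (Function.update p i s)) (p i)

/-- The pullback `Φ^* g`, with components `∂ᵢΦᵏ ∂ⱼΦˡ gₖₗ(Φ p)`. -/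
def pullback (Φ : Pt → Pt) (g : MetricField) : MetricField := fun p =>
  Matrix.of fun i j => ∑ k, ∑ l, pd i (fun q => Φ q k) p * pd j (fun q => Φ q l) p * g (Φ p) k l

/-- The value `g(u, v)` of the bilinear form `A` on two vectors. -/
def bilin (A : Matrix (Fin 4) (Fin 4) ℝ) (u v : Fin 4 → ℝ) : ℝ := ∑ i, ∑ j, A i j * u i * v j

/-- The length `∫ √|g(γ', γ')|` of the curve `γ` between the parameters `s₀` and `s₁`. -/
def curveLength (g : MetricField) (γ : ℝ → Pt) (s₀ s₁ : ℝ) : ℝ :=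
  ∫ s in s₀..s₁,
    Real.sqrt |bilin (g (γ s)) (fun i => deriv (fun u => γ u i) s) (fun i => deriv (fun u => γ u i) s)|

/-- The Christoffel symbol `Γᵏᵢⱼ` of the Levi-Civita connection. -/
def christoffel (g : MetricField) (k i j : Fin 4) (p : Pt) : ℝ :=
  (1 / 2) * ∑ l, (g p)⁻¹ k l *
    (pd i (fun q => g q l j) p + pd j (fun q => g q l i) p - pd l (fun q => g q i j) p)

/-- The Ricci tensor `Rᵢⱼ = ∂ₖΓᵏᵢⱼ - ∂ⱼΓᵏᵢₖ + ΓᵏₖₗΓˡᵢⱼ - ΓᵏⱼₗΓˡᵢₖ`. -/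
def ricci (g : MetricField) (p : Pt) : Matrix (Fin 4) (Fin 4) ℝ := Matrix.of fun i j =>
  (∑ k, (pd k (christoffel g k i j) p - pd j (christoffel g k i k) p)) +
    ∑ k, ∑ l, (christoffel g k k l p * christoffel g l i j p -
      christoffel g k j l p * christoffel g l i k p)

/-- The curvature scalar `gⁱʲ Rᵢⱼ`. -/
def scalarCurvature (g : MetricField) (p : Pt) : ℝ := ∑ i, ∑ j, (g p)⁻¹ i j * ricci g p i j

/-- The effective energy-momentum tensor `T = Ric - (1/2) R g`. -/
def energyMomentum (g : MetricField) (p : Pt) : Matrix (Fin 4) (Fin 4) ℝ :=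
  ricci g p - ((1 / 2) * scalarCurvature g p) • g p

/-! ### The metric in Kerr-Schild coordinates `(t̃, x, y, z)` -/

/-- The non-negative function `r(x, y, z)` with `r⁴ - r² (x² + y² + z² - a²) - a² z² = 0`
(the largest root, that is the one which is continuous on `ℝ³`). -/
def ksRadius (a x y z : ℝ) : ℝ :=
  Real.sqrt (((x ^ 2 + y ^ 2 + z ^ 2 - a ^ 2) +
    Real.sqrt ((x ^ 2 + y ^ 2 + z ^ 2 - a ^ 2) ^ 2 + 4 * a ^ 2 * z ^ 2)) / 2)

theorem ksRadius_eq (a x y z : ℝ) :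
    ksRadius a x y z ^ 4 - ksRadius a x y z ^ 2 * (x ^ 2 + y ^ 2 + z ^ 2 - a ^ 2)
      - a ^ 2 * z ^ 2 = 0 := by
  have h0 : 0 ≤ (x ^ 2 + y ^ 2 + z ^ 2 - a ^ 2) ^ 2 + 4 * a ^ 2 * z ^ 2 := by positivity
  have h1 := Real.sq_sqrt h0
  have h2 : 0 ≤ ((x ^ 2 + y ^ 2 + z ^ 2 - a ^ 2) +
      Real.sqrt ((x ^ 2 + y ^ 2 + z ^ 2 - a ^ 2) ^ 2 + 4 * a ^ 2 * z ^ 2)) / 2 := by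
    have : |x ^ 2 + y ^ 2 + z ^ 2 - a ^ 2| ≤
        Real.sqrt ((x ^ 2 + y ^ 2 + z ^ 2 - a ^ 2) ^ 2 + 4 * a ^ 2 * z ^ 2) := by
      apply Real.abs_le_sqrt
      nlinarith [sq_nonneg (a * z)]
    linarith [neg_abs_le (x ^ 2 + y ^ 2 + z ^ 2 - a ^ 2)]
  have h3 : ksRadius a x y z ^ 2 = _ := Real.sq_sqrt h2
  have h4 : ksRadius a x y z ^ 4 = (ksRadius a x y z ^ 2) ^ 2 := by ring
  rw [h4, h3]
  linear_combination h1 / 4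

/-- The function `H = 𝓜(r) r³ / (r⁴ + a² z²)`. On the disk `r = z = 0` the expression is `0/0`, which
is `0` here, the value of the continuous extension. -/
def ksH (a : ℝ) (M : ℝ → ℝ) (p : Pt) : ℝ :=
  let r := ksRadius a (p 1) (p 2) (p 3)
  M r * r ^ 3 / (r ^ 4 + a ^ 2 * p 3 ^ 2)

/-- The components of the one-form
`k = -(r (x dx + y dy) - a (x dy - y dx)) / (r² + a²) - z dz / r - dt̃`. -/
def ksForm (a : ℝ) (p : Pt) : Fin 4 → ℝ :=
  let r := ksRadius a (p 1) (p 2) (p 3)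
  ![-1, -(r * p 1 + a * p 2) / (r ^ 2 + a ^ 2), -(r * p 2 - a * p 1) / (r ^ 2 + a ^ 2), -(p 3 / r)]

/-- The Gürses-Gürsey metric `η + 2 H k ⊗ k`. -/
def ksMetric (a : ℝ) (M : ℝ → ℝ) : MetricField := fun p =>
  Matrix.diagonal ![-1, 1, 1, 1] + (2 * ksH a M p) • Matrix.vecMulVec (ksForm a p) (ksForm a p)

/-! ### Toroidal coordinates `(t̃, ρ, ψ, φ)` around the ring -/

/-- The Kerr-Schild coordinates of the point with toroidal coordinates `(t̃, ρ, ψ, φ)`. -/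
def toroidalMap (a : ℝ) (q : Pt) : Pt :=
  ![q 0, (a + q 1 * Real.cos (q 2)) * Real.cos (q 3), (a + q 1 * Real.cos (q 2)) * Real.sin (q 3),
    q 1 * Real.sin (q 2)]

/-- The metric in toroidal coordinates. -/
def toroidalMetric (a : ℝ) (M : ℝ → ℝ) : MetricField := pullback (toroidalMap a) (ksMetric a M)

/-- The flat metric `-dt² + dρ² + ρ² dψ² + a² dφ²`. -/
def flatRingMetric (a : ℝ) : MetricField := fun q => Matrix.diagonal ![-1, 1, q 1 ^ 2, a ^ 2]

/-- The lengths `1, 1, ρ, a` of the coordinate vectors in the flat metric `flatRingMetric`. -/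
def flatRingScale (a : ℝ) (q : Pt) : Fin 4 → ℝ := ![1, 1, q 1, a]

/-! ### Boyer-Lindquist coordinates `(t, r, θ, φ)` -/

/-- `Δ = r² - 2 𝓜(r) r + a²`. -/
def blDelta (a : ℝ) (M : ℝ → ℝ) (r : ℝ) : ℝ := r ^ 2 - 2 * M r * r + a ^ 2

/-- `Σ = r² + a² cos² θ`. -/
def blSigma (a r θ : ℝ) : ℝ := r ^ 2 + a ^ 2 * Real.cos θ ^ 2

/-- The Kerr-Schild coordinates of the point with Boyer-Lindquist coordinates `(t, r, θ, φ)`: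
`x + i y = (r + i a) sin θ exp (i (φ + ∫ a/Δ dr))`, `z = r cos θ`, `t̃ = t + ∫ (r² + a²)/Δ dr - r`. -/
def blMap (a : ℝ) (M : ℝ → ℝ) (p : Pt) : Pt :=
  let w := p 3 + ∫ s in (0 : ℝ)..(p 1), a / blDelta a M s
  ![p 0 + (∫ s in (0 : ℝ)..(p 1), (s ^ 2 + a ^ 2) / blDelta a M s) - p 1,
    Real.sin (p 2) * (p 1 * Real.cos w - a * Real.sin w),
    Real.sin (p 2) * (p 1 * Real.sin w + a * Real.cos w),
    p 1 * Real.cos (p 2)]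

/-- The metric in Boyer-Lindquist coordinates,
`-(Δ/Σ) (dt - a sin²θ dφ)² + (Σ/Δ) dr² + Σ dθ² + (sin²θ/Σ) (a dt - (r² + a²) dφ)²`. -/
def blMetric (a : ℝ) (M : ℝ → ℝ) : MetricField := fun p =>
  let Δ := blDelta a M (p 1)
  let S := blSigma a (p 1) (p 2)
  let u : Fin 4 → ℝ := ![1, 0, 0, -(a * Real.sin (p 2) ^ 2)]
  let v : Fin 4 → ℝ := ![a, 0, 0, -(p 1 ^ 2 + a ^ 2)]
  let dr : Fin 4 → ℝ := ![0, 1, 0, 0]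
  let dθ : Fin 4 → ℝ := ![0, 0, 1, 0]
  (-(Δ / S)) • Matrix.vecMulVec u u + (S / Δ) • Matrix.vecMulVec dr dr +
    S • Matrix.vecMulVec dθ dθ + (Real.sin (p 2) ^ 2 / S) • Matrix.vecMulVec v v

/-- `(r, θ)` are the Boyer-Lindquist coordinates of a point with toroidal coordinates `(ρ, ψ)`,
in the spacetime that is not extended to negative `r`: `r cos θ = z` and
`(r² + a²) sin² θ = x² + y²`. -/
def AreBLCoords (a ρ ψ r θ : ℝ) : Prop :=
  0 ≤ r ∧ 0 ≤ θ ∧ θ ≤ Real.pi ∧ r * Real.cos θ = ρ * Real.sin ψ ∧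
    (r ^ 2 + a ^ 2) * Real.sin θ ^ 2 = (a + ρ * Real.cos ψ) ^ 2

/-- The null vector `l` of the tetrad. -/
def nullL (a : ℝ) (M : ℝ → ℝ) (p : Pt) : Fin 4 → ℝ :=
  (1 / blDelta a M (p 1)) • ![p 1 ^ 2 + a ^ 2, blDelta a M (p 1), 0, a]

/-- The null vector `n` of the tetrad. -/
def nullN (a : ℝ) (M : ℝ → ℝ) (p : Pt) : Fin 4 → ℝ :=
  (1 / (2 * blSigma a (p 1) (p 2))) • ![p 1 ^ 2 + a ^ 2, -blDelta a M (p 1), 0, a]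

/-- The complex null vector `m` of the tetrad. -/
def nullM (a : ℝ) (p : Pt) : Fin 4 → ℂ :=
  (1 / ((Real.sqrt 2 : ℂ) * ((p 1 : ℂ) + Complex.I * (a * Real.cos (p 2) : ℝ)))) •
    ![Complex.I * (a * Real.sin (p 2) : ℝ), 0, 1, Complex.I * (1 / Real.sin (p 2) : ℝ)]

/-- `𝐭 = (l + n) / √2`. -/
def frameT (a : ℝ) (M : ℝ → ℝ) (p : Pt) : Fin 4 → ℝ :=
  (1 / Real.sqrt 2) • (nullL a M p + nullN a M p)

/-- `𝐳 = (l - n) / √2`. -/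
def frameZ (a : ℝ) (M : ℝ → ℝ) (p : Pt) : Fin 4 → ℝ :=
  (1 / Real.sqrt 2) • (nullL a M p - nullN a M p)

/-- `𝐱 = (m + m̄) / √2 = √2 Re m`. -/
def frameX (a : ℝ) (p : Pt) : Fin 4 → ℝ := fun i => Real.sqrt 2 * (nullM a p i).re

/-- `𝐲 = i (m - m̄) / √2 = -√2 Im m`. -/
def frameY (a : ℝ) (p : Pt) : Fin 4 → ℝ := fun i => -(Real.sqrt 2 * (nullM a p i).im)

/-- The curvature scalar `𝓡` in Boyer-Lindquist coordinates. -/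
def curvScalar (a : ℝ) (M : ℝ → ℝ) (p : Pt) : ℝ := scalarCurvature (blMetric a M) p

/-- The effective density `μ = T(𝐭, 𝐭)`. -/
def density (a : ℝ) (M : ℝ → ℝ) (p : Pt) : ℝ :=
  bilin (energyMomentum (blMetric a M) p) (frameT a M p) (frameT a M p)

/-- The effective pressure `p_x = T(𝐱, 𝐱)`. -/
def pressureX (a : ℝ) (M : ℝ → ℝ) (p : Pt) : ℝ :=
  bilin (energyMomentum (blMetric a M) p) (frameX a p) (frameX a p)

/-- The effective pressure `p_y = T(𝐲, 𝐲)`. -/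
def pressureY (a : ℝ) (M : ℝ → ℝ) (p : Pt) : ℝ :=
  bilin (energyMomentum (blMetric a M) p) (frameY a p) (frameY a p)

/-- The effective pressure `p_z = T(𝐳, 𝐳)`. -/
def pressureZ (a : ℝ) (M : ℝ → ℝ) (p : Pt) : ℝ :=
  bilin (energyMomentum (blMetric a M) p) (frameZ a M p) (frameZ a M p)

/-- The field `F` converges to `f ψ` as `ρ → 0⁺`, uniformly in the direction `ψ`; here
`(r, θ) = (r ρ ψ, θ ρ ψ)` are the Boyer-Lindquist coordinates and `F` is multiplied by `ρ ^ (-s)`. -/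
def RingLimit (r θ : ℝ → ℝ → ℝ) (t φ : ℝ) (F : Pt → ℝ) (s : ℝ) (f : ℝ → ℝ) : Prop :=
  TendstoUniformly (fun ρ ψ => F ![t, r ρ ψ, θ ρ ψ, φ] / ρ ^ s) f (𝓝[>] 0)

/-- The stationary and axisymmetric field `F` extends continuously to the ring, with the value `L`
there. -/
def ContinuousAtRing (r θ : ℝ → ℝ → ℝ) (t φ : ℝ) (F : Pt → ℝ) (L : ℝ) : Prop :=
  TendstoUniformly (fun ρ ψ => F ![t, r ρ ψ, θ ρ ψ, φ]) (fun _ => L) (𝓝[>] 0)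

end RotatingBH

end

/-! Write $f = r\,\mathcal M(r)$. On the tetrad vectors the Ricci tensor in Boyer–Lindquist
coordinates has only two eigenvalues: $A$ on the plane of $\mathbf l,\mathbf n$ and $B$ on the plane
of $\mathbf m,\bar{\mathbf m}$, with $B = 2(rf'-f)/\Sigma^2$ and $A+B = f''/\Sigma$
(`ricci_blMetric`). Hence, exactly, $\mathcal R = 2f''/\Sigma$, $\mu = -p_z = B$ and $p_x = p_y =
-A$ at every regular point (`BLRegular.curvScalar_eq`, `BLRegular.density_eq`,
`BLRegular.pressureX_eq` and their companions). The asymptotics at the ring thus concern only $f$,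
$r$ and $\Sigma$.

The geometry of the ring enters through $(r+ia\cos\theta)^2 = \rho^2+2a\rho e^{i\psi}$. Its modulus
and real part give $\Sigma = \rho\,(2a+O(\rho))$ and $r^2 = \rho\,(a(1+\cos\psi)+O(\rho))$,
uniformly in $\psi$ (`AreBLCoords.bounds`). The expansion of $\mathcal M$ may be differentiated
because $\mathcal M$ is $C^n$: a remainder that is $o(r^n)$ has zero $n$-jet, and so its derivatives
are small by Taylor's formula (`deriv_isLittleO`). This yields $f''\sim n(n+1)m_nr^{n-1}$ and $rf'-f
= r^2\mathcal M'\sim n\,m_nr^{n+1}$. Substituting $r\sim(\rho a(1+\cos\psi))^{1/2}$ and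
$\Sigma\sim2a\rho$ produces the power $\rho^{(n-3)/2}$ and the stated profiles. These are bounded,
so the fields vanish at the ring when $n>3$; for $n=3$ the power is $1$ and the profiles differ at
$\psi=0$ and $\psi=\pi$.

The metric statements need less. The components of $k$ are bounded near the ring and $n\ge3$ gives
$H = O(r^2) = O(\rho)$, so $g$ is a perturbation of size $O(\rho)$ of the Minkowski metric, whose
toroidal form differs from the flat ring metric only by $(a+\rho\cos\psi)^2$ in place of $a^2$. The
lengths of loops and radii follow by integration. That the two forms of the metric agree is a direct
pullback (`pullback_blMap`). -/

noncomputable section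
namespace RotatingBH

/-! ### Boyer-Lindquist metric: components, inverse, derivatives -/

/-- A symmetric matrix that does not mix the `(t, φ)` block with `r` and `θ`. -/
def blockMatrix (tt tf ff rr θθ : ℝ) : Matrix (Fin 4) (Fin 4) ℝ :=
  !![tt, 0, 0, tf; 0, rr, 0, 0; 0, 0, θθ, 0; tf, 0, 0, ff]

/-- The components of the metric, as functions of the values `f = r 𝓜(r)`, `s = sin θ`, `c = cos θ`. -/
def blComponents (a r f s c : ℝ) : Matrix (Fin 4) (Fin 4) ℝ :=
  let S := r ^ 2 + a ^ 2 * c ^ 2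
  let D := r ^ 2 + a ^ 2 - 2 * f
  blockMatrix (-1 + 2 * f / S) (-(2 * f * a * s ^ 2 / S))
    (s ^ 2 * (r ^ 2 + a ^ 2) + 2 * f * a ^ 2 * s ^ 4 / S) (S / D) S

/-- The components of the inverse metric. -/
def blInverse (a r f s c : ℝ) : Matrix (Fin 4) (Fin 4) ℝ :=
  let S := r ^ 2 + a ^ 2 * c ^ 2
  let D := r ^ 2 + a ^ 2 - 2 * f
  blockMatrix (-((r ^ 2 + a ^ 2) ^ 2 - D * a ^ 2 * s ^ 2) / (D * S)) (-(2 * a * f / (D * S)))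
    ((D - a ^ 2 * s ^ 2) / (D * S * s ^ 2)) (D / S) (1 / S)

/-- The derivatives `∂_r g`, where `f₁ = f'(r)`. -/
def blDr (a r f f₁ s c : ℝ) : Matrix (Fin 4) (Fin 4) ℝ :=
  let S := r ^ 2 + a ^ 2 * c ^ 2
  let D := r ^ 2 + a ^ 2 - 2 * f
  let h := 2 * (f₁ * S - 2 * r * f) / S ^ 2
  blockMatrix h (-(a * s ^ 2 * h)) (2 * r * s ^ 2 + a ^ 2 * s ^ 4 * h)
    ((2 * r * D - S * (2 * r - 2 * f₁)) / D ^ 2) (2 * r)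

/-- The derivatives `∂_θ g`. -/
def blDθ (a r f s c : ℝ) : Matrix (Fin 4) (Fin 4) ℝ :=
  let S := r ^ 2 + a ^ 2 * c ^ 2
  let D := r ^ 2 + a ^ 2 - 2 * f
  blockMatrix (4 * f * a ^ 2 * s * c / S ^ 2)
    (-(4 * f * a * s * c * (r ^ 2 + a ^ 2) / S ^ 2))
    (2 * s * c * (r ^ 2 + a ^ 2) + 4 * a ^ 2 * s ^ 3 * c * f * (a ^ 2 * s ^ 2 + 2 * S) / S ^ 2)
    (-(2 * a ^ 2 * s * c) / D) (-(2 * a ^ 2 * s * c))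

theorem blMetric_eq_components (a : ℝ) (M : ℝ → ℝ) (p : Pt) (hS : blSigma a (p 1) (p 2) ≠ 0) :
    blMetric a M p =
      blComponents a (p 1) (M (p 1) * p 1) (Real.sin (p 2)) (Real.cos (p 2)) := by
  have hsc := Real.sin_sq (p 2)
  simp only [blSigma] at hS
  simp only [blMetric, blComponents, blockMatrix, blSigma, blDelta]
  have hD : p 1 ^ 2 - 2 * M (p 1) * p 1 + a ^ 2 = p 1 ^ 2 + a ^ 2 - 2 * (M (p 1) * p 1) := by ring
  rw [hD]
  have h4 : Real.sin (p 2) ^ 4 = (1 - Real.cos (p 2) ^ 2) ^ 2 := by rw [← hsc]; ring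
  ext i j
  simp only [Matrix.add_apply, Matrix.smul_apply, Matrix.vecMulVec_apply, smul_eq_mul]
  fin_cases i <;> fin_cases j <;> simp [hsc] <;> field_simp <;>
    (try simp only [h4]) <;> ring

/-- The $(t,\varphi)$ block has determinant $-D\,s^2$, because $r^2+a^2-a^2s^2 = S$; this is why $D$
and $s$ must not vanish. -/
theorem blComponents_mul_blInverse {a r f s c : ℝ} (hS : r ^ 2 + a ^ 2 * c ^ 2 ≠ 0)
    (hD : r ^ 2 + a ^ 2 - 2 * f ≠ 0) (hs : s ≠ 0) (hsc : c ^ 2 = 1 - s ^ 2) :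
    blComponents a r f s c * blInverse a r f s c = 1 := by
  rw [hsc] at hS
  simp only [blComponents, blInverse, blockMatrix, hsc]
  ext i j
  fin_cases i <;> fin_cases j <;> simp [Matrix.mul_apply, Fin.sum_univ_four] <;> field_simp <;> ring

theorem hasDerivAt_blComponents_r {a r s c f₁ : ℝ} {f : ℝ → ℝ} (hf : HasDerivAt f f₁ r)
    (hS : r ^ 2 + a ^ 2 * c ^ 2 ≠ 0) (hD : r ^ 2 + a ^ 2 - 2 * f r ≠ 0) (i j : Fin 4) :
    HasDerivAt (fun x => blComponents a x (f x) s c i j) (blDr a r (f r) f₁ s c i j) r := by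
  have hx : HasDerivAt (fun x : ℝ => x ^ 2) (2 * r) r := by simpa using hasDerivAt_pow 2 r
  have dS : HasDerivAt (fun x : ℝ => x ^ 2 + a ^ 2 * c ^ 2) (2 * r) r := hx.add_const _
  have dD : HasDerivAt (fun x : ℝ => x ^ 2 + a ^ 2 - 2 * f x) (2 * r - 2 * f₁) r :=
    (hx.add_const _).sub (hf.const_mul 2)
  have dh : HasDerivAt (fun x : ℝ => 2 * f x / (x ^ 2 + a ^ 2 * c ^ 2))
      (2 * (f₁ * (r ^ 2 + a ^ 2 * c ^ 2) - 2 * r * f r) / (r ^ 2 + a ^ 2 * c ^ 2) ^ 2) r :=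
    ((hf.const_mul 2).div dS hS).congr_deriv (by ring)
  have d00 := dh.const_add (-1)
  have d03 : HasDerivAt (fun x : ℝ => -(2 * f x * a * s ^ 2 / (x ^ 2 + a ^ 2 * c ^ 2)))
      (-(a * s ^ 2 * (2 * (f₁ * (r ^ 2 + a ^ 2 * c ^ 2) - 2 * r * f r) /
        (r ^ 2 + a ^ 2 * c ^ 2) ^ 2))) r :=
    (dh.const_mul (a * s ^ 2)).neg.congr_of_eventuallyEq
      (Eventually.of_forall fun x => by simp only [Pi.neg_apply]; ring)
  have d11 := (dS.div dD hD).congr_deriv (g' := (2 * r * (r ^ 2 + a ^ 2 - 2 * f r) -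
    (r ^ 2 + a ^ 2 * c ^ 2) * (2 * r - 2 * f₁)) / (r ^ 2 + a ^ 2 - 2 * f r) ^ 2) (by ring)
  have d33 : HasDerivAt (fun x : ℝ => s ^ 2 * (x ^ 2 + a ^ 2) +
        2 * f x * a ^ 2 * s ^ 4 / (x ^ 2 + a ^ 2 * c ^ 2))
      (2 * r * s ^ 2 + a ^ 2 * s ^ 4 * (2 * (f₁ * (r ^ 2 + a ^ 2 * c ^ 2) - 2 * r * f r) /
        (r ^ 2 + a ^ 2 * c ^ 2) ^ 2)) r :=
    ((((hx.add_const (a ^ 2)).const_mul (s ^ 2)).add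
      (dh.const_mul (a ^ 2 * s ^ 4))).congr_deriv (by ring)).congr_of_eventuallyEq
      (Eventually.of_forall fun x => by simp only [Pi.add_apply]; ring)
  fin_cases i <;> fin_cases j
  all_goals first
    | exact hasDerivAt_const _ _
    | exact d00
    | exact dS
    | exact d11
    | exact d03
    | exact d33

theorem hasDerivAt_blComponents_θ {a r f θ : ℝ}
    (hS : r ^ 2 + a ^ 2 * Real.cos θ ^ 2 ≠ 0) (i j : Fin 4) :
    HasDerivAt (fun x => blComponents a r f (Real.sin x) (Real.cos x) i j)
      (blDθ a r f (Real.sin θ) (Real.cos θ) i j) θ := by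
  have hs := Real.hasDerivAt_sin θ
  have hc := Real.hasDerivAt_cos θ
  have hsc := Real.sin_sq θ
  have dS : HasDerivAt (fun x : ℝ => r ^ 2 + a ^ 2 * Real.cos x ^ 2)
      (-(2 * a ^ 2 * Real.sin θ * Real.cos θ)) θ :=
    (((hc.pow 2).const_mul (a ^ 2)).const_add (r ^ 2)).congr_deriv (by simp; ring)
  have dh : HasDerivAt (fun x : ℝ => 2 * f / (r ^ 2 + a ^ 2 * Real.cos x ^ 2))
      (4 * f * a ^ 2 * Real.sin θ * Real.cos θ / (r ^ 2 + a ^ 2 * Real.cos θ ^ 2) ^ 2) θ :=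
    ((hasDerivAt_const θ (2 * f)).div dS hS).congr_deriv (by ring)
  have d00 := dh.const_add (-1)
  have d11 := dS.div_const (r ^ 2 + a ^ 2 - 2 * f)
  have d03 : HasDerivAt
      (fun x : ℝ => -(2 * f * a * Real.sin x ^ 2 / (r ^ 2 + a ^ 2 * Real.cos x ^ 2)))
      (-(4 * f * a * Real.sin θ * Real.cos θ * (r ^ 2 + a ^ 2) /
        (r ^ 2 + a ^ 2 * Real.cos θ ^ 2) ^ 2)) θ :=
    ((((hs.pow 2).mul dh).const_mul a).neg.congr_deriv (by
      simp only [Pi.pow_apply, hsc]; field_simp; ring)).congr_of_eventuallyEq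
      (Eventually.of_forall fun x => by
        simp only [Pi.neg_apply, Pi.mul_apply, Pi.pow_apply]; ring)
  have d33 : HasDerivAt (fun x : ℝ => Real.sin x ^ 2 * (r ^ 2 + a ^ 2) +
        2 * f * a ^ 2 * Real.sin x ^ 4 / (r ^ 2 + a ^ 2 * Real.cos x ^ 2))
      (2 * Real.sin θ * Real.cos θ * (r ^ 2 + a ^ 2) +
        4 * a ^ 2 * Real.sin θ ^ 3 * Real.cos θ * f *
          (a ^ 2 * Real.sin θ ^ 2 + 2 * (r ^ 2 + a ^ 2 * Real.cos θ ^ 2)) /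
            (r ^ 2 + a ^ 2 * Real.cos θ ^ 2) ^ 2) θ :=
    (((hs.pow 2).mul_const (r ^ 2 + a ^ 2)).add
      (((hs.pow 4).mul dh).const_mul (a ^ 2))).congr_deriv (by
        simp only [Pi.pow_apply, Nat.cast_ofNat]; field_simp; ring) |>.congr_of_eventuallyEq
      (Eventually.of_forall fun x => by
        simp only [Pi.add_apply, Pi.mul_apply, Pi.pow_apply]; ring)
  fin_cases i <;> fin_cases j
  all_goals first
    | exact hasDerivAt_const _ _
    | exact d00
    | exact dS
    | exact d11
    | exact d03
    | exact d33

end RotatingBH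
end

/-! ### Regular points, and the curvature of a general stationary axisymmetric block metric -/

noncomputable section
namespace RotatingBH

theorem pd_congr {F G : Pt → ℝ} {p : Pt} (h : F =ᶠ[𝓝 p] G) (i : Fin 4) : pd i F p = pd i G p := by
  unfold pd
  apply EventuallyEq.deriv_eq
  have hc : Tendsto (fun s : ℝ => Function.update p i s) (𝓝 (p i)) (𝓝 p) := by
    have : Continuous fun s : ℝ => Function.update p i s := continuous_const.update i continuous_id
    simpa using this.tendsto (p i)
  exact hc.eventually h

/-- Derivatives of a stationary and axisymmetric field. -/
theorem pd_stationary {Φ : ℝ → ℝ → ℝ} {p : Pt} {dr dθ : ℝ}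
    (hr : HasDerivAt (fun x => Φ x (p 2)) dr (p 1)) (hθ : HasDerivAt (fun x => Φ (p 1) x) dθ (p 2))
    (i : Fin 4) : pd i (fun q => Φ (q 1) (q 2)) p = ![0, dr, dθ, 0] i := by
  fin_cases i <;> simp [pd]
  · exact hr.deriv
  · exact hθ.deriv

/-- The Boyer-Lindquist chart is regular at `p`, and the mass function is `C²` there. -/
structure BLRegular (a : ℝ) (M : ℝ → ℝ) (p : Pt) : Prop where
  smooth : ContDiffAt ℝ 2 M (p 1)
  sigma_ne : blSigma a (p 1) (p 2) ≠ 0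
  delta_ne : blDelta a M (p 1) ≠ 0
  sin_ne : Real.sin (p 2) ≠ 0

/-- Regularity is an open condition. Curvature differentiates formulas that are known only at
regular points, so they must hold in a whole neighbourhood. -/
theorem BLRegular.eventually {a : ℝ} {M : ℝ → ℝ} {p : Pt} (h : BLRegular a M p) :
    ∀ᶠ q in 𝓝 p, BLRegular a M q := by
  have h1 : ∀ᶠ q : Pt in 𝓝 p, ContDiffAt ℝ 2 M (q 1) :=
    (continuous_apply (1 : Fin 4)).continuousAt.eventually (h.smooth.eventually (by simp))
  have h2 : ∀ᶠ q : Pt in 𝓝 p, blSigma a (q 1) (q 2) ≠ 0 := by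
    have : Continuous (fun q : Pt => blSigma a (q 1) (q 2)) := by unfold blSigma; fun_prop
    exact this.continuousAt.eventually_ne h.sigma_ne
  have h3 : ∀ᶠ q : Pt in 𝓝 p, blDelta a M (q 1) ≠ 0 := by
    have hM : ContinuousAt M (p 1) := h.smooth.continuousAt
    have : ContinuousAt (fun q : Pt => blDelta a M (q 1)) p := by
      apply ContinuousAt.comp (f := fun q : Pt => q 1) (g := blDelta a M)
      · unfold blDelta; fun_prop
      · exact (continuous_apply (1 : Fin 4)).continuousAt
    exact this.eventually_ne h.delta_ne
  have h4 : ∀ᶠ q : Pt in 𝓝 p, Real.sin (q 2) ≠ 0 := by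
    have : Continuous (fun q : Pt => Real.sin (q 2)) := by fun_prop
    exact this.continuousAt.eventually_ne h.sin_ne
  filter_upwards [h1, h2, h3, h4] with q a1 a2 a3 a4 using ⟨a1, a2, a3, a4⟩

section
variable {a : ℝ} {M : ℝ → ℝ} {p : Pt}

theorem BLRegular.delta_ne' (h : BLRegular a M p) :
    p 1 ^ 2 + a ^ 2 - 2 * (M (p 1) * p 1) ≠ 0 := by
  have := h.delta_ne
  unfold blDelta at this
  intro h0; apply this; linarith

theorem BLRegular.inverse (h : BLRegular a M p) :
    (blMetric a M p)⁻¹ =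
      blInverse a (p 1) (M (p 1) * p 1) (Real.sin (p 2)) (Real.cos (p 2)) := by
  rw [blMetric_eq_components a M p h.sigma_ne]
  exact Matrix.inv_eq_right_inv
    (blComponents_mul_blInverse h.sigma_ne h.delta_ne' h.sin_ne (Real.cos_sq' _))

theorem BLRegular.hasDerivAt_mul (h : BLRegular a M p) :
    HasDerivAt (fun x => M x * x) (deriv (fun x => M x * x) (p 1)) (p 1) := by
  apply DifferentiableAt.hasDerivAt
  have := h.smooth.differentiableAt (by norm_num)
  fun_prop

theorem BLRegular.hasDerivAt_deriv_mul (h : BLRegular a M p) :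
    HasDerivAt (deriv (fun x => M x * x)) (deriv (deriv (fun x => M x * x)) (p 1)) (p 1) := by
  apply DifferentiableAt.hasDerivAt
  have h1 : ContDiffAt ℝ 2 (fun x => M x * x) (p 1) := h.smooth.mul contDiffAt_id
  have h2 : ContDiffAt ℝ 1 (deriv (fun x => M x * x)) (p 1) :=
    h1.derivWithin (m := 1) (by norm_num)
  exact h2.differentiableAt (by norm_num)

theorem BLRegular.pd_metric (h : BLRegular a M p) (l i j : Fin 4) :
    pd l (fun q => blMetric a M q i j) p =
      ![0, blDr a (p 1) (M (p 1) * p 1) (deriv (fun x => M x * x) (p 1)) (Real.sin (p 2))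
          (Real.cos (p 2)) i j,
        blDθ a (p 1) (M (p 1) * p 1) (Real.sin (p 2)) (Real.cos (p 2)) i j, 0] l := by
  rw [pd_congr (G := fun q => blComponents a (q 1) (M (q 1) * q 1) (Real.sin (q 2))
    (Real.cos (q 2)) i j)]
  · exact pd_stationary (Φ := fun x θ => blComponents a x (M x * x) (Real.sin θ) (Real.cos θ) i j)
      (hasDerivAt_blComponents_r h.hasDerivAt_mul h.sigma_ne h.delta_ne' i j)
      (hasDerivAt_blComponents_θ h.sigma_ne i j) l
  · filter_upwards [h.eventually] with q hq
    rw [blMetric_eq_components a M q hq.sigma_ne]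

end

/-- The Christoffel symbols `Γᵏᵢⱼ` of a stationary and axisymmetric metric whose `(t, φ)` block does
not mix with `r` and `θ`. The field `t_rf` is `Γᵗ` with the lower indices `r` and `φ`. -/
structure AxialSymbols where
  t_tr : ℝ
  t_tθ : ℝ
  t_rf : ℝ
  t_θf : ℝ
  r_tt : ℝ
  r_tf : ℝ
  r_ff : ℝ
  r_rr : ℝ
  r_rθ : ℝ
  r_θθ : ℝ
  θ_tt : ℝ
  θ_tf : ℝ
  θ_ff : ℝ
  θ_rr : ℝ
  θ_rθ : ℝ
  θ_θθ : ℝ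
  f_tr : ℝ
  f_tθ : ℝ
  f_rf : ℝ
  f_θf : ℝ

/-- The array of the symbols `Γᵏᵢⱼ`. -/
def AxialSymbols.symbol (G : AxialSymbols) : Fin 4 → Matrix (Fin 4) (Fin 4) ℝ :=
  ![!![0, G.t_tr, G.t_tθ, 0; G.t_tr, 0, 0, G.t_rf; G.t_tθ, 0, 0, G.t_θf; 0, G.t_rf, G.t_θf, 0],
    !![G.r_tt, 0, 0, G.r_tf; 0, G.r_rr, G.r_rθ, 0; 0, G.r_rθ, G.r_θθ, 0; G.r_tf, 0, 0, G.r_ff],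
    !![G.θ_tt, 0, 0, G.θ_tf; 0, G.θ_rr, G.θ_rθ, 0; 0, G.θ_rθ, G.θ_θθ, 0; G.θ_tf, 0, 0, G.θ_ff],
    !![0, G.f_tr, G.f_tθ, 0; G.f_tr, 0, 0, G.f_rf; G.f_tθ, 0, 0, G.f_θf; 0, G.f_rf, G.f_θf, 0]]

theorem christoffel_block {g : MetricField} {x : Pt} {p q w u v α β ε γ δ α' β' ε' γ' δ' : ℝ}
    (hinv : (g x)⁻¹ = blockMatrix p q w u v)
    (hd : ∀ l i j, pd l (fun y => g y i j) x = ![0, blockMatrix α β ε γ δ i j,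
      blockMatrix α' β' ε' γ' δ' i j, 0] l) (k i j : Fin 4) :
    christoffel g k i j x = AxialSymbols.symbol
      { t_tr := (p * α + q * β) / 2, t_tθ := (p * α' + q * β') / 2
        t_rf := (p * β + q * ε) / 2, t_θf := (p * β' + q * ε') / 2
        r_tt := -(u * α / 2), r_tf := -(u * β / 2), r_ff := -(u * ε / 2)
        r_rr := u * γ / 2, r_rθ := u * γ' / 2, r_θθ := -(u * δ / 2)
        θ_tt := -(v * α' / 2), θ_tf := -(v * β' / 2), θ_ff := -(v * ε' / 2)
        θ_rr := -(v * γ' / 2), θ_rθ := v * δ / 2, θ_θθ := v * δ' / 2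
        f_tr := (q * α + w * β) / 2, f_tθ := (q * α' + w * β') / 2
        f_rf := (q * β + w * ε) / 2, f_θf := (q * β' + w * ε') / 2 } k i j := by
  rw [christoffel, hinv]
  simp only [hd, Fin.sum_univ_four]
  fin_cases k <;> fin_cases i <;> fin_cases j <;>
    simp [blockMatrix, AxialSymbols.symbol] <;> ring

/-- No differentiability is needed: both sides are `deriv` of the same one-variable function,
whatever value it takes. -/
theorem pd_stationary_eq (Φ : ℝ → ℝ → ℝ) (p : Pt) (i : Fin 4) :
    pd i (fun q => Φ (q 1) (q 2)) p =
      ![0, deriv (fun x => Φ x (p 2)) (p 1), deriv (fun x => Φ (p 1) x) (p 2), 0] i := by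
  fin_cases i <;> simp [pd]

/-- The reflection $(t,\varphi)\mapsto(-t,-\varphi)$ preserves such a metric, so the components with
exactly one index in $\{t,\varphi\}$ vanish. The $r\theta$ components are left out on purpose: no
contraction used later sees them. -/
theorem ricci_block {g : MetricField} {p : Pt} {Γ : ℝ → ℝ → AxialSymbols}
    (h : ∀ᶠ q in 𝓝 p, ∀ k i j, christoffel g k i j q = (Γ (q 1) (q 2)).symbol k i j) :
    let r := p 1
    let θ := p 2
    let G := Γ r θ
    let trr := G.t_tr + G.r_rr + G.θ_rθ + G.f_rf
    let trθ := G.t_tθ + G.r_rθ + G.θ_θθ + G.f_θf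
    (ricci g p 0 0 = deriv (fun x => (Γ x θ).r_tt) r + deriv (fun x => (Γ r x).θ_tt) θ
      + trr * G.r_tt + trθ * G.θ_tt
      - 2 * (G.r_tt * G.t_tr + G.r_tf * G.f_tr + G.θ_tt * G.t_tθ + G.θ_tf * G.f_tθ)) ∧
    (ricci g p 0 3 = deriv (fun x => (Γ x θ).r_tf) r + deriv (fun x => (Γ r x).θ_tf) θ
      + trr * G.r_tf + trθ * G.θ_tf
      - (G.r_tf * G.t_tr + G.r_ff * G.f_tr + G.t_rf * G.r_tt + G.f_rf * G.r_tf)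
      - (G.θ_tf * G.t_tθ + G.θ_ff * G.f_tθ + G.t_θf * G.θ_tt + G.f_θf * G.θ_tf)) ∧
    (ricci g p 3 3 = deriv (fun x => (Γ x θ).r_ff) r + deriv (fun x => (Γ r x).θ_ff) θ
      + trr * G.r_ff + trθ * G.θ_ff
      - 2 * (G.r_tf * G.t_rf + G.r_ff * G.f_rf + G.θ_tf * G.t_θf + G.θ_ff * G.f_θf)) ∧
    (ricci g p 1 1 = deriv (fun x => (Γ r x).θ_rr) θ
      - deriv (fun x => (Γ x θ).t_tr) r - deriv (fun x => (Γ x θ).θ_rθ) r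
      - deriv (fun x => (Γ x θ).f_rf) r + trr * G.r_rr + trθ * G.θ_rr
      - (G.t_tr ^ 2 + 2 * G.t_rf * G.f_tr + G.f_rf ^ 2 + G.r_rr ^ 2 + 2 * G.r_rθ * G.θ_rr
        + G.θ_rθ ^ 2)) ∧
    (ricci g p 2 2 = deriv (fun x => (Γ x θ).r_θθ) r
      - deriv (fun x => (Γ r x).t_tθ) θ - deriv (fun x => (Γ r x).r_rθ) θ
      - deriv (fun x => (Γ r x).f_θf) θ + trr * G.r_θθ + trθ * G.θ_θθ
      - (G.t_tθ ^ 2 + 2 * G.t_θf * G.f_tθ + G.f_θf ^ 2 + G.r_rθ ^ 2 + 2 * G.r_θθ * G.θ_rθ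
        + G.θ_θθ ^ 2)) ∧
    ricci g p 3 0 = ricci g p 0 3 ∧
    ricci g p 0 1 = 0 ∧ ricci g p 1 0 = 0 ∧ ricci g p 0 2 = 0 ∧ ricci g p 2 0 = 0 ∧
    ricci g p 3 1 = 0 ∧ ricci g p 1 3 = 0 ∧ ricci g p 3 2 = 0 ∧ ricci g p 2 3 = 0 := by
  have h0 : ∀ k i j, christoffel g k i j p = (Γ (p 1) (p 2)).symbol k i j := h.self_of_nhds
  have h1 : ∀ l k i j, pd l (christoffel g k i j) p =
      ![0, deriv (fun x => (Γ x (p 2)).symbol k i j) (p 1),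
        deriv (fun x => (Γ (p 1) x).symbol k i j) (p 2), 0] l := fun l k i j => by
    rw [← pd_stationary_eq (fun r θ => (Γ r θ).symbol k i j)]
    exact pd_congr (h.mono fun q hq => hq k i j) l
  intro r θ G trr trθ
  simp only [ricci, Matrix.of_apply, h0, h1, Fin.sum_univ_four]
  simp only [trr, trθ, G, r, θ]
  refine ⟨?_, ?_, ?_, ?_, ?_, ?_, ?_, ?_, ?_, ?_, ?_, ?_, ?_, ?_⟩ <;>
    simp [AxialSymbols.symbol] <;> ring

end RotatingBH
end

/-! ### Christoffel symbols of the Boyer–Lindquist metric -/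

noncomputable section
namespace RotatingBH

/-- The Christoffel symbols in Boyer-Lindquist coordinates, with `f = r 𝓜(r)`, `f₁ = f'(r)`,
`s = sin θ`, `c = cos θ`. -/
def blSymbols (a r f f₁ s c : ℝ) : AxialSymbols :=
  let S := r ^ 2 + a ^ 2 * c ^ 2
  let D := r ^ 2 + a ^ 2 - 2 * f
  let R := r ^ 2 + a ^ 2
  let h := f₁ / S - 2 * r * f / S ^ 2
  { t_tr := -(h * R / D)
    t_tθ := -(2 * a ^ 2 * f * s * c / S ^ 2)
    t_rf := a * s ^ 2 * (h * R / D - 2 * r * f / (S * D))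
    t_θf := 2 * a ^ 3 * f * s ^ 3 * c / S ^ 2
    r_tt := -(D * h / S)
    r_tf := a * s ^ 2 * (D * h / S)
    r_ff := -(D * (r * s ^ 2 + a ^ 2 * s ^ 4 * h) / S)
    r_rr := r / S - (r - f₁) / D
    r_rθ := -(a ^ 2 * s * c / S)
    r_θθ := -(r * D / S)
    θ_tt := -(2 * a ^ 2 * f * s * c / S ^ 3)
    θ_tf := 2 * a * f * s * c * R / S ^ 3
    θ_ff := -(s * c * (R / S + 2 * a ^ 2 * s ^ 2 * f * (a ^ 2 * s ^ 2 + 2 * S) / S ^ 3))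
    θ_rr := a ^ 2 * s * c / (S * D)
    θ_rθ := r / S
    θ_θθ := -(a ^ 2 * s * c / S)
    f_tr := -(a * h / D)
    f_tθ := -(2 * a * f * c / (s * S ^ 2))
    f_rf := a ^ 2 * s ^ 2 * h / D + r * (D - a ^ 2 * s ^ 2) / (D * S)
    f_θf := c / s * (1 + 2 * a ^ 2 * f * s ^ 2 / S ^ 2) }

theorem christoffel_blMetric {a : ℝ} {M : ℝ → ℝ} {p : Pt} (h : BLRegular a M p) (k i j : Fin 4) :
    christoffel (blMetric a M) k i j p =
      (blSymbols a (p 1) (M (p 1) * p 1) (deriv (fun x => M x * x) (p 1)) (Real.sin (p 2))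
        (Real.cos (p 2))).symbol k i j := by
  have hS := h.sigma_ne
  have hD := h.delta_ne'
  have hs := h.sin_ne
  have hsc := Real.cos_sq' (p 2)
  rw [christoffel_block h.inverse h.pd_metric]
  unfold blSigma at hS
  congr 1
  simp only [blSymbols]
  generalize deriv (fun x => M x * x) (p 1) = f₁
  generalize M (p 1) * p 1 = f at *
  generalize p 1 = r at *
  generalize Real.sin (p 2) = s at *
  generalize Real.cos (p 2) = c at *
  generalize hSd : r ^ 2 + a ^ 2 * c ^ 2 = S at *
  generalize hDd : r ^ 2 + a ^ 2 - 2 * f = D at *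
  -- Solving for $f$ makes the denominators $S$ and $D$ atoms for `field_simp`. Afterwards only $S$
  -- is expanded and $c^2$ replaced by $1-s^2$; the same device recurs in the curvature
  -- computations.
  have hf : f = (r ^ 2 + a ^ 2 - D) / 2 := by linarith
  subst hf
  simp only [AxialSymbols.mk.injEq]
  refine ⟨?_, ?_, ?_, ?_, ?_, ?_, ?_, ?_, ?_, ?_, ?_, ?_, ?_, ?_, ?_, ?_, ?_, ?_, ?_, ?_⟩ <;>
    field_simp <;> (try rw [← hSd, hsc]) <;> ring
end RotatingBH
end

/-! ### Derivatives of the Christoffel symbols -/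

noncomputable section
namespace RotatingBH

section
variable {a r s c f₁ f₂ : ℝ} {f g : ℝ → ℝ}

theorem hasDerivAt_sq_add (r b : ℝ) : HasDerivAt (fun x : ℝ => x ^ 2 + b) (2 * r) r := by
  simpa using (hasDerivAt_pow 2 r).add_const b

theorem hasDerivAt_horizon (hf : HasDerivAt f f₁ r) :
    HasDerivAt (fun x => x ^ 2 + a ^ 2 - 2 * f x) (2 * r - 2 * f₁) r :=
  (hasDerivAt_sq_add r _).sub (hf.const_mul 2)

/-- The differentiated function is $h=\partial_r(f/S)$, through which $f'$ enters most of the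
symbols. The function `g` stands for $f'$, kept separate so that $f''$ enters only as its derivative
at $r$. -/
theorem hasDerivAt_massDensity (hf : HasDerivAt f f₁ r) (hg : HasDerivAt g f₂ r) (hgf : g r = f₁)
    (hS : r ^ 2 + a ^ 2 * c ^ 2 ≠ 0) :
    HasDerivAt (fun x => g x / (x ^ 2 + a ^ 2 * c ^ 2) - 2 * x * f x / (x ^ 2 + a ^ 2 * c ^ 2) ^ 2)
      (f₂ / (r ^ 2 + a ^ 2 * c ^ 2) - (4 * r * f₁ + 2 * f r) / (r ^ 2 + a ^ 2 * c ^ 2) ^ 2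
        + 8 * r ^ 2 * f r / (r ^ 2 + a ^ 2 * c ^ 2) ^ 3) r := by
  have dS := hasDerivAt_sq_add r (a ^ 2 * c ^ 2)
  have h2x : HasDerivAt (fun x : ℝ => 2 * x) 2 r := by simpa using (hasDerivAt_id r).const_mul 2
  refine ((hg.fun_div dS hS).fun_sub
    ((h2x.fun_mul hf).fun_div (dS.fun_pow 2) (pow_ne_zero 2 hS))).congr_deriv ?_
  rw [hgf]
  push_cast
  field_simp
  ring

theorem deriv_symbols_r (hf : HasDerivAt f f₁ r) (hg : HasDerivAt g f₂ r) (hgf : g r = f₁)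
    (hS : r ^ 2 + a ^ 2 * c ^ 2 ≠ 0) (hD : r ^ 2 + a ^ 2 - 2 * f r ≠ 0) :
    let S := r ^ 2 + a ^ 2 * c ^ 2
    let D := r ^ 2 + a ^ 2 - 2 * f r
    let D₁ := 2 * r - 2 * f₁
    let R := r ^ 2 + a ^ 2
    let h := f₁ / S - 2 * r * f r / S ^ 2
    let h₁ := f₂ / S - (4 * r * f₁ + 2 * f r) / S ^ 2 + 8 * r ^ 2 * f r / S ^ 3
    deriv (fun x => (blSymbols a x (f x) (g x) s c).r_tt) r =
      -((D₁ * h + D * h₁) / S - D * h * (2 * r) / S ^ 2) ∧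
    deriv (fun x => (blSymbols a x (f x) (g x) s c).r_tf) r =
      a * s ^ 2 * ((D₁ * h + D * h₁) / S - D * h * (2 * r) / S ^ 2) ∧
    deriv (fun x => (blSymbols a x (f x) (g x) s c).r_ff) r =
      -((D₁ * (r * s ^ 2 + a ^ 2 * s ^ 4 * h) + D * (s ^ 2 + a ^ 2 * s ^ 4 * h₁)) / S
        - D * (r * s ^ 2 + a ^ 2 * s ^ 4 * h) * (2 * r) / S ^ 2) ∧
    deriv (fun x => (blSymbols a x (f x) (g x) s c).t_tr) r =
      -((h₁ * R + h * (2 * r)) / D - h * R * D₁ / D ^ 2) ∧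
    deriv (fun x => (blSymbols a x (f x) (g x) s c).θ_rθ) r = 1 / S - 2 * r ^ 2 / S ^ 2 ∧
    deriv (fun x => (blSymbols a x (f x) (g x) s c).f_rf) r =
      a ^ 2 * s ^ 2 * (h₁ / D - h * D₁ / D ^ 2) + ((D - a ^ 2 * s ^ 2) + r * D₁) / (D * S)
        - r * (D - a ^ 2 * s ^ 2) * (D₁ * S + D * (2 * r)) / (D * S) ^ 2 ∧
    deriv (fun x => (blSymbols a x (f x) (g x) s c).r_θθ) r =
      -((D + r * D₁) / S - r * D * (2 * r) / S ^ 2) := by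
  have dS := hasDerivAt_sq_add r (a ^ 2 * c ^ 2)
  have dR := hasDerivAt_sq_add r (a ^ 2)
  have dD := hasDerivAt_horizon (a := a) hf
  have dh := hasDerivAt_massDensity hf hg hgf hS
  have dx := hasDerivAt_id' r
  subst hgf
  intro S D D₁ R h h₁
  have dtt := (dD.fun_mul dh).fun_div dS hS
  refine ⟨dtt.fun_neg.deriv.trans ?_, (dtt.const_mul (a * s ^ 2)).deriv.trans ?_,
    ((dD.fun_mul ((dx.mul_const (s ^ 2)).fun_add (dh.const_mul (a ^ 2 * s ^ 4)))).fun_div dS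
      hS).fun_neg.deriv.trans ?_, ((dh.fun_mul dR).fun_div dD hD).fun_neg.deriv.trans ?_,
    (dx.fun_div dS hS).deriv.trans ?_,
    (((dh.const_mul (a ^ 2 * s ^ 2)).fun_div dD hD).fun_add
      ((dx.fun_mul (dD.sub_const (a ^ 2 * s ^ 2))).fun_div (dD.fun_mul dS)
        (mul_ne_zero hD hS))).deriv.trans ?_,
    ((dx.fun_mul dD).fun_div dS hS).fun_neg.deriv.trans ?_⟩ <;>
  simp only [S, D, D₁, R, h, h₁] <;>
  generalize r ^ 2 + a ^ 2 * c ^ 2 = S at hS ⊢ <;>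
  generalize r ^ 2 + a ^ 2 - 2 * f r = D at hD ⊢ <;>
  field_simp <;> ring

end

theorem deriv_symbols_θ {a r θ f f₁ : ℝ} (hS : r ^ 2 + a ^ 2 * Real.cos θ ^ 2 ≠ 0)
    (hs : Real.sin θ ≠ 0) :
    let s := Real.sin θ
    let c := Real.cos θ
    let S := r ^ 2 + a ^ 2 * c ^ 2
    let S₂ := -(2 * a ^ 2 * s * c)
    let D := r ^ 2 + a ^ 2 - 2 * f
    let R := r ^ 2 + a ^ 2
    let Γ := fun x => blSymbols a r f f₁ (Real.sin x) (Real.cos x)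
    deriv (fun x => (Γ x).θ_tt) θ =
      -(2 * a ^ 2 * f * ((c ^ 2 - s ^ 2) / S ^ 3 - 3 * s * c * S₂ / S ^ 4)) ∧
    deriv (fun x => (Γ x).θ_tf) θ =
      2 * a * f * R * ((c ^ 2 - s ^ 2) / S ^ 3 - 3 * s * c * S₂ / S ^ 4) ∧
    deriv (fun x => (Γ x).θ_ff) θ =
      -((c ^ 2 - s ^ 2) * (R / S + 2 * a ^ 2 * s ^ 2 * f * (a ^ 2 * s ^ 2 + 2 * S) / S ^ 3)
        + s * c * (-(R * S₂ / S ^ 2) + 2 * a ^ 2 * f * (4 * a ^ 2 * s ^ 3 * c / S ^ 3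
          - 3 * a ^ 2 * s ^ 4 * S₂ / S ^ 4 + 4 * s * c / S ^ 2 - 4 * s ^ 2 * S₂ / S ^ 3))) ∧
    deriv (fun x => (Γ x).θ_rr) θ = a ^ 2 / D * ((c ^ 2 - s ^ 2) / S - s * c * S₂ / S ^ 2) ∧
    deriv (fun x => (Γ x).t_tθ) θ =
      -(2 * a ^ 2 * f * ((c ^ 2 - s ^ 2) / S ^ 2 - 2 * s * c * S₂ / S ^ 3)) ∧
    deriv (fun x => (Γ x).r_rθ) θ = -(a ^ 2 * ((c ^ 2 - s ^ 2) / S - s * c * S₂ / S ^ 2)) ∧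
    deriv (fun x => (Γ x).f_θf) θ = -(1 / s ^ 2)
      + 2 * a ^ 2 * f * ((c ^ 2 - s ^ 2) / S ^ 2 - 2 * s * c * S₂ / S ^ 3) := by
  have ds := Real.hasDerivAt_sin θ
  have dc := Real.hasDerivAt_cos θ
  have dS : HasDerivAt (fun x : ℝ => r ^ 2 + a ^ 2 * Real.cos x ^ 2)
      (-(2 * a ^ 2 * Real.sin θ * Real.cos θ)) θ :=
    (((dc.fun_pow 2).const_mul (a ^ 2)).const_add (r ^ 2)).congr_deriv (by simp; ring)
  intro s c S S₂ D R Γ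
  have hsc : c ^ 2 = 1 - s ^ 2 := Real.cos_sq' θ
  -- Each symbol is differentiated in a rearranged form that may agree with it only near $\theta$,
  -- where $S$ and $\sin\theta$ stay nonzero.
  have key : ∀ {F G : ℝ → ℝ} {F' v : ℝ}, HasDerivAt F F' θ → (∀ᶠ x in 𝓝 θ, G x = F x) → F' = v →
      deriv G θ = v := fun h h1 h2 => by rw [EventuallyEq.deriv_eq h1, h.deriv, h2]
  have d1 := fun n => (ds.fun_mul dc).fun_div (dS.fun_pow n) (pow_ne_zero n hS)
  have hs' : ∀ᶠ x in 𝓝 θ, Real.sin x ≠ 0 := Real.continuous_sin.continuousAt.eventually_ne hs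
  have dq := ((dS.fun_pow 1).fun_inv (pow_ne_zero 1 hS)).const_mul R |>.fun_add
    ((((ds.fun_pow 4).fun_div (dS.fun_pow 3) (pow_ne_zero 3 hS)).const_mul (a ^ 2) |>.fun_add
      (((ds.fun_pow 2).fun_div (dS.fun_pow 2) (pow_ne_zero 2 hS)).const_mul 2)).const_mul
        (2 * a ^ 2 * f))
  have hS' : ∀ᶠ x in 𝓝 θ, r ^ 2 + a ^ 2 * Real.cos x ^ 2 ≠ 0 := dS.continuousAt.eventually_ne hS
  refine ⟨key ((d1 3).const_mul (-(2 * a ^ 2 * f))) (Eventually.of_forall fun x => ?_) ?_,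
    key ((d1 3).const_mul (2 * a * f * R)) (Eventually.of_forall fun x => ?_) ?_,
    key ((ds.fun_mul dc).fun_mul dq).fun_neg (hS'.mono fun x hx => ?_) ?_,
    key ((d1 1).const_mul (a ^ 2 / D)) (Eventually.of_forall fun x => ?_) ?_,
    key ((d1 2).const_mul (-(2 * a ^ 2 * f))) (Eventually.of_forall fun x => ?_) ?_,
    key ((d1 1).const_mul (-a ^ 2)) (Eventually.of_forall fun x => ?_) ?_,
    key ((dc.fun_div ds hs).fun_add ((d1 2).const_mul (2 * a ^ 2 * f)))
      (hs'.mono fun x hx => ?_) ?_⟩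
  all_goals
    simp only [Γ, blSymbols, D, S, R, S₂, s, c, pow_one, Nat.cast_ofNat, Nat.cast_one]
  · ring
  · generalize r ^ 2 + a ^ 2 * Real.cos θ ^ 2 = S at hS ⊢
    field_simp
    ring
  · ring
  · generalize r ^ 2 + a ^ 2 * Real.cos θ ^ 2 = S at hS ⊢
    field_simp
    ring
  · field_simp
  · generalize r ^ 2 + a ^ 2 * Real.cos θ ^ 2 = S at hS ⊢
    field_simp
    ring
  · generalize r ^ 2 + a ^ 2 * Real.cos x ^ 2 = S
    generalize r ^ 2 + a ^ 2 - 2 * f = D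
    ring
  · generalize r ^ 2 + a ^ 2 * Real.cos θ ^ 2 = S at hS ⊢
    field_simp
    ring
  · ring
  · generalize r ^ 2 + a ^ 2 * Real.cos θ ^ 2 = S at hS ⊢
    field_simp
    ring
  · ring
  · generalize r ^ 2 + a ^ 2 * Real.cos θ ^ 2 = S at hS ⊢
    field_simp
    ring
  · field_simp
  · have h1 : -Real.sin θ * Real.sin θ - Real.cos θ * Real.cos θ = -1 := by
      linarith [Real.sin_sq_add_cos_sq θ]
    rw [h1]
    generalize r ^ 2 + a ^ 2 * Real.cos θ ^ 2 = S at hS ⊢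
    field_simp
    ring

end RotatingBH
end

/-! ### The Ricci tensor and its two eigenvalues -/

noncomputable section
namespace RotatingBH

/-- The eigenvalue of the Ricci tensor on the `(t, r)` plane of the tetrad. -/
def ricciRadial (a r f f₁ f₂ c : ℝ) : ℝ :=
  f₂ / (r ^ 2 + a ^ 2 * c ^ 2) - 2 * (r * f₁ - f) / (r ^ 2 + a ^ 2 * c ^ 2) ^ 2

/-- The eigenvalue of the Ricci tensor on the `(θ, φ)` plane of the tetrad. -/
def ricciAngular (a r f f₁ c : ℝ) : ℝ := 2 * (r * f₁ - f) / (r ^ 2 + a ^ 2 * c ^ 2) ^ 2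

-- The right-hand sides are the components of $A(-e^0e^0+e^1e^1)+B(e^2e^2+e^3e^3)$ in the
-- orthonormal coframe $e^0=\sqrt{D/S}\,(dt-a\sin^2\theta\,d\varphi)$, $e^1=\sqrt{S/D}\,dr$,
-- $e^2=\sqrt S\,d\theta$, $e^3=\tfrac{\sin\theta}{\sqrt S}(a\,dt-(r^2+a^2)d\varphi)$, for $D>0$;
-- only squares of the roots occur.
set_option maxHeartbeats 1000000 in
theorem ricci_blMetric {a : ℝ} {M : ℝ → ℝ} {p : Pt} (hp : BLRegular a M p) :
    let r := p 1
    let f := M r * r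
    let f₁ := deriv (fun x => M x * x) r
    let f₂ := deriv (deriv (fun x => M x * x)) r
    let s := Real.sin (p 2)
    let c := Real.cos (p 2)
    let S := r ^ 2 + a ^ 2 * c ^ 2
    let D := r ^ 2 + a ^ 2 - 2 * f
    let A := ricciRadial a r f f₁ f₂ c
    let B := ricciAngular a r f f₁ c
    ricci (blMetric a M) p 0 0 = -(A * D / S) + B * a ^ 2 * s ^ 2 / S ∧
    ricci (blMetric a M) p 0 3 = A * D * a * s ^ 2 / S - B * a * s ^ 2 * (r ^ 2 + a ^ 2) / S ∧
    ricci (blMetric a M) p 3 3 =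
      -(A * D * a ^ 2 * s ^ 4 / S) + B * s ^ 2 * (r ^ 2 + a ^ 2) ^ 2 / S ∧
    ricci (blMetric a M) p 1 1 = A * S / D ∧
    ricci (blMetric a M) p 2 2 = B * S := by
  have hev : ∀ᶠ q in 𝓝 p, ∀ k i j, christoffel (blMetric a M) k i j q =
      (blSymbols a (q 1) (M (q 1) * q 1) (deriv (fun x => M x * x) (q 1)) (Real.sin (q 2))
        (Real.cos (q 2))).symbol k i j :=
    hp.eventually.mono fun q hq k i j => christoffel_blMetric hq k i j
  obtain ⟨h00, h03, h33, h11, h22, -⟩ := ricci_block (g := blMetric a M) (p := p)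
    (Γ := fun r θ => blSymbols a r (M r * r) (deriv (fun x => M x * x) r) (Real.sin θ)
        (Real.cos θ)) hev
  have hS : p 1 ^ 2 + a ^ 2 * Real.cos (p 2) ^ 2 ≠ 0 := hp.sigma_ne
  have hD := hp.delta_ne'
  have hs := hp.sin_ne
  have hsc := Real.cos_sq' (p 2)
  obtain ⟨r1, r2, r3, r4, r5, r6, r7⟩ := deriv_symbols_r (a := a) (s := Real.sin (p 2))
    (c := Real.cos (p 2)) hp.hasDerivAt_mul hp.hasDerivAt_deriv_mul rfl hS hD
  obtain ⟨t1, t2, t3, t4, t5, t6, t7⟩ := deriv_symbols_θ (a := a) (r := p 1) (θ := p 2)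
    (f := M (p 1) * p 1) (f₁ := deriv (fun x => M x * x) (p 1)) hS hs
  rw [r1, t1] at h00
  rw [r2, t2] at h03
  rw [r3, t3] at h33
  rw [t4, r4, r5, r6] at h11
  rw [r7, t5, t6, t7] at h22
  clear r1 r2 r3 r4 r5 r6 r7 t1 t2 t3 t4 t5 t6 t7 hev
  intro r f f₁ f₂ s c S D A B
  rw [h00, h03, h33, h11, h22]
  clear h00 h03 h33 h11 h22
  simp only [blSymbols, A, B, ricciRadial, ricciAngular, S, D, f₁, f₂, f, s, c, r]
  clear A B S D f₁ f₂ f s c r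
  generalize deriv (deriv fun x => M x * x) (p 1) = f₂
  generalize deriv (fun x => M x * x) (p 1) = f₁
  generalize M (p 1) * p 1 = f at *
  clear hp
  generalize p 1 = r at *
  generalize Real.sin (p 2) = s at *
  generalize Real.cos (p 2) = c at *
  generalize hSd : r ^ 2 + a ^ 2 * c ^ 2 = S at *
  generalize hDd : r ^ 2 + a ^ 2 - 2 * f = D at *
  have hf : f = (r ^ 2 + a ^ 2 - D) / 2 := by linarith
  subst hf
  refine ⟨?_, ?_, ?_, ?_, ?_⟩
  · field_simp
    rw [← hSd, hsc]
    ring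
  · field_simp
    rw [← hSd, hsc]
    ring
  · field_simp
    rw [← hSd, hsc]
    ring
  · field_simp
    rw [← hSd, hsc]
    ring
  · field_simp
    rw [← hSd, hsc]
    ring
end RotatingBH
end

/-! ### Curvature scalar and tetrad components of the energy-momentum tensor -/

noncomputable section
namespace RotatingBH

/-- The unknowns `u` and `v` are the uncomputed $r\theta$ components. They drop out of the trace,
and of every quadratic form on a vector lacking an $r$ or a $\theta$ component. -/
theorem ricci_blMetric_eq {a : ℝ} {M : ℝ → ℝ} {p : Pt} (hp : BLRegular a M p) :
    let r := p 1
    let f := M r * r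
    let f₁ := deriv (fun x => M x * x) r
    let f₂ := deriv (deriv (fun x => M x * x)) r
    let s := Real.sin (p 2)
    let c := Real.cos (p 2)
    let S := r ^ 2 + a ^ 2 * c ^ 2
    let D := r ^ 2 + a ^ 2 - 2 * f
    let A := ricciRadial a r f f₁ f₂ c
    let B := ricciAngular a r f f₁ c
    ∃ u v, ricci (blMetric a M) p =
      blockMatrix (-(A * D / S) + B * a ^ 2 * s ^ 2 / S)
        (A * D * a * s ^ 2 / S - B * a * s ^ 2 * (r ^ 2 + a ^ 2) / S)
        (-(A * D * a ^ 2 * s ^ 4 / S) + B * s ^ 2 * (r ^ 2 + a ^ 2) ^ 2 / S) (A * S / D) (B * S)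
      + !![0, 0, 0, 0; 0, 0, u, 0; 0, v, 0, 0; 0, 0, 0, 0] := by
  intro r f f₁ f₂ s c S D A B
  obtain ⟨h00, h03, h33, h11, h22⟩ := ricci_blMetric hp
  have hev : ∀ᶠ q in 𝓝 p, ∀ k i j, christoffel (blMetric a M) k i j q =
      (blSymbols a (q 1) (M (q 1) * q 1) (deriv (fun x => M x * x) (q 1)) (Real.sin (q 2))
        (Real.cos (q 2))).symbol k i j :=
    hp.eventually.mono fun q hq k i j => christoffel_blMetric hq k i j
  obtain ⟨-, -, -, -, -, h30, h01, h10, h02, h20, h31, h13, h32, h23⟩ :=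
    ricci_block (g := blMetric a M) (p := p)
      (Γ := fun r θ => blSymbols a r (M r * r) (deriv (fun x => M x * x) r) (Real.sin θ)
        (Real.cos θ)) hev
  refine ⟨ricci (blMetric a M) p 1 2, ricci (blMetric a M) p 2 1, ?_⟩
  rw [h03] at h30
  ext i j
  fin_cases i <;> fin_cases j
  all_goals simp only [Matrix.add_apply, blockMatrix]
  · simpa using h00
  · simpa using h01
  · simpa using h02
  · simpa using h03
  · simpa using h10
  · simpa using h11
  · simp
  · simpa using h13
  · simpa using h20
  · simp
  · simpa using h22
  · simpa using h23
  · simpa using h30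
  · simpa using h31
  · simpa using h32
  · simpa using h33

section
variable {a : ℝ} {M : ℝ → ℝ} {p : Pt}

/-- The trace is $2A+2B$, in which the terms with $rf'-f$ cancel. -/
theorem BLRegular.curvScalar_eq (hp : BLRegular a M p) :
    curvScalar a M p = 2 * deriv (deriv (fun x => M x * x)) (p 1) / blSigma a (p 1) (p 2) := by
  have hS : p 1 ^ 2 + a ^ 2 * Real.cos (p 2) ^ 2 ≠ 0 := hp.sigma_ne
  have hD := hp.delta_ne'
  have hs := hp.sin_ne
  have hsc := Real.cos_sq' (p 2)
  obtain ⟨u, v, h⟩ := ricci_blMetric_eq hp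
  rw [curvScalar, scalarCurvature, h, hp.inverse]
  simp only [Fin.sum_univ_four, blInverse, blockMatrix, Matrix.add_apply, blSigma]
  simp [ricciRadial, ricciAngular]
  generalize deriv (deriv fun x => M x * x) (p 1) = f₂
  generalize deriv (fun x => M x * x) (p 1) = f₁
  generalize M (p 1) * p 1 = f at *
  generalize p 1 = r at *
  generalize Real.sin (p 2) = s at *
  generalize Real.cos (p 2) = c at *
  generalize hSd : r ^ 2 + a ^ 2 * c ^ 2 = S at *
  generalize hDd : r ^ 2 + a ^ 2 - 2 * f = D at *
  have hf : f = (r ^ 2 + a ^ 2 - D) / 2 := by linarith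
  subst hf
  field_simp
  rw [← hSd, hsc]
  ring

theorem bilin_energyMomentum (g : MetricField) (q : Pt) (w : Fin 4 → ℝ) :
    bilin (energyMomentum g q) w w =
      bilin (ricci g q) w w - scalarCurvature g q / 2 * bilin (g q) w w := by
  simp only [bilin, energyMomentum, Matrix.sub_apply, Matrix.smul_apply, smul_eq_mul,
    Finset.mul_sum, ← Finset.sum_sub_distrib]
  refine Finset.sum_congr rfl fun i _ => Finset.sum_congr rfl fun j _ => ?_
  ring

theorem bilin_blockMatrix (tt tf ff rr θθ u v : ℝ) (w : Fin 4 → ℝ) (hw : w 1 = 0 ∨ w 2 = 0) :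
    bilin (blockMatrix tt tf ff rr θθ + !![0, 0, 0, 0; 0, 0, u, 0; 0, v, 0, 0; 0, 0, 0, 0]) w w =
      tt * w 0 ^ 2 + 2 * tf * w 0 * w 3 + ff * w 3 ^ 2 + rr * w 1 ^ 2 + θθ * w 2 ^ 2 := by
  simp only [bilin, Fin.sum_univ_four, blockMatrix, Matrix.add_apply]
  rcases hw with hw | hw <;> simp [hw] <;> ring

theorem bilin_blComponents (r f s c : ℝ) (w : Fin 4 → ℝ) (hw : w 1 = 0 ∨ w 2 = 0) :
    bilin (blComponents a r f s c) w w =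
      (-1 + 2 * f / (r ^ 2 + a ^ 2 * c ^ 2)) * w 0 ^ 2
      + 2 * (-(2 * f * a * s ^ 2 / (r ^ 2 + a ^ 2 * c ^ 2))) * w 0 * w 3
      + (s ^ 2 * (r ^ 2 + a ^ 2) + 2 * f * a ^ 2 * s ^ 4 / (r ^ 2 + a ^ 2 * c ^ 2)) * w 3 ^ 2
      + (r ^ 2 + a ^ 2 * c ^ 2) / (r ^ 2 + a ^ 2 - 2 * f) * w 1 ^ 2
      + (r ^ 2 + a ^ 2 * c ^ 2) * w 2 ^ 2 := by
  rw [← bilin_blockMatrix _ _ _ _ _ 0 0 w hw]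
  congr 1
  simp only [blComponents]
  ext i j
  fin_cases i <;> fin_cases j <;> simp

theorem bilin_smul (A : Matrix (Fin 4) (Fin 4) ℝ) (κ : ℝ) (w : Fin 4 → ℝ) :
    bilin A (κ • w) (κ • w) = κ ^ 2 * bilin A w w := by
  simp only [bilin, Finset.mul_sum, Pi.smul_apply, smul_eq_mul]
  refine Finset.sum_congr rfl fun i _ => Finset.sum_congr rfl fun j _ => ?_
  ring

theorem nullL_add_nullN (a : ℝ) (M : ℝ → ℝ) (p : Pt) (e : ℝ) :
    let S := blSigma a (p 1) (p 2)
    let D := blDelta a M (p 1)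
    let w := nullL a M p + e • nullN a M p
    w 0 = (p 1 ^ 2 + a ^ 2) * (1 / D + e / (2 * S)) ∧ w 1 = D / D - e * D / (2 * S) ∧ w 2 = 0 ∧
    w 3 = a * (1 / D + e / (2 * S)) := by
  intro S D w
  simp [w, nullL, nullN, S, D]
  refine ⟨?_, ?_, ?_⟩ <;> ring

/-- On the plane of $\mathbf l,\mathbf n$ the tensor $T$ equals $(A-(A+B))g=-B\,g$, and $\mathbf
l+e\,\mathbf n$ has square $2e\,g(\mathbf l,\mathbf n)=-2e$. The signs $e=\pm1$ treat $\mathbf t$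
and $\mathbf z$ together. -/
theorem BLRegular.bilin_null (hp : BLRegular a M p) {e : ℝ} (he : e = 1 ∨ e = -1) :
    bilin (energyMomentum (blMetric a M) p) (nullL a M p + e • nullN a M p)
      (nullL a M p + e • nullN a M p) =
      2 * e * ricciAngular a (p 1) (M (p 1) * p 1) (deriv (fun x => M x * x) (p 1))
        (Real.cos (p 2)) := by
  have hS : p 1 ^ 2 + a ^ 2 * Real.cos (p 2) ^ 2 ≠ 0 := hp.sigma_ne
  have hD := hp.delta_ne'
  have hsc := Real.cos_sq' (p 2)
  obtain ⟨u, v, h⟩ := ricci_blMetric_eq hp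
  obtain ⟨w0, w1, w2, w3⟩ := nullL_add_nullN a M p e
  have hRs := hp.curvScalar_eq
  unfold curvScalar at hRs
  rw [bilin_energyMomentum, hRs, h, blMetric_eq_components a M p hp.sigma_ne,
    bilin_blockMatrix _ _ _ _ _ _ _ _ (Or.inr w2), bilin_blComponents _ _ _ _ _ (Or.inr w2),
    w0, w1, w2, w3]
  have hDelta : blDelta a M (p 1) = p 1 ^ 2 + a ^ 2 - 2 * (M (p 1) * p 1) := by
    unfold blDelta; ring
  rw [hDelta]
  simp only [blSigma, ricciRadial, ricciAngular]
  generalize deriv (deriv fun x => M x * x) (p 1) = f₂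
  generalize deriv (fun x => M x * x) (p 1) = f₁
  generalize M (p 1) * p 1 = f at *
  generalize p 1 = r at *
  generalize Real.sin (p 2) = s at *
  generalize Real.cos (p 2) = c at *
  generalize hSd : r ^ 2 + a ^ 2 * c ^ 2 = S at *
  generalize hDd : r ^ 2 + a ^ 2 - 2 * f = D at *
  have hf : f = (r ^ 2 + a ^ 2 - D) / 2 := by linarith
  subst hf
  rcases he with rfl | rfl
  all_goals
    field_simp
    rw [← hSd, hsc]
    ring

theorem BLRegular.density_eq (hp : BLRegular a M p) :
    density a M p = ricciAngular a (p 1) (M (p 1) * p 1) (deriv (fun x => M x * x) (p 1))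
        (Real.cos (p 2)) := by
  have h := hp.bilin_null (Or.inl rfl)
  rw [one_smul] at h
  rw [density, frameT, bilin_smul, h]
  simp

theorem BLRegular.pressureZ_eq (hp : BLRegular a M p) :
    pressureZ a M p = -ricciAngular a (p 1) (M (p 1) * p 1) (deriv (fun x => M x * x) (p 1))
        (Real.cos (p 2)) := by
  have h := hp.bilin_null (Or.inr rfl)
  rw [neg_one_smul, ← sub_eq_add_neg] at h
  rw [pressureZ, frameZ, bilin_smul, h]
  simp

/-- Multiplying by the conjugate, $1/(r+ia\cos\theta)=(r-ia\cos\theta)/\Sigma$; the two real vectors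
displayed are, up to factors, $\mathbf x$ and $\mathbf y$. -/
theorem nullM_eq (a : ℝ) (p : Pt) (hS : blSigma a (p 1) (p 2) ≠ 0) (i : Fin 4) :
    Real.sqrt 2 * nullM a p i = (1 / blSigma a (p 1) (p 2) : ℝ) *
      (((![a ^ 2 * Real.sin (p 2) * Real.cos (p 2), 0, p 1,
        a * Real.cos (p 2) / Real.sin (p 2)] i : ℝ) : ℂ) + Complex.I *
      ((![a * Real.sin (p 2) * p 1, 0, -(a * Real.cos (p 2)), p 1 / Real.sin (p 2)] i : ℝ) : ℂ)) := by
  have h2 : (Real.sqrt 2 : ℂ) ≠ 0 := by simp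
  have hz : (p 1 : ℂ) + Complex.I * (a * Real.cos (p 2) : ℝ) ≠ 0 := by
    intro h0
    have hre := congrArg Complex.re h0
    have him := congrArg Complex.im h0
    simp at hre him
    apply hS
    unfold blSigma
    rw [hre]
    rcases him with h | h
    · simp [h]
    · rw [Complex.cos_ofReal_re] at h
      simp [h]
  have hmul : ((p 1 : ℂ) + Complex.I * (a * Real.cos (p 2) : ℝ)) *
      ((p 1 : ℂ) - Complex.I * (a * Real.cos (p 2) : ℝ)) = (blSigma a (p 1) (p 2) : ℝ) := by
    unfold blSigma
    push_cast
    linear_combination (-(a * Complex.cos (p 2)) ^ 2) * Complex.I_sq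
  have hinv : Real.sqrt 2 * (1 / ((Real.sqrt 2 : ℂ) * ((p 1 : ℂ) +
      Complex.I * (a * Real.cos (p 2) : ℝ)))) = (1 / blSigma a (p 1) (p 2) : ℝ) *
        ((p 1 : ℂ) - Complex.I * (a * Real.cos (p 2) : ℝ)) := by
    have hS' : ((blSigma a (p 1) (p 2) : ℝ) : ℂ) ≠ 0 := by exact_mod_cast hS
    rw [Complex.ofReal_div, Complex.ofReal_one]
    field_simp
    rw [← hmul]
  simp only [nullM, Pi.smul_apply, smul_eq_mul]
  rw [← mul_assoc, hinv, mul_assoc]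
  congr 1
  fin_cases i
  · simp
    linear_combination (-(a ^ 2 * Complex.cos (p 2) * Complex.sin (p 2))) * Complex.I_sq
  · simp
  · simp
    ring
  · simp
    linear_combination (-(a * Complex.cos (p 2) * (Complex.sin (p 2))⁻¹)) * Complex.I_sq

theorem frameX_eq (a : ℝ) (p : Pt) (hS : blSigma a (p 1) (p 2) ≠ 0) :
    frameX a p = (1 / blSigma a (p 1) (p 2)) •
    ![a ^ 2 * Real.sin (p 2) * Real.cos (p 2), 0, p 1, a * Real.cos (p 2) / Real.sin (p 2)] := by
  ext i
  have h := congrArg Complex.re (nullM_eq a p hS i)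
  rw [Complex.re_ofReal_mul, Complex.re_ofReal_mul] at h
  rw [frameX, h]
  simp only [Complex.add_re, Complex.re_mul_ofReal, Complex.ofReal_re, Complex.I_re, zero_mul,
    add_zero, Pi.smul_apply, smul_eq_mul]

theorem frameY_eq (a : ℝ) (p : Pt) (hS : blSigma a (p 1) (p 2) ≠ 0) :
    frameY a p = (-1 / blSigma a (p 1) (p 2)) •
    ![a * Real.sin (p 2) * p 1, 0, -(a * Real.cos (p 2)), p 1 / Real.sin (p 2)] := by
  ext i
  have h := congrArg Complex.im (nullM_eq a p hS i)
  rw [Complex.im_ofReal_mul, Complex.im_ofReal_mul] at h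
  rw [frameY, h]
  simp only [Complex.add_im, Complex.im_mul_ofReal, Complex.ofReal_im, Complex.I_im, one_mul,
    zero_add, Pi.smul_apply, smul_eq_mul]
  ring

/-- The vectors $(a\sin\theta,0,0,1/\sin\theta)$ and $\partial_\theta$ are orthogonal of square
$\Sigma$ and span the plane of $\mathbf m,\bar{\mathbf m}$, on which $T=(B-(A+B))g=-A\,g$. Both
$\mathbf x$ and $\mathbf y$ are multiples of such combinations. -/
theorem BLRegular.bilin_transverse (hp : BLRegular a M p) (e : ℝ × ℝ) :
    bilin (energyMomentum (blMetric a M) p)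
      ![a * Real.sin (p 2) * e.1, 0, e.2, e.1 / Real.sin (p 2)]
      ![a * Real.sin (p 2) * e.1, 0, e.2, e.1 / Real.sin (p 2)] =
      -((e.1 ^ 2 + e.2 ^ 2) * blSigma a (p 1) (p 2) * ricciRadial a (p 1) (M (p 1) * p 1)
        (deriv (fun x => M x * x) (p 1)) (deriv (deriv (fun x => M x * x)) (p 1))
        (Real.cos (p 2))) := by
  have hS : p 1 ^ 2 + a ^ 2 * Real.cos (p 2) ^ 2 ≠ 0 := hp.sigma_ne
  have hD := hp.delta_ne'
  have hs := hp.sin_ne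
  have hsc := Real.cos_sq' (p 2)
  obtain ⟨u, v, h⟩ := ricci_blMetric_eq hp
  have hRs := hp.curvScalar_eq
  unfold curvScalar at hRs
  rw [bilin_energyMomentum, hRs, h, blMetric_eq_components a M p hp.sigma_ne,
    bilin_blockMatrix _ _ _ _ _ _ _ _ (Or.inl rfl), bilin_blComponents _ _ _ _ _ (Or.inl rfl)]
  simp [blSigma, ricciRadial, ricciAngular]
  generalize deriv (deriv fun x => M x * x) (p 1) = f₂
  generalize deriv (fun x => M x * x) (p 1) = f₁
  generalize M (p 1) * p 1 = f at *
  generalize p 1 = r at *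
  generalize Real.sin (p 2) = s at *
  generalize Real.cos (p 2) = c at *
  generalize hSd : r ^ 2 + a ^ 2 * c ^ 2 = S at *
  generalize hDd : r ^ 2 + a ^ 2 - 2 * f = D at *
  have hf : f = (r ^ 2 + a ^ 2 - D) / 2 := by linarith
  subst hf
  field_simp
  rw [← hSd, hsc]
  ring

theorem BLRegular.pressureX_eq (hp : BLRegular a M p) :
    pressureX a M p = -ricciRadial a (p 1) (M (p 1) * p 1)
        (deriv (fun x => M x * x) (p 1)) (deriv (deriv (fun x => M x * x)) (p 1))
        (Real.cos (p 2)) := by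
  have h := hp.bilin_transverse (a * Real.cos (p 2), p 1)
  have hS := hp.sigma_ne
  have e1 : a * Real.sin (p 2) * (a * Real.cos (p 2)) = a ^ 2 * Real.sin (p 2) * Real.cos (p 2) := by
    ring
  simp only [e1] at h
  rw [pressureX, frameX_eq a p hS, bilin_smul, h]
  have : (a * Real.cos (p 2)) ^ 2 + p 1 ^ 2 = blSigma a (p 1) (p 2) := by unfold blSigma; ring
  rw [this]
  field_simp

theorem BLRegular.pressureY_eq (hp : BLRegular a M p) :
    pressureY a M p = -ricciRadial a (p 1) (M (p 1) * p 1)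
        (deriv (fun x => M x * x) (p 1)) (deriv (deriv (fun x => M x * x)) (p 1))
        (Real.cos (p 2)) := by
  have h := hp.bilin_transverse (p 1, -(a * Real.cos (p 2)))
  have hS := hp.sigma_ne
  simp only at h
  rw [pressureY, frameY_eq a p hS, bilin_smul, h]
  have : p 1 ^ 2 + (-(a * Real.cos (p 2))) ^ 2 = blSigma a (p 1) (p 2) := by unfold blSigma; ring
  rw [this]
  field_simp

end
end RotatingBH
end

noncomputable section
namespace RotatingBH

/-! ### Expansion of the mass function -/

theorem isLittleO_sub_taylor {g : ℝ → ℝ} {k : ℕ} (hg : ContDiffAt ℝ k g 0) :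
    (fun x => g x - ∑ j ∈ Finset.range (k + 1), iteratedDeriv j g 0 / (j.factorial : ℝ) * x ^ j)
      =o[𝓝 0] fun x => x ^ k := by
  obtain ⟨u, hu, hgu⟩ := hg.contDiffOn le_rfl (by simp)
  obtain ⟨ε, hε, hball⟩ := Metric.mem_nhds_iff.1 hu
  have h := taylor_isLittleO (convex_ball (0 : ℝ) ε) (Metric.mem_ball_self hε) (hgu.mono hball)
  rw [Metric.isOpen_ball.nhdsWithin_eq (Metric.mem_ball_self hε)] at h
  refine h.congr (fun x => ?_) (fun x => by simp)
  rw [taylor_within_apply]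
  congr 1
  refine Finset.sum_congr rfl fun j _ => ?_
  rw [iteratedDerivWithin_of_isOpen Metric.isOpen_ball (Metric.mem_ball_self hε), smul_eq_mul,
    sub_zero]
  ring

/-- Once the coefficients below $j$ vanish, the quotient by $x^j$ tends both to $c_j$ and to $0$. A
one-sided neighbourhood is enough, so one-sided information on $\mathcal M$ determines its jet. -/
theorem coeff_eq_zero_of_isLittleO {c : ℕ → ℝ} {k : ℕ}
    (h : (fun x : ℝ => ∑ j ∈ Finset.range (k + 1), c j * x ^ j) =o[𝓝[>] 0] fun x => x ^ k) :
    ∀ j ≤ k, c j = 0 := by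
  intro j
  induction j using Nat.strong_induction_on with
  | _ j ih =>
    intro hj
    have h1 : (fun x : ℝ => ∑ i ∈ Finset.range (k + 1), c i * x ^ i) =o[𝓝[>] 0]
        fun x => x ^ j := by
      refine h.trans_isBigO (IsBigO.of_bound 1 ?_)
      filter_upwards [Ioo_mem_nhdsGT (zero_lt_one' ℝ)] with x hx
      rw [one_mul, Real.norm_of_nonneg (pow_nonneg hx.1.le _),
        Real.norm_of_nonneg (pow_nonneg hx.1.le _)]
      exact pow_le_pow_of_le_one hx.1.le hx.2.le hj
    have h2 := h1.tendsto_div_nhds_zero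
    have h3 : Tendsto (fun x : ℝ => ∑ i ∈ Finset.range (k + 1), if j ≤ i then c i * x ^ (i - j)
        else 0) (𝓝[>] 0) (𝓝 (∑ i ∈ Finset.range (k + 1), if j ≤ i then c i * 0 ^ (i - j)
        else 0)) := by
      have hc : Continuous (fun x : ℝ => ∑ i ∈ Finset.range (k + 1),
          if j ≤ i then c i * x ^ (i - j) else 0) := by
        refine continuous_finsetSum _ fun i _ => ?_
        split_ifs <;> fun_prop
      exact (hc.tendsto 0).mono_left nhdsWithin_le_nhds
    have h4 : (∑ i ∈ Finset.range (k + 1), if j ≤ i then c i * (0 : ℝ) ^ (i - j) else 0) = c j := by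
      rw [Finset.sum_eq_single j]
      · simp
      · intro i _ hij
        split_ifs with h
        · rw [zero_pow (by omega), mul_zero]
        · rfl
      · intro h
        exact absurd (Finset.mem_range.2 (by omega)) h
    rw [h4] at h3
    refine tendsto_nhds_unique h3 (h2.congr' ?_)
    filter_upwards [self_mem_nhdsWithin] with x hx
    have hx0 : x ≠ 0 := ne_of_gt hx
    rw [Finset.sum_div]
    refine Finset.sum_congr rfl fun i _ => ?_
    split_ifs with h
    · rw [pow_sub₀ x hx0 h]
      ring
    · rw [ih i (by omega) (by omega)]
      simp

theorem iteratedDeriv_eq_zero_of_isLittleO {g : ℝ → ℝ} {k : ℕ} (hg : ContDiffAt ℝ k g 0)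
    (h : g =o[𝓝[>] 0] fun x => x ^ k) : ∀ j ≤ k, iteratedDeriv j g 0 = 0 := by
  have h1 := h.sub ((isLittleO_sub_taylor hg).mono nhdsWithin_le_nhds)
  simp only [sub_sub_cancel] at h1
  intro j hj
  have := coeff_eq_zero_of_isLittleO h1 j hj
  have hf : (j.factorial : ℝ) ≠ 0 := by positivity
  field_simp at this
  simpa using this

theorem isLittleO_of_iteratedDeriv_eq_zero {g : ℝ → ℝ} {k : ℕ} (hg : ContDiffAt ℝ k g 0)
    (h : ∀ j ≤ k, iteratedDeriv j g 0 = 0) : g =o[𝓝 0] fun x => x ^ k := by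
  refine (isLittleO_sub_taylor hg).congr_left fun x => ?_
  rw [Finset.sum_eq_zero, sub_zero]
  intro j hj
  rw [h j (by simpa [Nat.lt_succ_iff] using hj)]
  simp

/-- Asymptotics cannot be differentiated in general. Here the $(k+1)$-jet of $g$ vanishes, hence so
does the $k$-jet of $g'$, and Taylor's formula with Peano remainder applies to $g'$. The hypothesis
is one-sided, the conclusion two-sided. -/
theorem deriv_isLittleO {g : ℝ → ℝ} {k : ℕ} (hg : ContDiffAt ℝ (k + 1 : ℕ) g 0)
    (h : g =o[𝓝[>] 0] fun x => x ^ (k + 1)) :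
    ContDiffAt ℝ k (deriv g) 0 ∧ deriv g =o[𝓝 0] fun x => x ^ k := by
  have h1 : ContDiffAt ℝ k (deriv g) 0 := hg.derivWithin (by norm_cast)
  refine ⟨h1, isLittleO_of_iteratedDeriv_eq_zero h1 fun j hj => ?_⟩
  rw [← iteratedDeriv_succ']
  exact iteratedDeriv_eq_zero_of_isLittleO hg h _ (by omega)

section
variable {n : ℕ} {m : ℝ} {M : ℝ → ℝ}

theorem mass_sub_isLittleO (hexp : (fun s => M s - m * s ^ n) =O[𝓝[>] 0] fun s => s ^ (n + 1)) :
    (fun s => M s - m * s ^ n) =o[𝓝[>] 0] fun s => s ^ n :=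
  hexp.trans_isLittleO ((isLittleO_pow_pow (Nat.lt_succ_self n)).mono nhdsWithin_le_nhds)

theorem mass_isBigO (hM : ContDiffAt ℝ n M 0)
    (hexp : (fun s => M s - m * s ^ n) =O[𝓝[>] 0] fun s => s ^ (n + 1)) :
    M =O[𝓝 0] fun s => s ^ n := by
  have hN : ContDiffAt ℝ n (fun s => M s - m * s ^ n) 0 := by fun_prop
  have h := isLittleO_of_iteratedDeriv_eq_zero hN
    (iteratedDeriv_eq_zero_of_isLittleO hN (mass_sub_isLittleO hexp))
  have h2 := h.isBigO.add (isBigO_const_mul_self m (fun s : ℝ => s ^ n) (𝓝 0))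
  simpa using h2

theorem deriv_mass_isLittleO (hn : 3 ≤ n) (hM : ContDiffAt ℝ n M 0)
    (hexp : (fun s => M s - m * s ^ n) =O[𝓝[>] 0] fun s => s ^ (n + 1)) :
    (fun s => deriv M s - n * m * s ^ (n - 1)) =o[𝓝 0] (fun s => s ^ (n - 1)) ∧
    (fun s => deriv (deriv M) s - n * (n - 1) * m * s ^ (n - 2)) =o[𝓝 0] (fun s => s ^ (n - 2)) := by
  obtain ⟨k, rfl⟩ : ∃ k, n = k + 2 := ⟨n - 2, by omega⟩
  set N : ℝ → ℝ := fun s => M s - m * s ^ (k + 2) with hNdef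
  have hN : ContDiffAt ℝ (k + 1 + 1 : ℕ) N 0 := by
    have : ContDiffAt ℝ (k + 1 + 1 : ℕ) M 0 := hM
    fun_prop
  obtain ⟨c1, h1⟩ := deriv_isLittleO hN (mass_sub_isLittleO hexp)
  obtain ⟨-, h2⟩ := deriv_isLittleO c1 (h1.mono nhdsWithin_le_nhds)
  have hM2 : ContDiffAt ℝ 2 M 0 := hM.of_le (by norm_cast; omega)
  have hd1 : ∀ᶠ s in 𝓝 0, deriv N s = deriv M s - m * ((k + 2 : ℕ) * s ^ (k + 1)) := by
    filter_upwards [hM2.eventually (by simp)] with s hs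
    have := hs.differentiableAt (by norm_num)
    have h3 := this.hasDerivAt.fun_sub ((hasDerivAt_pow (k + 2) s).const_mul m)
    simpa using h3.deriv
  have hd2 : ∀ᶠ s in 𝓝 0, deriv (deriv N) s =
      deriv (deriv M) s - m * ((k + 2 : ℕ) * ((k + 1 : ℕ) * s ^ k)) := by
    filter_upwards [hM2.eventually (by simp), hd1.eventually_nhds] with s hs hs1
    have h4 : ContDiffAt ℝ 1 (deriv M) s := hs.derivWithin (by norm_num)
    have h5 := h4.differentiableAt (by norm_num)
    have h6 := h5.hasDerivAt.fun_sub (((hasDerivAt_pow (k + 1) s).const_mul ((k + 2 : ℕ) : ℝ)).const_mul m)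
    rw [EventuallyEq.deriv_eq hs1]
    simpa using h6.deriv
  refine ⟨h1.congr' ?_ ?_, h2.congr' ?_ ?_⟩
  · filter_upwards [hd1] with s hs
    rw [hs]
    push_cast
    simp
    ring
  · simp
  · filter_upwards [hd2] with s hs
    rw [hs]
    push_cast
    simp
    ring
  · simp

/-- The two combinations of derivatives of `f = r 𝓜(r)` in the Ricci tensor. -/
theorem mul_mass_expansion (hn : 3 ≤ n) (hM : ContDiffAt ℝ n M 0)
    (hexp : (fun s => M s - m * s ^ n) =O[𝓝[>] 0] fun s => s ^ (n + 1)) :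
    (fun s => s * deriv (fun x => M x * x) s - M s * s - n * m * s ^ (n + 1)) =o[𝓝 0]
      (fun s => s ^ (n + 1)) ∧
    (fun s => deriv (deriv (fun x => M x * x)) s - n * (n + 1) * m * s ^ (n - 1)) =o[𝓝 0]
      (fun s => s ^ (n - 1)) := by
  obtain ⟨h1, h2⟩ := deriv_mass_isLittleO hn hM hexp
  have hM2 : ContDiffAt ℝ 2 M 0 := hM.of_le (by norm_cast; omega)
  have hd1 : ∀ᶠ s in 𝓝 0, deriv (fun x => M x * x) s = deriv M s * s + M s := by
    filter_upwards [hM2.eventually (by simp)] with s hs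
    have := (hs.differentiableAt (by norm_num)).hasDerivAt.fun_mul (hasDerivAt_id' s)
    simpa using this.deriv
  have hd2 : ∀ᶠ s in 𝓝 0, deriv (deriv (fun x => M x * x)) s =
      deriv (deriv M) s * s + 2 * deriv M s := by
    filter_upwards [hM2.eventually (by simp), hd1.eventually_nhds] with s hs hs1
    have h4 : ContDiffAt ℝ 1 (deriv M) s := hs.derivWithin (by norm_num)
    have h5 := ((h4.differentiableAt (by norm_num)).hasDerivAt.fun_mul (hasDerivAt_id' s)).fun_add
      (hs.differentiableAt (by norm_num)).hasDerivAt
    rw [EventuallyEq.deriv_eq hs1, h5.deriv]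
    ring
  obtain ⟨k, rfl⟩ : ∃ k, n = k + 2 := ⟨n - 2, by omega⟩
  simp only [Nat.add_sub_cancel, Nat.add_succ_sub_one] at h1 h2 ⊢
  -- The identities behind the two expansions are $sf'-f=s^2\mathcal M'$ and $f''=s\mathcal
  -- M''+2\mathcal M'$; the second gives the coefficient $n(n-1)+2n=n(n+1)$.
  have e1 := (isBigO_refl (fun s : ℝ => s ^ 2) (𝓝 0)).mul_isLittleO h1
  have e2 := (isBigO_refl (fun s : ℝ => s) (𝓝 0)).mul_isLittleO h2
  refine ⟨e1.congr' ?_ ?_, (e2.add ((h1.const_mul_left 2).congr_right fun s => pow_succ' s k)).congr' ?_ ?_⟩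
  · filter_upwards [hd1] with s hs
    rw [hs]; ring
  · exact Eventually.of_forall fun s => by ring
  · filter_upwards [hd2] with s hs
    rw [hs]; push_cast; ring
  · exact Eventually.of_forall fun s => by ring

end
end RotatingBH
end

noncomputable section
namespace RotatingBH

/-! ### Boyer-Lindquist coordinates near the ring -/

/-- In the half-turn representative $y=0$ the quartic reads $(r^2+a^2)(r^2-z^2)=r^2x^2$. If $r>0$ it
gives $|z|\le r$ and $\cos\theta=z/r$ works. If $r=0$ the point lies on the closed disk $z=0$,
$|x|\le a$, and $\sin\theta=|x|/a$ works. -/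
theorem exists_areBLCoords {a : ℝ} (ha : 0 < a) (ρ ψ : ℝ) : ∃ r θ : ℝ, AreBLCoords a ρ ψ r θ := by
  obtain ⟨x, hx⟩ : ∃ x, x = a + ρ * Real.cos ψ := ⟨_, rfl⟩
  obtain ⟨z, hz⟩ : ∃ z, z = ρ * Real.sin ψ := ⟨_, rfl⟩
  obtain ⟨r, hr⟩ : ∃ r, r = ksRadius a x 0 z := ⟨_, rfl⟩
  have hr0 : 0 ≤ r := hr ▸ Real.sqrt_nonneg _
  have hq : r ^ 4 - r ^ 2 * (x ^ 2 + 0 ^ 2 + z ^ 2 - a ^ 2) - a ^ 2 * z ^ 2 = 0 :=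
    hr ▸ ksRadius_eq a x 0 z
  have hf : (r ^ 2 + a ^ 2) * (r ^ 2 - z ^ 2) = r ^ 2 * x ^ 2 := by linear_combination hq
  have hR : 0 < r ^ 2 + a ^ 2 := by positivity
  rcases hr0.eq_or_lt with h0 | h0
  · have hz0 : z = 0 := by
      rw [← h0] at hq
      have : (a * z) ^ 2 = 0 := by linear_combination -hq
      have := pow_eq_zero_iff (two_ne_zero) |>.1 this
      exact (mul_eq_zero.1 this).resolve_left ha.ne'
    have hxa : x ^ 2 ≤ a ^ 2 := by
      have h1 : Real.sqrt (((x ^ 2 + 0 ^ 2 + z ^ 2 - a ^ 2) +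
        Real.sqrt ((x ^ 2 + 0 ^ 2 + z ^ 2 - a ^ 2) ^ 2 + 4 * a ^ 2 * z ^ 2)) / 2) = 0 := (h0.trans hr).symm
      rw [Real.sqrt_eq_zero'] at h1
      have h3 := sq_nonneg z
      have h2 := Real.sqrt_nonneg ((x ^ 2 + 0 ^ 2 + z ^ 2 - a ^ 2) ^ 2 + 4 * a ^ 2 * z ^ 2)
      rw [zero_pow two_ne_zero] at h1 h2
      linarith
    have hxa' : |x| / a ≤ 1 := (div_le_one ha).2 (abs_le_of_sq_le_sq hxa ha.le)
    have hxn : 0 ≤ |x| / a := by positivity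
    refine ⟨0, Real.arcsin (|x| / a), le_rfl, Real.arcsin_nonneg.2 hxn, ?_, ?_, ?_⟩
    · linarith [Real.arcsin_le_pi_div_two (|x| / a), Real.pi_pos]
    · rw [← hz, hz0, zero_mul]
    · rw [Real.sin_arcsin (by linarith) hxa', ← hx, div_pow, sq_abs]
      field_simp
      ring
  · have hzr : z ^ 2 ≤ r ^ 2 := by
      by_contra hlt
      push Not at hlt
      have : (r ^ 2 + a ^ 2) * (r ^ 2 - z ^ 2) < 0 := mul_neg_of_pos_of_neg hR (by linarith)
      nlinarith [mul_nonneg (sq_nonneg r) (sq_nonneg x)]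
    have habs := abs_le.1 (abs_le_of_sq_le_sq hzr h0.le)
    have h1 : -1 ≤ z / r := by rw [le_div_iff₀ h0]; linarith [habs.1]
    have h2 : z / r ≤ 1 := by rw [div_le_iff₀ h0]; linarith [habs.2]
    refine ⟨r, Real.arccos (z / r), hr0, Real.arccos_nonneg _, Real.arccos_le_pi _, ?_, ?_⟩
    · rw [Real.cos_arccos h1 h2]
      field_simp
      rw [hz]
    · rw [Real.sin_sq, Real.cos_arccos h1 h2, ← hx]
      field_simp
      linear_combination hf

section
variable {a ρ ψ r θ : ℝ}

/-- Modulus and real part of $(r+ia\cos\theta)^2=\rho^2+2a\rho e^{i\psi}$. Geometrically, $\Sigma$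
is the product of the distances to the two points where the meridian plane meets the ring; the
second factor is the squared distance to the opposite point. -/
theorem AreBLCoords.sigma_sq (h : AreBLCoords a ρ ψ r θ) :
    blSigma a r θ ^ 2 = ρ ^ 2 * (4 * a ^ 2 + 4 * a * ρ * Real.cos ψ + ρ ^ 2) ∧
    2 * r ^ 2 = blSigma a r θ + 2 * a * ρ * Real.cos ψ + ρ ^ 2 := by
  obtain ⟨-, -, -, h1, h2⟩ := h
  have e1 := Real.sin_sq_add_cos_sq ψ
  rw [Real.sin_sq θ] at h2
  unfold blSigma
  have h3 : r ^ 2 - a ^ 2 * Real.cos θ ^ 2 = 2 * a * ρ * Real.cos ψ + ρ ^ 2 := by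
    linear_combination h2 + (r * Real.cos θ + ρ * Real.sin ψ) * h1 + ρ ^ 2 * e1
  refine ⟨?_, by linear_combination h3⟩
  linear_combination (r ^ 2 - a ^ 2 * Real.cos θ ^ 2 + 2 * a * ρ * Real.cos ψ + ρ ^ 2) * h3 +
    4 * a ^ 2 * (r * Real.cos θ + ρ * Real.sin ψ) * h1 + 4 * a ^ 2 * ρ ^ 2 * e1

/-- By the triangle inequality $\Sigma/\rho$, the distance to the opposite ring point, differs from
$2a$ by at most $\rho$. The estimate for $r^2$ follows by averaging. -/
theorem AreBLCoords.bounds (h : AreBLCoords a ρ ψ r θ) (ha : 0 < a) (hρ : 0 < ρ) (hρa : ρ < a) :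
    |blSigma a r θ / ρ - 2 * a| ≤ ρ ∧ |r ^ 2 / ρ - a * (1 + Real.cos ψ)| ≤ ρ := by
  obtain ⟨h1, h2⟩ := h.sigma_sq
  have hS : 0 ≤ blSigma a r θ := by unfold blSigma; positivity
  have hY0 : 0 ≤ blSigma a r θ / ρ := by positivity
  have hS' : blSigma a r θ = ρ * (blSigma a r θ / ρ) := by field_simp
  have hY : (blSigma a r θ / ρ) ^ 2 = 4 * a ^ 2 + 4 * a * ρ * Real.cos ψ + ρ ^ 2 := by
    rw [div_pow, h1]
    field_simp
  have hr : r ^ 2 / ρ = (blSigma a r θ / ρ + 2 * a * Real.cos ψ + ρ) / 2 := by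
    field_simp
    linear_combination h2
  set Y := blSigma a r θ / ρ
  have hc1 := Real.neg_one_le_cos ψ
  have hc2 := Real.cos_le_one ψ
  have hl : 2 * a - ρ ≤ Y := abs_le_of_sq_le_sq' (by nlinarith [mul_pos ha hρ]) hY0 |>.2
  have hu : Y ≤ 2 * a + ρ := abs_le_of_sq_le_sq' (by nlinarith [mul_pos ha hρ]) (by positivity) |>.2
  refine ⟨abs_le.2 ⟨by linarith, by linarith⟩, ?_⟩
  rw [hr]
  exact abs_le.2 ⟨by linarith, by linarith⟩

theorem AreBLCoords.sin_ne (h : AreBLCoords a ρ ψ r θ) (hρ : 0 < ρ) (hρa : ρ < a) :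
    Real.sin θ ≠ 0 := by
  obtain ⟨-, -, -, -, h2⟩ := h
  intro h0
  rw [h0] at h2
  have : 0 < a + ρ * Real.cos ψ := by nlinarith [Real.neg_one_le_cos ψ]
  nlinarith

theorem AreBLCoords.sigma_pos (h : AreBLCoords a ρ ψ r θ) (hρ : 0 < ρ) (hρa : ρ < a) :
    0 < blSigma a r θ := by
  have h1 := (abs_le.1 (h.bounds (hρ.trans hρa) hρ hρa).1).1
  have : 0 < blSigma a r θ / ρ := by linarith
  exact (div_pos_iff_of_pos_right hρ).1 this

end

/-- Near the ring $r^2\le3a\rho$, so a property holding for $r$ near $0$ holds for small $\rho$,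
uniformly in $\psi$. -/
theorem eventually_radius {a : ℝ} (ha : 0 < a) {P : ℝ → Prop} (hP : ∀ᶠ r in 𝓝 0, P r) :
    ∀ᶠ ρ in 𝓝[>] (0 : ℝ), ∀ ψ r θ, AreBLCoords a ρ ψ r θ → P r := by
  obtain ⟨ε, hε, hball⟩ := Metric.eventually_nhds_iff.1 hP
  have h0 : ∀ᶠ ρ in 𝓝[>] (0 : ℝ), ρ * (3 * a) < ε ^ 2 := by
    have : Tendsto (fun ρ : ℝ => ρ * (3 * a)) (𝓝[>] 0) (𝓝 0) := by
      have hc : Continuous (fun ρ : ℝ => ρ * (3 * a)) := by fun_prop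
      simpa using (hc.tendsto 0).mono_left nhdsWithin_le_nhds
    exact this.eventually_lt_const (by positivity)
  filter_upwards [h0, Ioo_mem_nhdsGT ha] with ρ h1 h2 ψ r θ h
  apply hball
  have hb := (abs_le.1 (h.bounds ha h2.1 h2.2).2).2
  have h3 : r ^ 2 / ρ ≤ 3 * a := by nlinarith [Real.cos_le_one ψ, h2.2]
  have h4 : r ^ 2 ≤ ρ * (3 * a) := by
    rw [div_le_iff₀ h2.1] at h3
    linarith
  rw [dist_zero_right, Real.norm_eq_abs]
  exact abs_lt_of_sq_lt_sq (by linarith) hε.le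

/-- $\Delta(0)=a^2\neq0$, $\Sigma>0$ off the ring, and the axis is not reached while $\rho<a$.
Points with $r=0$ are included, since $\mathcal M$ is $C^2$ on both sides of $0$. -/
theorem eventually_blRegular {a : ℝ} (ha : 0 < a) {M : ℝ → ℝ} (hM : ContDiffAt ℝ 2 M 0) :
    ∀ᶠ ρ in 𝓝[>] (0 : ℝ), ∀ ψ r θ, AreBLCoords a ρ ψ r θ → ∀ t φ, BLRegular a M ![t, r, θ, φ] := by
  have hD : ∀ᶠ r in 𝓝 0, blDelta a M r ≠ 0 := by
    have hMc := hM.continuousAt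
    have : ContinuousAt (blDelta a M) 0 := by unfold blDelta; fun_prop
    refine this.eventually_ne ?_
    simp [blDelta, ha.ne']
  filter_upwards [eventually_radius ha hD, eventually_radius ha (hM.eventually (by simp)),
    Ioo_mem_nhdsGT ha] with ρ h1 h2 h3 ψ r θ h t φ
  exact ⟨h2 ψ r θ h, (h.sigma_pos h3.1 h3.2).ne', h1 ψ r θ h, h.sin_ne h3.1 h3.2⟩

theorem BLRegular.contDiffAt {a : ℝ} {M : ℝ → ℝ} {p : Pt} (h : BLRegular a M p) (i j : Fin 4) :
    ContDiffAt ℝ 2 (fun q => blMetric a M q i j) p := by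
  have h1 : ContDiffAt ℝ 2 (fun q : Pt => q 1) p := (contDiff_apply ℝ ℝ (1 : Fin 4)).contDiffAt
  have h2 : ContDiffAt ℝ 2 (fun q : Pt => q 2) p := (contDiff_apply ℝ ℝ (2 : Fin 4)).contDiffAt
  have hs : ContDiffAt ℝ 2 (fun q : Pt => Real.sin (q 2)) p := h2.sin
  have hc : ContDiffAt ℝ 2 (fun q : Pt => Real.cos (q 2)) p := h2.cos
  have hf : ContDiffAt ℝ 2 (fun q : Pt => M (q 1) * q 1) p := (h.smooth.comp p h1).mul h1
  have hS : ContDiffAt ℝ 2 (fun q : Pt => q 1 ^ 2 + a ^ 2 * Real.cos (q 2) ^ 2) p := by fun_prop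
  have hD : ContDiffAt ℝ 2 (fun q : Pt => q 1 ^ 2 + a ^ 2 - 2 * (M (q 1) * q 1)) p := by fun_prop
  have hS0 : p 1 ^ 2 + a ^ 2 * Real.cos (p 2) ^ 2 ≠ 0 := h.sigma_ne
  have hD0 := h.delta_ne'
  have hev : (fun q => blMetric a M q i j) =ᶠ[𝓝 p] fun q =>
      blComponents a (q 1) (M (q 1) * q 1) (Real.sin (q 2)) (Real.cos (q 2)) i j :=
    h.eventually.mono fun q hq =>
      congrFun (congrFun (blMetric_eq_components a M q hq.sigma_ne) i) j
  refine ContDiffAt.congr_of_eventuallyEq ?_ hev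
  have d11 := hS.div hD hD0
  have d00 : ContDiffAt ℝ 2 (fun q : Pt => -1 + 2 * (M (q 1) * q 1) /
      (q 1 ^ 2 + a ^ 2 * Real.cos (q 2) ^ 2)) p :=
    contDiffAt_const.add ((contDiffAt_const.mul hf).div hS hS0)
  have d03 : ContDiffAt ℝ 2 (fun q : Pt => -(2 * (M (q 1) * q 1) * a * Real.sin (q 2) ^ 2 /
      (q 1 ^ 2 + a ^ 2 * Real.cos (q 2) ^ 2))) p :=
    ((((contDiffAt_const.mul hf).mul contDiffAt_const).mul (hs.pow 2)).div hS hS0).neg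
  have d33 : ContDiffAt ℝ 2 (fun q : Pt => Real.sin (q 2) ^ 2 * (q 1 ^ 2 + a ^ 2) +
      2 * (M (q 1) * q 1) * a ^ 2 * Real.sin (q 2) ^ 4 /
      (q 1 ^ 2 + a ^ 2 * Real.cos (q 2) ^ 2)) p :=
    ((hs.pow 2).mul ((h1.pow 2).add contDiffAt_const)).add
      ((((contDiffAt_const.mul hf).mul contDiffAt_const).mul (hs.pow 4)).div hS hS0)
  fin_cases i <;> fin_cases j
  all_goals first
    | exact contDiffAt_const
    | exact d00
    | exact hS
    | exact d11
    | exact d03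
    | exact d33

theorem BLRegular.det_ne {a : ℝ} {M : ℝ → ℝ} {p : Pt} (h : BLRegular a M p) :
    (blMetric a M p).det ≠ 0 := by
  rw [blMetric_eq_components a M p h.sigma_ne]
  intro h0
  have := congrArg Matrix.det
    (blComponents_mul_blInverse h.sigma_ne h.delta_ne' h.sin_ne (Real.cos_sq' _))
  rw [Matrix.det_mul, h0] at this
  simp at this

end RotatingBH
end

noncomputable section
namespace RotatingBH

/-! ### Uniform limits at the ring -/

theorem tendstoUniformly_mul_of_bounded {ι X : Type*} {l : Filter ι} {F G : ι → X → ℝ}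
    {f g : X → ℝ} {A B : ℝ} (hF : TendstoUniformly F f l) (hG : TendstoUniformly G g l)
    (hf : ∀ x, |f x| ≤ A) (hg : ∀ x, |g x| ≤ B) :
    TendstoUniformly (fun i x => F i x * G i x) (fun x => f x * g x) l := by
  rw [Metric.tendstoUniformly_iff] at *
  intro ε hε
  have hK : 0 < |A| + |B| + 1 := by positivity
  -- With $\delta\le1$ the product of the two errors is at most $\delta$, which accounts for the
  -- summand $1$.
  obtain ⟨δ, hδ, hδ1, hδε⟩ : ∃ δ > 0, δ ≤ 1 ∧ δ * (|A| + |B| + 1) < ε := by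
    refine ⟨min 1 (ε / (2 * (|A| + |B| + 1))), by positivity, min_le_left _ _, ?_⟩
    calc _ ≤ ε / (2 * (|A| + |B| + 1)) * (|A| + |B| + 1) := by gcongr; exact min_le_right _ _
      _ = ε / 2 := by field_simp
      _ < ε := by linarith
  filter_upwards [hF δ hδ, hG δ hδ] with i h1 h2 x
  specialize h1 x
  specialize h2 x
  rw [Real.dist_eq] at *
  have e : f x * g x - F i x * G i x =
      f x * (g x - G i x) + g x * (f x - F i x) - (f x - F i x) * (g x - G i x) := by ring
  have hf' := (hf x).trans (le_abs_self A)
  have hg' := (hg x).trans (le_abs_self B)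
  rw [e]
  calc _ ≤ |f x| * |g x - G i x| + |g x| * |f x - F i x| + |f x - F i x| * |g x - G i x| := by
        rw [← abs_mul, ← abs_mul, ← abs_mul]
        exact (abs_sub _ _).trans (by gcongr; exact abs_add_le _ _)
    _ ≤ |A| * δ + |B| * δ + 1 * δ := by gcongr; linarith
    _ = δ * (|A| + |B| + 1) := by ring
    _ < ε := hδε

theorem tendstoUniformly_congr {ι X : Type*} {l : Filter ι} {F G : ι → X → ℝ} {f g : X → ℝ}
    (h : TendstoUniformly F f l) (hF : ∀ᶠ i in l, ∀ x, G i x = F i x) (hf : ∀ x, g x = f x) :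
    TendstoUniformly G g l := by
  rw [Metric.tendstoUniformly_iff] at *
  intro ε hε
  filter_upwards [h ε hε, hF] with i h1 h2 x
  rw [hf, h2]
  exact h1 x

theorem tendstoUniformly_const_mul {ι X : Type*} {l : Filter ι} {F : ι → X → ℝ} {f : X → ℝ}
    (h : TendstoUniformly F f l) (C : ℝ) :
    TendstoUniformly (fun i x => C * F i x) (fun x => C * f x) l :=
  (uniformContinuous_const_smul C).comp_tendstoUniformly h

section
variable {a : ℝ} {r θ : ℝ → ℝ → ℝ}

theorem tendstoUniformly_radius_sq (ha : 0 < a)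
    (h : ∀ ρ > 0, ∀ ψ, AreBLCoords a ρ ψ (r ρ ψ) (θ ρ ψ)) :
    TendstoUniformly (fun ρ ψ => r ρ ψ ^ 2 / ρ) (fun ψ => a * (1 + Real.cos ψ)) (𝓝[>] 0) := by
  rw [Metric.tendstoUniformly_iff]
  intro ε hε
  filter_upwards [Ioo_mem_nhdsGT ha, Ioo_mem_nhdsGT hε] with ρ h1 h2 ψ
  rw [dist_comm, Real.dist_eq]
  exact ((h ρ h1.1 ψ).bounds ha h1.1 h1.2).2.trans_lt h2.2

theorem tendstoUniformly_inv_sigma (ha : 0 < a)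
    (h : ∀ ρ > 0, ∀ ψ, AreBLCoords a ρ ψ (r ρ ψ) (θ ρ ψ)) :
    TendstoUniformly (fun ρ ψ => ρ / blSigma a (r ρ ψ) (θ ρ ψ)) (fun _ => 1 / (2 * a))
      (𝓝[>] 0) := by
  rw [Metric.tendstoUniformly_iff]
  intro ε hε
  have hε' : 0 < ε * (2 * a * a) := by positivity
  filter_upwards [Ioo_mem_nhdsGT ha, Ioo_mem_nhdsGT hε'] with ρ h1 h2 ψ
  have hb := ((h ρ h1.1 ψ).bounds ha h1.1 h1.2).1
  have hS := (h ρ h1.1 ψ).sigma_pos h1.1 h1.2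
  rw [Real.dist_eq, ← inv_div (blSigma a (r ρ ψ) (θ ρ ψ)) ρ]
  set Y := blSigma a (r ρ ψ) (θ ρ ψ) / ρ
  have hY : a < Y := by linarith [(abs_le.1 hb).1, h1.2]
  have hY0 : 0 < Y := ha.trans hY
  have e : 1 / (2 * a) - Y⁻¹ = (Y - 2 * a) / (2 * a * Y) := by field_simp
  rw [e, abs_div, abs_of_pos (by positivity : 0 < 2 * a * Y), div_lt_iff₀ (by positivity)]
  calc _ ≤ ρ := hb
    _ < ε * (2 * a * a) := h2.2
    _ ≤ ε * (2 * a * Y) := by gcongr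

/-- Powers need not be uniformly continuous on the half-line, but $r^2/\rho$ and its limit stay in
the compact interval $[0,3a]$. -/
theorem tendstoUniformly_radius_rpow (ha : 0 < a)
    (h : ∀ ρ > 0, ∀ ψ, AreBLCoords a ρ ψ (r ρ ψ) (θ ρ ψ)) {α : ℝ} (hα : 0 ≤ α) :
    TendstoUniformly (fun ρ ψ => (r ρ ψ ^ 2 / ρ) ^ α) (fun ψ => (a * (1 + Real.cos ψ)) ^ α)
      (𝓝[>] 0) := by
  have hu : UniformContinuousOn (fun x : ℝ => x ^ α) (Set.Icc 0 (3 * a)) :=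
    isCompact_Icc.uniformContinuousOn_of_continuous
      (Real.continuous_rpow_const hα).continuousOn
  refine hu.comp_tendstoUniformly_eventually (s := Set.Icc 0 (3 * a)) ?_ ?_
    (tendstoUniformly_radius_sq ha h)
  · filter_upwards [Ioo_mem_nhdsGT ha] with ρ h1 ψ
    have hb := ((h ρ h1.1 ψ).bounds ha h1.1 h1.2).2
    refine ⟨by have := h1.1; positivity, ?_⟩
    nlinarith [(abs_le.1 hb).2, Real.cos_le_one ψ, h1.2]
  · intro ψ
    constructor
    · nlinarith [Real.neg_one_le_cos ψ]
    · nlinarith [Real.cos_le_one ψ]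

theorem abs_rpow_le (ha : 0 < a) {α : ℝ} (hα : 0 ≤ α) (ψ : ℝ) :
    |(a * (1 + Real.cos ψ)) ^ α| ≤ (2 * a) ^ α := by
  have h0 : 0 ≤ a * (1 + Real.cos ψ) := by nlinarith [Real.neg_one_le_cos ψ]
  rw [abs_of_nonneg (Real.rpow_nonneg h0 _)]
  exact Real.rpow_le_rpow h0 (by nlinarith [Real.cos_le_one ψ]) hα

/-- Since $r\ge0$, $r^k/\rho^{k/2}=(r^2/\rho)^{k/2}$, which converges uniformly. The same quantity
is bounded by $B+1$, so the $o(r^k)$ error divided by $\rho^{k/2}$ tends to $0$ uniformly. -/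
theorem tendstoUniformly_of_expansion (ha : 0 < a)
    (h : ∀ ρ > 0, ∀ ψ, AreBLCoords a ρ ψ (r ρ ψ) (θ ρ ψ)) {g : ℝ → ℝ} {C : ℝ} {k : ℕ}
    (hg : (fun s => g s - C * s ^ k) =o[𝓝 0] fun s => s ^ k) :
    TendstoUniformly (fun ρ ψ => g (r ρ ψ) / ρ ^ ((k : ℝ) / 2))
      (fun ψ => C * (a * (1 + Real.cos ψ)) ^ ((k : ℝ) / 2)) (𝓝[>] 0) := by
  have hk : (0 : ℝ) ≤ (k : ℝ) / 2 := by positivity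
  have h1 := tendstoUniformly_radius_rpow ha h hk
  have hB : (0 : ℝ) < (2 * a) ^ ((k : ℝ) / 2) := by positivity
  set B := (2 * a) ^ ((k : ℝ) / 2)
  have h2 : TendstoUniformly (fun ρ ψ => g (r ρ ψ) / ρ ^ ((k : ℝ) / 2) -
      C * (r ρ ψ ^ 2 / ρ) ^ ((k : ℝ) / 2)) (fun _ => 0) (𝓝[>] 0) := by
    rw [Metric.tendstoUniformly_iff] at h1 ⊢
    intro ε hε
    have hε' : 0 < ε / (2 * (B + 1)) := by positivity
    filter_upwards [eventually_radius ha (hg.def hε'), h1 1 one_pos, self_mem_nhdsWithin]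
      with ρ e1 e2 hρ ψ
    have hρ : 0 < ρ := hρ
    have hco := h ρ hρ ψ
    have e1 := e1 ψ _ _ hco
    have hr0 : 0 ≤ r ρ ψ := hco.1
    have hrk : (r ρ ψ ^ 2 / ρ) ^ ((k : ℝ) / 2) = r ρ ψ ^ k / ρ ^ ((k : ℝ) / 2) := by
      rw [Real.div_rpow (sq_nonneg _) hρ.le, ← Real.rpow_natCast (r ρ ψ) 2,
        ← Real.rpow_mul hr0, ← Real.rpow_natCast (r ρ ψ) k]
      congr 2
      push_cast
      ring
    have hle : (r ρ ψ ^ 2 / ρ) ^ ((k : ℝ) / 2) ≤ B + 1 := by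
      have e2 := e2 ψ
      rw [dist_comm, Real.dist_eq] at e2
      linarith [(abs_lt.1 e2).2, (abs_le.1 (abs_rpow_le ha hk ψ)).2]
    rw [dist_zero_left, hrk]
    have hd : g (r ρ ψ) / ρ ^ ((k : ℝ) / 2) - C * (r ρ ψ ^ k / ρ ^ ((k : ℝ) / 2)) =
        (g (r ρ ψ) - C * r ρ ψ ^ k) / ρ ^ ((k : ℝ) / 2) := by ring
    rw [hd, norm_div, Real.norm_of_nonneg (Real.rpow_nonneg hρ.le _)]
    rw [Real.norm_of_nonneg (pow_nonneg hr0 _)] at e1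
    have hpos : 0 < ρ ^ ((k : ℝ) / 2) := Real.rpow_pos_of_pos hρ _
    calc _ ≤ ε / (2 * (B + 1)) * r ρ ψ ^ k / ρ ^ ((k : ℝ) / 2) := by gcongr
      _ = ε / (2 * (B + 1)) * (r ρ ψ ^ 2 / ρ) ^ ((k : ℝ) / 2) := by rw [hrk]; ring
      _ ≤ ε / (2 * (B + 1)) * (B + 1) := by gcongr
      _ = ε / 2 := by field_simp
      _ < ε := by linarith
  refine tendstoUniformly_congr (h2.add (tendstoUniformly_const_mul h1 C))
    (Eventually.of_forall fun ρ ψ => ?_) fun ψ => ?_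
  · simp
  · simp

variable {n : ℕ} {m : ℝ} {M : ℝ → ℝ}

/-- In $\mathcal R=2f''/\Sigma$ the factor $f''$ contributes $(\rho a(1+\cos\psi))^{(n-1)/2}$ and
$1/\Sigma\sim1/(2a\rho)$ lowers the powers of $\rho$ and of $a$ by one. -/
theorem ringLimit_curvScalar (ha : 0 < a) (hn : 3 ≤ n) (hM : ContDiffAt ℝ n M 0)
    (hexp : (fun s => M s - m * s ^ n) =O[𝓝[>] 0] fun s => s ^ (n + 1))
    (h : ∀ ρ > 0, ∀ ψ, AreBLCoords a ρ ψ (r ρ ψ) (θ ρ ψ)) (t φ : ℝ) :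
    RingLimit r θ t φ (curvScalar a M) (((n : ℝ) - 3) / 2)
      (fun ψ => m * n * (1 + n) * (1 + Real.cos ψ) ^ (((n : ℝ) - 1) / 2) *
        a ^ (((n : ℝ) - 3) / 2)) := by
  have hM2 : ContDiffAt ℝ 2 M 0 := hM.of_le (by norm_cast; omega)
  have h1 := tendstoUniformly_of_expansion ha h (mul_mass_expansion hn hM hexp).2
  have hcast : ((n - 1 : ℕ) : ℝ) = (n : ℝ) - 1 := by rw [Nat.cast_sub (by omega)]; simp
  rw [hcast] at h1
  have hα : 0 ≤ ((n : ℝ) - 1) / 2 := by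
    have : (3 : ℝ) ≤ n := by exact_mod_cast hn
    linarith
  have hs : ((n : ℝ) - 1) / 2 = ((n : ℝ) - 3) / 2 + 1 := by ring
  have h2 := tendstoUniformly_const_mul (tendstoUniformly_mul_of_bounded h1
    (tendstoUniformly_inv_sigma ha h) (fun ψ => by
      rw [abs_mul]; exact mul_le_mul_of_nonneg_left (abs_rpow_le ha hα ψ) (abs_nonneg _))
    (fun _ => le_rfl)) 2
  refine tendstoUniformly_congr h2 ?_ fun ψ => ?_
  · filter_upwards [eventually_blRegular ha hM2, self_mem_nhdsWithin] with ρ hreg hρ ψ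
    have hρ : 0 < ρ := hρ
    rw [(hreg ψ _ _ (h ρ hρ ψ) t φ).curvScalar_eq]
    have hp : ρ ^ (((n : ℝ) - 3) / 2) ≠ 0 := (Real.rpow_pos_of_pos hρ _).ne'
    rw [hs, Real.rpow_add_one hρ.ne']
    simp
    field_simp
  · have h0 : 0 ≤ 1 + Real.cos ψ := by linarith [Real.neg_one_le_cos ψ]
    rw [Real.mul_rpow ha.le h0]
    conv_rhs => rw [hs]
    conv_lhs => rw [hs]
    rw [Real.rpow_add_one ha.ne']
    field_simp
    ring

theorem ringLimit_density (ha : 0 < a) (hn : 3 ≤ n) (hM : ContDiffAt ℝ n M 0)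
    (hexp : (fun s => M s - m * s ^ n) =O[𝓝[>] 0] fun s => s ^ (n + 1))
    (h : ∀ ρ > 0, ∀ ψ, AreBLCoords a ρ ψ (r ρ ψ) (θ ρ ψ)) (t φ : ℝ) :
    RingLimit r θ t φ (density a M) (((n : ℝ) - 3) / 2)
      (fun ψ => m * n / 2 * (1 + Real.cos ψ) ^ (((n : ℝ) + 1) / 2) *
        a ^ (((n : ℝ) - 3) / 2)) := by
  have hM2 : ContDiffAt ℝ 2 M 0 := hM.of_le (by norm_cast; omega)
  have h1 := tendstoUniformly_of_expansion ha h (mul_mass_expansion hn hM hexp).1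
  have hcast : ((n + 1 : ℕ) : ℝ) = (n : ℝ) + 1 := by push_cast; rfl
  rw [hcast] at h1
  have hα : 0 ≤ ((n : ℝ) + 1) / 2 := by positivity
  have hs : ((n : ℝ) + 1) / 2 = ((n : ℝ) - 3) / 2 + 1 + 1 := by ring
  have hi := tendstoUniformly_inv_sigma ha h
  have h2 := tendstoUniformly_const_mul (tendstoUniformly_mul_of_bounded h1
    (tendstoUniformly_mul_of_bounded hi hi (fun _ => le_rfl) (fun _ => le_rfl)) (fun ψ => by
      rw [abs_mul]; exact mul_le_mul_of_nonneg_left (abs_rpow_le ha hα ψ) (abs_nonneg _))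
    (fun _ => le_rfl)) 2
  refine tendstoUniformly_congr h2 ?_ fun ψ => ?_
  · filter_upwards [eventually_blRegular ha hM2, self_mem_nhdsWithin] with ρ hreg hρ ψ
    have hρ : 0 < ρ := hρ
    have hp : ρ ^ (((n : ℝ) - 3) / 2) ≠ 0 := (Real.rpow_pos_of_pos hρ _).ne'
    have hS := (hreg ψ _ _ (h ρ hρ ψ) t φ).sigma_ne
    rw [(hreg ψ _ _ (h ρ hρ ψ) t φ).density_eq, ricciAngular]
    rw [hs, Real.rpow_add_one hρ.ne', Real.rpow_add_one hρ.ne']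
    simp only [blSigma] at hS ⊢
    simp at hS ⊢
    field_simp
  · have h0 : 0 ≤ 1 + Real.cos ψ := by linarith [Real.neg_one_le_cos ψ]
    rw [Real.mul_rpow ha.le h0]
    conv_rhs => rw [hs]
    conv_lhs => rw [hs]
    rw [Real.rpow_add_one ha.ne', Real.rpow_add_one ha.ne']
    field_simp

theorem ringLimit_pressureZ (ha : 0 < a) (hn : 3 ≤ n) (hM : ContDiffAt ℝ n M 0)
    (hexp : (fun s => M s - m * s ^ n) =O[𝓝[>] 0] fun s => s ^ (n + 1))
    (h : ∀ ρ > 0, ∀ ψ, AreBLCoords a ρ ψ (r ρ ψ) (θ ρ ψ)) (t φ : ℝ) :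
    RingLimit r θ t φ (pressureZ a M) (((n : ℝ) - 3) / 2)
      (fun ψ => -(m * n / 2 * (1 + Real.cos ψ) ^ (((n : ℝ) + 1) / 2) *
        a ^ (((n : ℝ) - 3) / 2))) := by
  have hM2 : ContDiffAt ℝ 2 M 0 := hM.of_le (by norm_cast; omega)
  refine tendstoUniformly_congr (tendstoUniformly_const_mul
    (ringLimit_density ha hn hM hexp h t φ) (-1)) ?_ fun ψ => by ring
  filter_upwards [eventually_blRegular ha hM2, self_mem_nhdsWithin] with ρ hreg hρ ψ
  have hreg := hreg ψ _ _ (h ρ hρ ψ) t φ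
  rw [hreg.pressureZ_eq, hreg.density_eq]
  ring

/-- $-A=B-\tfrac12\mathcal R$, so the limit comes from those of $\mu$ and $\mathcal R$; the factor
$\cos\psi-n$ is $(1+\cos\psi)-(n+1)$. -/
theorem ringLimit_of_eq_neg_ricciRadial (ha : 0 < a) (hn : 3 ≤ n) (hM : ContDiffAt ℝ n M 0)
    (hexp : (fun s => M s - m * s ^ n) =O[𝓝[>] 0] fun s => s ^ (n + 1))
    (h : ∀ ρ > 0, ∀ ψ, AreBLCoords a ρ ψ (r ρ ψ) (θ ρ ψ)) (t φ : ℝ) {F : Pt → ℝ}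
    (hF : ∀ p, BLRegular a M p → F p = -ricciRadial a (p 1) (M (p 1) * p 1)
        (deriv (fun x => M x * x) (p 1)) (deriv (deriv (fun x => M x * x)) (p 1))
        (Real.cos (p 2))) :
    RingLimit r θ t φ F (((n : ℝ) - 3) / 2)
      (fun ψ => m * n / 2 * (Real.cos ψ - n) * (1 + Real.cos ψ) ^ (((n : ℝ) - 1) / 2) *
        a ^ (((n : ℝ) - 3) / 2)) := by
  have hM2 : ContDiffAt ℝ 2 M 0 := hM.of_le (by norm_cast; omega)
  refine tendstoUniformly_congr ((ringLimit_density ha hn hM hexp h t φ).sub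
    (tendstoUniformly_const_mul (ringLimit_curvScalar ha hn hM hexp h t φ) (1 / 2))) ?_ fun ψ => ?_
  · filter_upwards [eventually_blRegular ha hM2, self_mem_nhdsWithin] with ρ hreg hρ ψ
    have hreg := hreg ψ _ _ (h ρ hρ ψ) t φ
    simp only [Pi.sub_apply]
    rw [hF _ hreg, hreg.density_eq, hreg.curvScalar_eq, ricciRadial, ricciAngular, blSigma]
    ring
  · have h0 : 0 ≤ 1 + Real.cos ψ := by linarith [Real.neg_one_le_cos ψ]
    have hs : ((n : ℝ) + 1) / 2 = ((n : ℝ) - 1) / 2 + 1 := by ring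
    have hne : ((n : ℝ) - 1) / 2 + 1 ≠ 0 := by rw [← hs]; positivity
    simp only [Pi.sub_apply]
    -- The base vanishes at $\psi=\pi$, so the exponent law needs a nonzero total exponent instead
    -- of a nonzero base.
    rw [hs, Real.rpow_add_one' h0 hne]
    ring

theorem continuousAtRing_zero {F : Pt → ℝ} {f : ℝ → ℝ} {s A t φ : ℝ} (hs : 0 < s)
    (hF : RingLimit r θ t φ F s f) (hf : ∀ ψ, |f ψ| ≤ A) : ContinuousAtRing r θ t φ F 0 := by
  have hρ : TendstoUniformly (fun (ρ : ℝ) (_ : ℝ) => ρ ^ s) (fun _ => 0) (𝓝[>] 0) := by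
    have hc : Tendsto (fun ρ : ℝ => ρ ^ s) (𝓝[>] 0) (𝓝 0) := by
      have := (Real.continuous_rpow_const hs.le).tendsto 0
      rw [Real.zero_rpow hs.ne'] at this
      exact this.mono_left nhdsWithin_le_nhds
    rw [Metric.tendstoUniformly_iff]
    intro ε hε
    filter_upwards [Metric.tendsto_nhds.1 hc ε hε] with ρ h _
    rw [dist_comm]
    exact h
  refine tendstoUniformly_congr (tendstoUniformly_mul_of_bounded hF hρ hf
    (B := 0) (fun _ => by simp)) ?_ fun ψ => by simp
  filter_upwards [self_mem_nhdsWithin] with ρ hρ ψ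
  have : ρ ^ s ≠ 0 := (Real.rpow_pos_of_pos hρ _).ne'
  field_simp

/-- A continuous extension would force the limits along all directions to agree; with exponent $0$
the rescaling is trivial. -/
theorem not_continuousAtRing {F : Pt → ℝ} {f : ℝ → ℝ} {t φ ψ₁ ψ₂ : ℝ}
    (hF : RingLimit r θ t φ F 0 f) (hf : f ψ₁ ≠ f ψ₂) :
    ¬ ∃ L, ContinuousAtRing r θ t φ F L := by
  rintro ⟨L, hL⟩
  have h1 : ∀ ψ, f ψ = L := fun ψ =>
    tendsto_nhds_unique ((hF.tendsto_at ψ).congr fun ρ => by simp) (hL.tendsto_at ψ)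
  exact hf ((h1 _).trans (h1 _).symm)

end
end RotatingBH
end

noncomputable section
namespace RotatingBH

/-! ### From Kerr-Schild to Boyer-Lindquist coordinates -/

theorem pullback_ksMetric (Φ : Pt → Pt) (a : ℝ) (M : ℝ → ℝ) (p : Pt) (i j : Fin 4) :
    pullback Φ (ksMetric a M) p i j =
      -(pd i (fun q => Φ q 0) p * pd j (fun q => Φ q 0) p) +
      pd i (fun q => Φ q 1) p * pd j (fun q => Φ q 1) p +
      pd i (fun q => Φ q 2) p * pd j (fun q => Φ q 2) p +
      pd i (fun q => Φ q 3) p * pd j (fun q => Φ q 3) p +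
      2 * ksH a M (Φ p) * ((∑ k, pd i (fun q => Φ q k) p * ksForm a (Φ p) k) *
        (∑ k, pd j (fun q => Φ q k) p * ksForm a (Φ p) k)) := by
  simp only [pullback, Matrix.of_apply, ksMetric, Matrix.add_apply, Matrix.smul_apply,
    Matrix.vecMulVec_apply, Fin.sum_univ_four, smul_eq_mul, Matrix.diagonal_apply]
  simp
  ring

theorem hasDerivAt_integral_zero {g : ℝ → ℝ} {δ x : ℝ} (hg : ContinuousOn g (Set.Ioo (-δ) δ))
    (hx : x ∈ Set.Ioo (-δ) δ) : HasDerivAt (fun y => ∫ s in (0 : ℝ)..y, g s) (g x) x := by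
  have hδ : 0 < δ := by linarith [hx.1, hx.2]
  have h0 : (0 : ℝ) ∈ Set.Ioo (-δ) δ := ⟨by linarith, hδ⟩
  refine intervalIntegral.integral_hasDerivAt_right ?_ ?_ (hg.continuousAt (Ioo_mem_nhds hx.1 hx.2))
  · exact (hg.mono (Set.ordConnected_Ioo.uIcc_subset h0 hx)).intervalIntegrable
  · exact hg.stronglyMeasurableAtFilter isOpen_Ioo x hx

/-- In spheroidal coordinates the discriminant of the quartic is the perfect square
$(r^2+a^2c^2)^2$. -/
theorem ksRadius_spheroidal {a r s c : ℝ} (hr : 0 ≤ r) (hsc : s ^ 2 + c ^ 2 = 1) {x y z : ℝ}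
    (hxy : x ^ 2 + y ^ 2 = s ^ 2 * (r ^ 2 + a ^ 2)) (hz : z = r * c) : ksRadius a x y z = r := by
  have h1 : x ^ 2 + y ^ 2 + z ^ 2 - a ^ 2 = r ^ 2 - a ^ 2 * c ^ 2 := by
    rw [hxy, hz]
    linear_combination (r ^ 2 + a ^ 2) * hsc
  have h2 : (r ^ 2 - a ^ 2 * c ^ 2) ^ 2 + 4 * a ^ 2 * z ^ 2 = (r ^ 2 + a ^ 2 * c ^ 2) ^ 2 := by
    rw [hz]; ring
  rw [ksRadius, h1, h2, Real.sqrt_sq (by positivity)]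
  have h3 : (r ^ 2 - a ^ 2 * c ^ 2 + (r ^ 2 + a ^ 2 * c ^ 2)) / 2 = r ^ 2 := by ring
  rw [h3, Real.sqrt_sq hr]

/-- The angle `φ + ∫ a/Δ dr` of the Kerr-Schild coordinates. -/
def blAngle (a : ℝ) (M : ℝ → ℝ) (p : Pt) : ℝ := p 3 + ∫ s in (0 : ℝ)..(p 1), a / blDelta a M s

theorem blMap_eq (a : ℝ) (M : ℝ → ℝ) (p : Pt) : blMap a M p =
    ![p 0 + (∫ s in (0 : ℝ)..(p 1), (s ^ 2 + a ^ 2) / blDelta a M s) - p 1,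
      Real.sin (p 2) * (p 1 * Real.cos (blAngle a M p) - a * Real.sin (blAngle a M p)),
      Real.sin (p 2) * (p 1 * Real.sin (blAngle a M p) + a * Real.cos (blAngle a M p)),
      p 1 * Real.cos (p 2)] := rfl

section
variable {a δ : ℝ} {M : ℝ → ℝ} {p : Pt}

theorem ksForm_blMap (ha : 0 < a) (hr : 0 < p 1) :
    ksRadius a (blMap a M p 1) (blMap a M p 2) (blMap a M p 3) = p 1 ∧
    ksForm a (blMap a M p) = ![-1, -(Real.sin (p 2) * Real.cos (blAngle a M p)),
      -(Real.sin (p 2) * Real.sin (blAngle a M p)), -Real.cos (p 2)] := by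
  have hw := Real.sin_sq_add_cos_sq (blAngle a M p)
  have hrad : ksRadius a (blMap a M p 1) (blMap a M p 2) (blMap a M p 3) = p 1 := by
    refine ksRadius_spheroidal hr.le (Real.sin_sq_add_cos_sq (p 2)) ?_ ?_
    · simp only [blMap_eq]
      simp
      linear_combination (Real.sin (p 2) ^ 2 * (p 1 ^ 2 + a ^ 2)) * hw
    · simp [blMap_eq]
  refine ⟨hrad, ?_⟩
  have hR : p 1 ^ 2 + a ^ 2 ≠ 0 := by positivity
  simp only [ksForm, hrad]
  simp only [blMap_eq]
  ext i
  fin_cases i <;> simp <;> field_simp <;> ring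

/-- The Jacobian matrix `∂ᵢΦᵏ` of `blMap`. -/
def blJacobian (a r s c D A B : ℝ) : Matrix (Fin 4) (Fin 4) ℝ :=
  !![1, 0, 0, 0;
     (r ^ 2 + a ^ 2) / D - 1, s * (A - r * B * (a / D) - a * A * (a / D)),
       s * (B + r * A * (a / D) - a * B * (a / D)), c;
     0, c * (r * A - a * B), c * (r * B + a * A), -(r * s);
     0, s * (-(r * B) - a * A), s * (r * A - a * B), 0]

theorem pd_blMap (hδ : ∀ x ∈ Set.Ioo (-δ) δ, ContinuousAt M x ∧ blDelta a M x ≠ 0)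
    (hr : p 1 ∈ Set.Ioo (-δ) δ) (i k : Fin 4) :
    pd i (fun q => blMap a M q k) p = blJacobian a (p 1) (Real.sin (p 2)) (Real.cos (p 2))
      (blDelta a M (p 1)) (Real.cos (blAngle a M p)) (Real.sin (blAngle a M p)) i k := by
  have hDc : ContinuousOn (blDelta a M) (Set.Ioo (-δ) δ) := by
    have hMc : ContinuousOn M (Set.Ioo (-δ) δ) := fun x hx => (hδ x hx).1.continuousWithinAt
    unfold blDelta
    fun_prop
  have d1 : HasDerivAt (fun y => ∫ s in (0 : ℝ)..y, a / blDelta a M s) (a / blDelta a M (p 1))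
      (p 1) := hasDerivAt_integral_zero (continuousOn_const.div hDc fun x hx => (hδ x hx).2) hr
  have d2 : HasDerivAt (fun y => ∫ s in (0 : ℝ)..y, (s ^ 2 + a ^ 2) / blDelta a M s)
      ((p 1 ^ 2 + a ^ 2) / blDelta a M (p 1)) (p 1) := by
    refine hasDerivAt_integral_zero (g := fun s => (s ^ 2 + a ^ 2) / blDelta a M s) ?_ hr
    exact ContinuousOn.div (by fun_prop) hDc fun x hx => (hδ x hx).2
  have dx := hasDerivAt_id' (p 1)
  have dw : HasDerivAt (fun y => p 3 + ∫ s in (0 : ℝ)..y, a / blDelta a M s)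
    (a / blDelta a M (p 1)) (p 1) := d1.const_add _
  have dw3 : HasDerivAt (fun y => y + ∫ s in (0 : ℝ)..(p 1), a / blDelta a M s) 1 (p 3) :=
    (hasDerivAt_id' (p 3)).add_const _
  have ds := Real.hasDerivAt_sin (p 2)
  have dc := Real.hasDerivAt_cos (p 2)
  have e0 : ∀ k, HasDerivAt (fun y => blMap a M (Function.update p 0 y) k) (blJacobian a (p 1)
      (Real.sin (p 2)) (Real.cos (p 2)) (blDelta a M (p 1)) (Real.cos (blAngle a M p))
      (Real.sin (blAngle a M p)) 0 k) (p 0) := by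
    intro k
    fin_cases k <;> simp [blMap, blJacobian]
    · exact hasDerivAt_id' _
    · exact hasDerivAt_const _ _
    · exact hasDerivAt_const _ _
    · exact hasDerivAt_const _ _
  have e1 : ∀ k, HasDerivAt (fun y => blMap a M (Function.update p 1 y) k) (blJacobian a (p 1)
      (Real.sin (p 2)) (Real.cos (p 2)) (blDelta a M (p 1)) (Real.cos (blAngle a M p))
      (Real.sin (blAngle a M p)) 1 k) (p 1) := by
    intro k
    fin_cases k <;> simp [blMap, blJacobian, blAngle]
    · exact (d2.const_add (p 0)).fun_sub dx
    · exact (((dx.fun_mul dw.cos).fun_sub (dw.sin.const_mul a)).const_mul _).congr_deriv (by ring)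
    · exact (((dx.fun_mul dw.sin).fun_add (dw.cos.const_mul a)).const_mul _).congr_deriv (by ring)
    · exact (dx.mul_const _).congr_deriv (by ring)
  have e2 : ∀ k, HasDerivAt (fun y => blMap a M (Function.update p 2 y) k) (blJacobian a (p 1)
      (Real.sin (p 2)) (Real.cos (p 2)) (blDelta a M (p 1)) (Real.cos (blAngle a M p))
      (Real.sin (blAngle a M p)) 2 k) (p 2) := by
    intro k
    fin_cases k <;> simp [blMap, blJacobian, blAngle]
    · exact hasDerivAt_const _ _
    · exact ds.mul_const _
    · exact ds.mul_const _
    · exact (dc.const_mul _).congr_deriv (by ring)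
  have e3 : ∀ k, HasDerivAt (fun y => blMap a M (Function.update p 3 y) k) (blJacobian a (p 1)
      (Real.sin (p 2)) (Real.cos (p 2)) (blDelta a M (p 1)) (Real.cos (blAngle a M p))
      (Real.sin (blAngle a M p)) 3 k) (p 3) := by
    intro k
    fin_cases k <;> simp [blMap, blJacobian, blAngle]
    · exact hasDerivAt_const _ _
    · exact (((dw3.cos.const_mul _).fun_sub (dw3.sin.const_mul a)).const_mul _).congr_deriv (by ring)
    · exact (((dw3.sin.const_mul _).fun_add (dw3.cos.const_mul a)).const_mul _).congr_deriv (by ring)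
    · exact hasDerivAt_const _ _
  fin_cases i
  · exact (e0 k).deriv
  · exact (e1 k).deriv
  · exact (e2 k).deriv
  · exact (e3 k).deriv

/-- The pulled-back form is $k=-(dt-a\sin^2\theta\,d\varphi)-(\Sigma/\Delta)\,dr$: the integrals in
the change of coordinates remove its $d\theta$ part and leave a multiple of $dr$. -/
theorem blJacobian_ksForm {a r s c D A B : ℝ} (hsc : c ^ 2 = 1 - s ^ 2)
    (hw : A ^ 2 = 1 - B ^ 2) (i : Fin 4) :
    ∑ k, blJacobian a r s c D A B i k * ![-1, -(s * A), -(s * B), -c] k =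
      ![-1, -((r ^ 2 + a ^ 2 - a ^ 2 * s ^ 2) / D), 0, a * s ^ 2] i := by
  rw [Fin.sum_univ_four]
  fin_cases i <;> simp [blJacobian]
  · linear_combination (-(s ^ 2 * (1 - a ^ 2 / D))) * hw - hsc
  · linear_combination (-(s * c * r)) * hw
  · linear_combination (a * s ^ 2) * hw

theorem blJacobian_flat {a r s c D A B : ℝ} (hsc : c ^ 2 = 1 - s ^ 2) (hw : A ^ 2 = 1 - B ^ 2)
    {J : Matrix (Fin 4) (Fin 4) ℝ} (hJ : J = blJacobian a r s c D A B) (i j : Fin 4) :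
    -(J i 0 * J j 0) + J i 1 * J j 1 + J i 2 * J j 2 + J i 3 * J j 3 =
      !![-1, -((r ^ 2 + a ^ 2) / D - 1), 0, 0;
         -((r ^ 2 + a ^ 2) / D - 1), -((r ^ 2 + a ^ 2) / D - 1) ^ 2 +
          s ^ 2 * ((1 - a ^ 2 / D) ^ 2 + r ^ 2 * (a / D) ^ 2) + 1 - s ^ 2, 0,
          s ^ 2 * (-a + a * (r ^ 2 + a ^ 2) / D);
         0, 0, r ^ 2 + a ^ 2 * (1 - s ^ 2), 0;
         0, s ^ 2 * (-a + a * (r ^ 2 + a ^ 2) / D), 0, s ^ 2 * (r ^ 2 + a ^ 2)] i j := by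
  subst hJ
  fin_cases i <;> fin_cases j <;> simp [blJacobian]
  · linear_combination (s ^ 2 * ((1 - a ^ 2 / D) ^ 2 + r ^ 2 * (a / D) ^ 2)) * hw + hsc
  · linear_combination (s * c * r) * hw
  · linear_combination (s ^ 2 * (-a + a * (r ^ 2 + a ^ 2) / D)) * hw
  · linear_combination (s * c * r) * hw
  · linear_combination (c ^ 2 * (r ^ 2 + a ^ 2)) * hw + (r ^ 2 + a ^ 2) * hsc
  · ring
  · linear_combination (s ^ 2 * (-a + a * (r ^ 2 + a ^ 2) / D)) * hw
  · ring
  · linear_combination (s ^ 2 * (r ^ 2 + a ^ 2)) * hw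

/-- With $H=f/\Sigma$, the $dt\,dr$ and $dr\,d\varphi$ terms of the flat part cancel those of
$2H\,k\otimes k$, because $2f=r^2+a^2-\Delta$. -/
theorem pullback_blMap (ha : 0 < a)
    (hδ : ∀ x ∈ Set.Ioo (-δ) δ, ContinuousAt M x ∧ blDelta a M x ≠ 0) (h0 : 0 < p 1)
    (h1 : p 1 < δ) : pullback (blMap a M) (ksMetric a M) p = blMetric a M p := by
  have hr : p 1 ∈ Set.Ioo (-δ) δ := ⟨by linarith, h1⟩
  have hS : blSigma a (p 1) (p 2) ≠ 0 := by unfold blSigma; positivity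
  have hD := (hδ _ hr).2
  obtain ⟨hrad, hform⟩ := ksForm_blMap (M := M) ha h0
  have hH : ksH a M (blMap a M p) = M (p 1) * p 1 / blSigma a (p 1) (p 2) := by
    simp only [ksH, hrad]
    have : blMap a M p 3 = p 1 * Real.cos (p 2) := rfl
    rw [this]
    have e : p 1 ^ 4 + a ^ 2 * (p 1 * Real.cos (p 2)) ^ 2 = p 1 ^ 2 * blSigma a (p 1) (p 2) := by
      unfold blSigma; ring
    rw [e]
    field_simp
  rw [blMetric_eq_components a M p hS]
  ext i j
  rw [pullback_ksMetric]
  have hsc := Real.cos_sq' (p 2)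
  have hw := Real.cos_sq' (blAngle a M p)
  simp only [pd_blMap hδ hr, hH, hform]
  rw [blJacobian_flat hsc hw rfl, blJacobian_ksForm hsc hw, blJacobian_ksForm hsc hw]
  have hDelta : blDelta a M (p 1) = p 1 ^ 2 + a ^ 2 - 2 * (M (p 1) * p 1) := by
    unfold blDelta; ring
  rw [hDelta] at hD ⊢
  simp only [blComponents, blockMatrix, blSigma] at hS ⊢
  generalize M (p 1) * p 1 = f at *
  generalize p 1 = r at *
  generalize Real.sin (p 2) = s at *
  generalize Real.cos (p 2) = c at *
  generalize hSd : r ^ 2 + a ^ 2 * c ^ 2 = S at *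
  generalize hDd : r ^ 2 + a ^ 2 - 2 * f = D at *
  have hf : f = (r ^ 2 + a ^ 2 - D) / 2 := by linarith
  subst hf
  fin_cases i <;> fin_cases j <;> simp <;> field_simp <;> (try rw [← hSd, hsc]) <;> ring

end
end RotatingBH
end

noncomputable section
namespace RotatingBH

/-! ### Toroidal coordinates -/

/-- The Jacobian matrix `∂ᵢΦᵏ` of `toroidalMap`. -/
def toroidalJacobian (a : ℝ) (q : Pt) : Matrix (Fin 4) (Fin 4) ℝ :=
  !![1, 0, 0, 0;
     0, Real.cos (q 2) * Real.cos (q 3), Real.cos (q 2) * Real.sin (q 3), Real.sin (q 2);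
     0, -(q 1 * Real.sin (q 2) * Real.cos (q 3)), -(q 1 * Real.sin (q 2) * Real.sin (q 3)),
      q 1 * Real.cos (q 2);
     0, -((a + q 1 * Real.cos (q 2)) * Real.sin (q 3)), (a + q 1 * Real.cos (q 2)) * Real.cos (q 3),
      0]

theorem hasDerivAt_toroidalMap (a : ℝ) (q : Pt) (i k : Fin 4) :
    HasDerivAt (fun y => toroidalMap a (Function.update q i y) k) (toroidalJacobian a q i k)
      (q i) := by
  have ds := fun i => Real.hasDerivAt_sin (q i)
  have dc := fun i => Real.hasDerivAt_cos (q i)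
  have dx := fun i => hasDerivAt_id' (q i)
  fin_cases i <;> fin_cases k <;> simp [toroidalMap, toroidalJacobian]
  · exact dx 0
  · exact hasDerivAt_const _ _
  · exact hasDerivAt_const _ _
  · exact hasDerivAt_const _ _
  · exact hasDerivAt_const _ _
  · exact ((((dx 1).mul_const _).const_add a).mul_const _).congr_deriv (by ring)
  · exact ((((dx 1).mul_const _).const_add a).mul_const _).congr_deriv (by ring)
  · exact ((dx 1).mul_const _).congr_deriv (by ring)
  · exact hasDerivAt_const _ _
  · exact ((((dc 2).const_mul _).const_add a).mul_const _).congr_deriv (by ring)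
  · exact ((((dc 2).const_mul _).const_add a).mul_const _).congr_deriv (by ring)
  · exact (ds 2).const_mul _
  · exact hasDerivAt_const _ _
  · exact ((dc 3).const_mul _).congr_deriv (by ring)
  · exact (ds 3).const_mul _
  · exact hasDerivAt_const _ _

theorem toroidalJacobian_flat (a : ℝ) (q : Pt) (i j : Fin 4) :
    -(toroidalJacobian a q i 0 * toroidalJacobian a q j 0)
      + toroidalJacobian a q i 1 * toroidalJacobian a q j 1
      + toroidalJacobian a q i 2 * toroidalJacobian a q j 2
      + toroidalJacobian a q i 3 * toroidalJacobian a q j 3 =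
    Matrix.diagonal ![-1, 1, q 1 ^ 2, (a + q 1 * Real.cos (q 2)) ^ 2] i j := by
  have h2 := Real.sin_sq_add_cos_sq (q 2)
  have h3 := Real.sin_sq_add_cos_sq (q 3)
  fin_cases i <;> fin_cases j <;> simp [toroidalJacobian]
  · linear_combination Real.cos (q 2) ^ 2 * h3 + h2
  · linear_combination -(q 1 * Real.sin (q 2) * Real.cos (q 2)) * h3
  · ring
  · linear_combination -(q 1 * Real.sin (q 2) * Real.cos (q 2)) * h3
  · linear_combination q 1 ^ 2 * Real.sin (q 2) ^ 2 * h3 + q 1 ^ 2 * h2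
  · ring
  · ring
  · ring
  · linear_combination (a + q 1 * Real.cos (q 2)) ^ 2 * h3

theorem bilin_ksMetric (a : ℝ) (M : ℝ → ℝ) (x : Pt) (v : Fin 4 → ℝ) :
    bilin (ksMetric a M x) v v = -(v 0 * v 0) + v 1 * v 1 + v 2 * v 2 + v 3 * v 3
      + 2 * ksH a M x * (∑ k, v k * ksForm a x k) ^ 2 := by
  simp only [bilin, ksMetric, Matrix.add_apply, Matrix.smul_apply,
    Matrix.vecMulVec_apply, Fin.sum_univ_four, smul_eq_mul, Matrix.diagonal_apply]
  simp
  ring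

/-- The components of `k` in toroidal coordinates. -/
def toroidalForm (a : ℝ) (q : Pt) (i : Fin 4) : ℝ :=
  ∑ k, toroidalJacobian a q i k * ksForm a (toroidalMap a q) k

theorem toroidalMetric_eq (a : ℝ) (M : ℝ → ℝ) (q : Pt) (i j : Fin 4) :
    toroidalMetric a M q i j =
      Matrix.diagonal ![-1, 1, q 1 ^ 2, (a + q 1 * Real.cos (q 2)) ^ 2] i j +
      2 * ksH a M (toroidalMap a q) * (toroidalForm a q i * toroidalForm a q j) := by
  have h : ∀ i k, pd i (fun y => toroidalMap a y k) q = toroidalJacobian a q i k :=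
    fun i k => (hasDerivAt_toroidalMap a q i k).deriv
  rw [toroidalMetric, pullback_ksMetric]
  simp only [h]
  rw [toroidalJacobian_flat]
  rfl

section
variable {a : ℝ} {q : Pt}

/-- The constant comes from $2ra+2a^2\le3(r^2+a^2)$; for the last component the quartic gives
$|z|\le r$. -/
theorem abs_ksForm_le (ha : 0 < a) {x : Pt} (h1 : |x 1| ≤ 2 * a) (h2 : |x 2| ≤ 2 * a) (k : Fin 4) :
    |ksForm a x k| ≤ 3 := by
  have hq := ksRadius_eq a (x 1) (x 2) (x 3)
  have hr : 0 ≤ ksRadius a (x 1) (x 2) (x 3) := Real.sqrt_nonneg _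
  simp only [ksForm]
  generalize ksRadius a (x 1) (x 2) (x 3) = r at *
  have hR : 0 < r ^ 2 + a ^ 2 := by positivity
  have key : ∀ u v : ℝ, |u| ≤ 2 * a → |v| ≤ 2 * a → |r * u + a * v| ≤ 3 * (r ^ 2 + a ^ 2) := by
    intro u v hu hv
    calc |r * u + a * v| ≤ |r * u| + |a * v| := abs_add_le _ _
      _ = r * |u| + a * |v| := by rw [abs_mul, abs_mul, abs_of_nonneg hr, abs_of_pos ha]
      _ ≤ r * (2 * a) + a * (2 * a) := by gcongr
      _ ≤ 3 * (r ^ 2 + a ^ 2) := by nlinarith [sq_nonneg (r - a)]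
  fin_cases k <;> simp
  · rw [abs_div, abs_of_pos hR, div_le_iff₀ hR,
      show -(a * x 2) + -(r * x 1) = -(r * x 1 + a * x 2) by ring, abs_neg]
    exact key _ _ h1 h2
  · rw [abs_div, abs_of_pos hR, div_le_iff₀ hR, abs_sub_comm]
    have := key (x 2) (-x 1) h2 (by rwa [abs_neg])
    rwa [mul_neg, ← sub_eq_add_neg] at this
  · rw [abs_div, abs_of_nonneg hr]
    rcases hr.eq_or_lt with h0 | h0
    -- At $r=0$ the quotient $z/r$ is $0$ by convention.
    · rw [← h0]; simp
    · rw [div_le_iff₀ h0]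
      have hz : x 3 ^ 2 ≤ r ^ 2 := by
        by_contra hlt
        push Not at hlt
        have h4 : (r ^ 2 + a ^ 2) * (r ^ 2 - x 3 ^ 2) = r ^ 2 * (x 1 ^ 2 + x 2 ^ 2) := by
          linear_combination hq
        have : (r ^ 2 + a ^ 2) * (r ^ 2 - x 3 ^ 2) < 0 := mul_neg_of_pos_of_neg hR (by linarith)
        have : 0 ≤ r ^ 2 * (x 1 ^ 2 + x 2 ^ 2) := by positivity
        linarith
      have := abs_le_of_sq_le_sq hz h0.le
      linarith

/-- $24=4\cdot2\cdot3$: four terms, Jacobian entries at most twice the scale (the radius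
$a+\rho\cos\psi$ is at most $2a$), and components of $k$ at most $3$. -/
theorem abs_toroidalForm_le (ha : 0 < a) (h0 : 0 ≤ q 1) (h1 : q 1 ≤ a) (i : Fin 4) :
    |toroidalForm a q i| ≤ 24 * flatRingScale a q i := by
  have hc : ∀ x, |Real.cos x| ≤ 1 := Real.abs_cos_le_one
  have hs : ∀ x, |Real.sin x| ≤ 1 := Real.abs_sin_le_one
  have hX : |a + q 1 * Real.cos (q 2)| ≤ 2 * a := by
    calc _ ≤ |a| + |q 1 * Real.cos (q 2)| := abs_add_le _ _
      _ = a + q 1 * |Real.cos (q 2)| := by rw [abs_mul, abs_of_pos ha, abs_of_nonneg h0]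
      _ ≤ a + a * 1 := by gcongr; exact hc _
      _ = 2 * a := by ring
  have hmul : ∀ {u v A : ℝ}, |u| ≤ A → |v| ≤ 1 → |u * v| ≤ A := fun {u v A} hu hv => by
    rw [abs_mul]
    calc _ ≤ A * 1 := mul_le_mul hu hv (abs_nonneg _) ((abs_nonneg u).trans hu)
      _ = A := mul_one A
  have hf : ∀ k, |ksForm a (toroidalMap a q) k| ≤ 3 :=
    abs_ksForm_le ha (hmul hX (hc _)) (hmul hX (hs _))
  have hq : |q 1| ≤ q 1 := (abs_of_nonneg h0).le
  have hsc : 0 ≤ flatRingScale a q i := by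
    fin_cases i <;> simp [flatRingScale, h0, ha.le]
  have hJ : ∀ k, |toroidalJacobian a q i k| ≤ 2 * flatRingScale a q i := by
    have w1 : ∀ {u A : ℝ}, 0 ≤ A → |u| ≤ A → |u| ≤ 2 * A := fun hA hu => by linarith
    intro k
    fin_cases i <;> fin_cases k <;> simp [toroidalJacobian, flatRingScale, h0, ha.le, -abs_mul]
    · exact (hmul (hc _) (hc _)).trans one_le_two
    · exact (hmul (hc _) (hs _)).trans one_le_two
    · exact (hs _).trans one_le_two
    · exact w1 h0 (hmul (hmul hq (hs _)) (hc _))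
    · exact w1 h0 (hmul (hmul hq (hs _)) (hs _))
    · exact w1 h0 (hmul hq (hc _))
    · exact hmul hX (hs _)
    · exact hmul hX (hc _)
  unfold toroidalForm
  calc _ ≤ ∑ k, |toroidalJacobian a q i k * ksForm a (toroidalMap a q) k| :=
        Finset.abs_sum_le_sum_abs _ _
    _ ≤ ∑ _k : Fin 4, 2 * flatRingScale a q i * 3 := by
        refine Finset.sum_le_sum fun k _ => ?_
        rw [abs_mul]
        exact mul_le_mul (hJ k) (hf k) (abs_nonneg _) (by positivity)
    _ = 24 * flatRingScale a q i := by simp; ring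

theorem ksRadius_toroidalMap_sq_le (ha : 0 < a) (h0 : 0 ≤ q 1) (h1 : q 1 ≤ a) :
    ksRadius a (toroidalMap a q 1) (toroidalMap a q 2) (toroidalMap a q 3) ^ 2 ≤ 4 * a * q 1 := by
  have e : toroidalMap a q 1 ^ 2 + toroidalMap a q 2 ^ 2 + toroidalMap a q 3 ^ 2 - a ^ 2 =
      2 * a * q 1 * Real.cos (q 2) + q 1 ^ 2 := by
    simp [toroidalMap]
    linear_combination (a + q 1 * Real.cos (q 2)) ^ 2 * Real.sin_sq_add_cos_sq (q 3) +
      q 1 ^ 2 * Real.sin_sq_add_cos_sq (q 2)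
  have ez : toroidalMap a q 3 = q 1 * Real.sin (q 2) := rfl
  have haq : 0 ≤ a * q 1 := by positivity
  have hc1 := Real.neg_one_le_cos (q 2)
  have hc2 := Real.cos_le_one (q 2)
  have hb1 : |2 * a * q 1 * Real.cos (q 2) + q 1 ^ 2| ≤ 3 * (a * q 1) := by
    rw [abs_le]; constructor <;> nlinarith
  have hz : |q 1 * Real.sin (q 2)| ≤ q 1 := by
    rw [abs_mul, abs_of_nonneg h0]
    exact mul_le_of_le_one_right h0 (Real.abs_sin_le_one _)
  rw [ksRadius, e, ez]
  generalize 2 * a * q 1 * Real.cos (q 2) + q 1 ^ 2 = b at *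
  generalize q 1 * Real.sin (q 2) = z at *
  have hsq : Real.sqrt (b ^ 2 + 4 * a ^ 2 * z ^ 2) ≤ 5 * (a * q 1) := by
    apply Real.sqrt_le_iff.2 ⟨by positivity, ?_⟩
    have h2 := sq_le_sq.2 (hb1.trans (le_abs_self _))
    have h3 := sq_le_sq.2 (hz.trans (le_abs_self _))
    nlinarith [mul_le_mul_of_nonneg_left h3 (sq_nonneg a), sq_nonneg (a * q 1)]
  rcases le_total 0 ((b + Real.sqrt (b ^ 2 + 4 * a ^ 2 * z ^ 2)) / 2) with h | h
  · rw [Real.sq_sqrt h]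
    linarith [(abs_le.1 hb1).2]
  · rw [Real.sqrt_eq_zero_of_nonpos h]
    nlinarith

variable {n : ℕ} {m : ℝ} {M : ℝ → ℝ}

/-- $|H|\le|\mathcal M|r^3/r^4\le C r^2\le4aC\rho$ for small $r$, the second step using $n\ge3$. The
property `P` shares the same neighbourhood, so that continuity of $\mathcal M$ along a curve can be
extracted too. -/
theorem exists_abs_ksH_le (ha : 0 < a) (hn : 3 ≤ n) (hM : ContDiffAt ℝ n M 0)
    (hexp : (fun s => M s - m * s ^ n) =O[𝓝[>] 0] fun s => s ^ (n + 1)) {P : ℝ → Prop}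
    (hP : ∀ᶠ r in 𝓝 0, P r) :
    ∃ C > 0, ∃ δ > 0, δ ≤ a ∧ ∀ q : Pt, 0 ≤ q 1 → q 1 < δ →
      |ksH a M (toroidalMap a q)| ≤ C * q 1 ∧
      P (ksRadius a (toroidalMap a q 1) (toroidalMap a q 2) (toroidalMap a q 3)) := by
  obtain ⟨C, hC, hbound⟩ := (mass_isBigO hM hexp).exists_pos
  obtain ⟨ε, hε, hball⟩ := Metric.eventually_nhds_iff.1 (hbound.bound.and hP)
  have hε' : 0 < (min ε 1) ^ 2 / (4 * a) := by positivity
  refine ⟨C * (4 * a), by positivity, min a ((min ε 1) ^ 2 / (4 * a)), lt_min ha hε',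
    min_le_left _ _, fun q h0 h1 => ?_⟩
  have hqa : q 1 ≤ a := (h1.trans_le (min_le_left _ _)).le
  have hr := ksRadius_toroidalMap_sq_le ha h0 hqa
  have hr0 : 0 ≤ ksRadius a (toroidalMap a q 1) (toroidalMap a q 2) (toroidalMap a q 3) :=
    Real.sqrt_nonneg _
  simp only [ksH]
  generalize ksRadius a (toroidalMap a q 1) (toroidalMap a q 2) (toroidalMap a q 3) = r at *
  have hlt : r < min ε 1 := by
    have h2 : q 1 < (min ε 1) ^ 2 / (4 * a) := h1.trans_le (min_le_right _ _)
    rw [lt_div_iff₀ (by positivity)] at h2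
    exact lt_of_pow_lt_pow_left₀ 2 (by positivity) (by linarith)
  obtain ⟨hM1, hPr⟩ := hball (y := r) (by
    rw [dist_zero_right, Real.norm_of_nonneg hr0]
    exact hlt.trans_le (min_le_left _ _))
  refine ⟨?_, hPr⟩
  rw [Real.norm_eq_abs, Real.norm_of_nonneg (pow_nonneg hr0 n)] at hM1
  have hM3 : |M r| ≤ C * r ^ 3 := hM1.trans (by
    gcongr ?_ * ?_
    exact pow_le_pow_of_le_one hr0 (hlt.trans_le (min_le_right _ _)).le hn)
  have hden : 0 ≤ r ^ 4 + a ^ 2 * toroidalMap a q 3 ^ 2 := by positivity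
  rw [abs_div, abs_mul, abs_of_nonneg (pow_nonneg hr0 3), abs_of_nonneg hden]
  rcases hr0.eq_or_lt with hz | hz
  · rw [← hz]
    simp
    positivity
  · rw [div_le_iff₀ (by positivity)]
    calc |M r| * r ^ 3 ≤ C * r ^ 3 * r ^ 3 := by gcongr
      _ = C * r ^ 2 * r ^ 4 := by ring
      _ ≤ C * (4 * a * q 1) * (r ^ 4 + a ^ 2 * toroidalMap a q 3 ^ 2) := by
          gcongr
          exact le_add_of_nonneg_right (by positivity)
      _ = C * (4 * a) * q 1 * (r ^ 4 + a ^ 2 * toroidalMap a q 3 ^ 2) := by ring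

theorem toroidalMetric_sub_flat (ha : 0 < a) (hn : 3 ≤ n) (hM : ContDiffAt ℝ n M 0)
    (hexp : (fun s => M s - m * s ^ n) =O[𝓝[>] 0] fun s => s ^ (n + 1)) :
    ∃ C, ∃ δ > 0, ∀ q : Pt, 0 < q 1 → q 1 < δ → ∀ i j,
      |toroidalMetric a M q i j - flatRingMetric a q i j| ≤
        C * q 1 * (flatRingScale a q i * flatRingScale a q j) := by
  obtain ⟨C, hC, δ, hδ, hδa, hH⟩ := exists_abs_ksH_le ha hn hM hexp (P := fun _ => True)
    (Eventually.of_forall fun _ => trivial)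
  -- The first term bounds $(a+\rho\cos\psi)^2-a^2$, at most $3a\rho$, relative to the scale $a^2$;
  -- the second bounds $2H\,k\otimes k$.
  refine ⟨3 / a + 2 * C * 24 ^ 2, δ, hδ, fun q h0 h1 i j => ?_⟩
  have hqa : q 1 ≤ a := (h1.trans_le hδa).le
  have hH := (hH q h0.le h1).1
  have hi := abs_toroidalForm_le ha h0.le hqa i
  have hj := abs_toroidalForm_le ha h0.le hqa j
  have hsc : ∀ i, 0 ≤ flatRingScale a q i := by
    intro i
    fin_cases i <;> simp [flatRingScale, h0.le, ha.le]
  rw [toroidalMetric_eq]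
  have h2 : |2 * ksH a M (toroidalMap a q) * (toroidalForm a q i * toroidalForm a q j)| ≤
      2 * C * 24 ^ 2 * q 1 * (flatRingScale a q i * flatRingScale a q j) := by
    rw [abs_mul, abs_mul, abs_mul, abs_two]
    calc _ ≤ 2 * (C * q 1) * ((24 * flatRingScale a q i) * (24 * flatRingScale a q j)) := by
          have := hsc i
          have := hsc j
          gcongr
      _ = _ := by ring
  have h3 : |Matrix.diagonal ![-1, 1, q 1 ^ 2, (a + q 1 * Real.cos (q 2)) ^ 2] i j -
      flatRingMetric a q i j| ≤ 3 / a * q 1 * (flatRingScale a q i * flatRingScale a q j) := by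
    have hnn : ∀ i j, 0 ≤ 3 / a * q 1 * (flatRingScale a q i * flatRingScale a q j) := fun i j => by
      have := hsc i
      have := hsc j
      positivity
    have h33 : |(a + q 1 * Real.cos (q 2)) ^ 2 - a ^ 2| ≤ 3 / a * q 1 * (a * a) := by
      have e : 3 / a * q 1 * (a * a) = 3 * (a * q 1) := by field_simp
      have hc1 := Real.neg_one_le_cos (q 2)
      have hc2 := Real.cos_le_one (q 2)
      have haq : 0 < a * q 1 := by positivity
      have hcs : Real.cos (q 2) ^ 2 ≤ 1 := by nlinarith
      rw [e, abs_le]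
      constructor <;> nlinarith [mul_le_mul_of_nonneg_left hcs (sq_nonneg (q 1)), sq_nonneg (q 1 * Real.cos (q 2))]
    by_cases hij : i = j
    · subst hij
      have := hnn i i
      fin_cases i <;> simp [flatRingMetric]
      · simpa using this
      · simpa using this
      · simpa using this
      · simpa [flatRingScale] using h33
    · rw [Matrix.diagonal_apply_ne _ hij, flatRingMetric, Matrix.diagonal_apply_ne _ hij]
      simpa using hnn i j
  calc _ = |(Matrix.diagonal ![-1, 1, q 1 ^ 2, (a + q 1 * Real.cos (q 2)) ^ 2] i j -
        flatRingMetric a q i j) + 2 * ksH a M (toroidalMap a q) *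
          (toroidalForm a q i * toroidalForm a q j)| := by congr 1; ring
    _ ≤ _ := (abs_add_le _ _).trans (add_le_add h3 h2)
    _ = _ := by ring

end
end RotatingBH
end

noncomputable section
namespace RotatingBH

/-! ### Lengths of small curves around the ring -/

section
variable {a : ℝ} {M : ℝ → ℝ}

theorem measurable_ksRadius (a : ℝ) : Measurable fun x : Pt => ksRadius a (x 1) (x 2) (x 3) := by
  unfold ksRadius
  fun_prop

theorem measurable_ksForm (a : ℝ) (k : Fin 4) : Measurable fun x : Pt => ksForm a x k := by
  have := measurable_ksRadius a
  fin_cases k <;> simp [ksForm] <;> fun_prop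

theorem measurable_ksH (a : ℝ) (hM : Measurable M) : Measurable (ksH a M) := by
  have := measurable_ksRadius a
  unfold ksH
  fun_prop

theorem continuous_toroidalMap (a : ℝ) : Continuous (toroidalMap a) := by
  refine continuous_pi fun k => ?_
  fin_cases k <;> simp [toroidalMap] <;> fun_prop

theorem measurable_toroidalForm (a : ℝ) (i : Fin 4) :
    Measurable fun q : Pt => toroidalForm a q i := by
  have hJ : ∀ k, Measurable fun q : Pt => toroidalJacobian a q i k := fun k => by
    fin_cases i <;> fin_cases k <;> simp [toroidalJacobian] <;> fun_prop
  have hf := fun k => (measurable_ksForm a k).comp (continuous_toroidalMap a).measurable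
  exact Finset.measurable_sum _ fun k _ => (hJ k).mul (hf k)

/-- A relative error in a squared speed gives at most the same relative error in the speed, without
assuming $A\ge0$. -/
theorem abs_sqrt_abs_sub_le {A s η : ℝ} (hs : 0 ≤ s) (h : |A - s ^ 2| ≤ η * s ^ 2) :
    |√|A| - s| ≤ η * s := by
  rcases hs.eq_or_lt with rfl | hs
  · have : A = 0 := by simpa using h
    simp [this]
  have h1 : |√|A| - s| * (√|A| + s) = |(|A| - s ^ 2)| := by
    have h0 : 0 ≤ √|A| + s := by positivity
    calc _ = |√|A| - s| * |√|A| + s| := by rw [abs_of_nonneg h0]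
      _ = |√|A| ^ 2 - s ^ 2| := by rw [← abs_mul]; congr 1; ring
      _ = _ := by rw [Real.sq_sqrt (abs_nonneg A)]
  have h2 : |(|A| - s ^ 2)| ≤ |A - s ^ 2| := by
    have := abs_abs_sub_abs_le A (s ^ 2)
    rwa [abs_of_nonneg (sq_nonneg s)] at this
  have h3 : |√|A| - s| * s ≤ η * s * s :=
    calc _ ≤ |√|A| - s| * (√|A| + s) := by
          gcongr
          exact le_add_of_nonneg_left (Real.sqrt_nonneg _)
      _ ≤ η * s * s := by rw [h1]; exact (h2.trans h).trans_eq (by ring)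
  exact le_of_mul_le_mul_right h3 hs

/-- The squared speed of a curve along the `i`-th toroidal coordinate. -/
theorem bilin_toroidalJacobian (a : ℝ) (M : ℝ → ℝ) (q : Pt) (i : Fin 4) :
    bilin (ksMetric a M (toroidalMap a q)) (toroidalJacobian a q i) (toroidalJacobian a q i) =
      Matrix.diagonal ![-1, 1, q 1 ^ 2, (a + q 1 * Real.cos (q 2)) ^ 2] i i
      + 2 * ksH a M (toroidalMap a q) * toroidalForm a q i ^ 2 := by
  rw [bilin_ksMetric, toroidalJacobian_flat]
  rfl

/-- Along the $\rho$ and $\psi$ directions the Minkowski speed is exactly the scale $\sigma$, so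
only the $H$ term perturbs the length, by a relative error $O(\rho)$. -/
theorem exists_abs_curveLength_sub_le {n : ℕ} {m : ℝ} (ha : 0 < a) (hn : 3 ≤ n)
    (hM : ContDiffAt ℝ n M 0)
    (hexp : (fun s => M s - m * s ^ n) =O[𝓝[>] 0] fun s => s ^ (n + 1)) :
    ∃ C, ∃ δ > 0, ∀ (i : Fin 4) (q : ℝ → Pt) (s₀ s₁ ρ σ : ℝ), i = 1 ∨ i = 2 → Continuous q →
      (∀ s k, HasDerivAt (fun u => toroidalMap a (q u) k) (toroidalJacobian a (q s) i k) s) →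
      s₀ ≤ s₁ → ρ < δ →
      (∀ s ∈ Set.Ioc s₀ s₁, 0 ≤ q s 1 ∧ q s 1 ≤ ρ ∧ flatRingScale a (q s) i = σ) →
      |curveLength (ksMetric a M) (fun s => toroidalMap a (q s)) s₀ s₁ - (s₁ - s₀) * σ| ≤
        C * ρ * σ * (s₁ - s₀) := by
  have hcont : ∀ᶠ r in 𝓝 0, ContinuousAt M r :=
    (hM.eventually (by simp)).mono fun r hr => hr.continuousAt
  obtain ⟨C, hC, δ, hδ, hδa, hH⟩ := exists_abs_ksH_le ha hn hM hexp hcont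
  refine ⟨2 * C * 24 ^ 2, δ, hδ, fun i q s₀ s₁ ρ σ hi hq hd hs hρ hcurve => ?_⟩
  classical
  -- Away from $0$ the function $\mathcal M$ may fail to be measurable. Setting it to $0$ off its
  -- set of continuity points gives a measurable function that agrees with it on the curve, hence an
  -- integrable speed.
  let N : ℝ → ℝ := Set.piecewise {r | ContinuousAt M r} M 0
  have hN : Measurable N := ContinuousOn.measurable_piecewise
    (fun r hr => ContinuousAt.continuousWithinAt hr) continuousOn_const
    (measurableSet_of_continuousAt M)
  let f : ℝ → ℝ := fun s => √|σ ^ 2 + 2 * ksH a N (toroidalMap a (q s)) * toroidalForm a (q s) i ^ 2|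
  have hf : Measurable f := by
    have h1 : Measurable fun s => ksH a N (toroidalMap a (q s)) :=
      (measurable_ksH a hN).comp ((continuous_toroidalMap a).comp hq).measurable
    have h2 : Measurable fun s => toroidalForm a (q s) i :=
      (measurable_toroidalForm a i).comp hq.measurable
    fun_prop
  have hdiag : ∀ s ∈ Set.Ioc s₀ s₁,
      Matrix.diagonal ![-1, 1, q s 1 ^ 2, (a + q s 1 * Real.cos (q s 2)) ^ 2] i i = σ ^ 2 := by
    intro s hs
    rw [← (hcurve s hs).2.2]
    rcases hi with rfl | rfl <;> simp [flatRingScale]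
  have hfb : ∀ s ∈ Set.Ioc s₀ s₁, |f s - σ| ≤ 2 * C * 24 ^ 2 * ρ * σ := by
    intro s hs
    obtain ⟨h0, h1, h2⟩ := hcurve s hs
    obtain ⟨hHs, hc⟩ := hH (q s) h0 (h1.trans_lt hρ)
    have hσ : 0 ≤ σ := by
      rw [← h2]
      rcases hi with rfl | rfl <;> simp [flatRingScale, h0]
    have hK := abs_toroidalForm_le ha h0 ((h1.trans_lt hρ).trans_le hδa).le i
    rw [h2] at hK
    have hNM : ksH a N (toroidalMap a (q s)) = ksH a M (toroidalMap a (q s)) := by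
      simp only [ksH, N]
      rw [Set.piecewise_eq_of_mem _ _ _ hc]
    refine abs_sqrt_abs_sub_le hσ ?_
    rw [hNM, add_sub_cancel_left, abs_mul, abs_mul, abs_two, abs_pow]
    have hHρ : |ksH a M (toroidalMap a (q s))| ≤ C * ρ := hHs.trans (by gcongr)
    calc _ ≤ 2 * (C * ρ) * (24 * σ) ^ 2 := by
          have := (abs_nonneg _).trans hHρ
          gcongr
      _ = _ := by ring
  have hint : MeasureTheory.IntegrableOn f (Set.Ioc s₀ s₁) := by
    refine MeasureTheory.Measure.integrableOn_of_bounded (M := |σ| + 2 * C * 24 ^ 2 * ρ * σ)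
      measure_Ioc_lt_top.ne hf.aestronglyMeasurable ?_
    refine (MeasureTheory.ae_restrict_iff' measurableSet_Ioc).2 (Eventually.of_forall fun s hs => ?_)
    have := abs_sub_abs_le_abs_sub (f s) σ
    have := hfb s hs
    rw [Real.norm_eq_abs]
    linarith
  have hlen : curveLength (ksMetric a M) (fun s => toroidalMap a (q s)) s₀ s₁ =
      ∫ s in s₀..s₁, f s := by
    unfold curveLength
    refine intervalIntegral.integral_congr_ae (Eventually.of_forall fun s hs' => ?_)
    rw [Set.uIoc_of_le hs] at hs'
    obtain ⟨h0, h1, h2⟩ := hcurve s hs'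
    have hc := (hH (q s) h0 (h1.trans_lt hρ)).2
    have hNM : ksH a N (toroidalMap a (q s)) = ksH a M (toroidalMap a (q s)) := by
      simp only [ksH, N]
      rw [Set.piecewise_eq_of_mem _ _ _ hc]
    have hderiv : (fun k => deriv (fun u => toroidalMap a (q u) k) s) =
        toroidalJacobian a (q s) i := funext fun k => (hd s k).deriv
    simp only [f, hderiv, hNM]
    rw [bilin_toroidalJacobian, hdiag s hs']
  have hconst : (s₁ - s₀) * σ = ∫ _s in s₀..s₁, σ := by simp
  rw [hlen, hconst, ← intervalIntegral.integral_sub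
    ((intervalIntegrable_iff_integrableOn_Ioc_of_le hs).2 hint) (by simp)]
  have := intervalIntegral.norm_integral_le_of_norm_le_const (a := s₀) (b := s₁)
    (f := fun s => f s - σ) (C := 2 * C * 24 ^ 2 * ρ * σ) (by
      rw [Set.uIoc_of_le hs]
      exact hfb)
  rwa [abs_of_nonneg (sub_nonneg.2 hs)] at this

theorem tendsto_div_of_abs_sub_le {L : ℝ → ℝ} {c C δ : ℝ} (hδ : 0 < δ)
    (h : ∀ ρ, 0 < ρ → ρ < δ → |L ρ - c * ρ| ≤ C * ρ ^ 2) :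
    Tendsto (fun ρ => L ρ / ρ) (𝓝[>] 0) (𝓝 c) := by
  have h0 : Tendsto (fun ρ : ℝ => C * ρ) (𝓝[>] 0) (𝓝 0) := by
    have : Tendsto (fun ρ : ℝ => C * ρ) (𝓝 0) (𝓝 (C * 0)) := (continuous_const_mul C).tendsto 0
    rw [mul_zero] at this
    exact this.mono_left nhdsWithin_le_nhds
  rw [tendsto_iff_norm_sub_tendsto_zero]
  refine squeeze_zero' (Eventually.of_forall fun _ => norm_nonneg _) ?_ h0
  filter_upwards [Ioo_mem_nhdsGT hδ] with ρ hρ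
  have e : L ρ / ρ - c = (L ρ - c * ρ) / ρ := by field_simp [hρ.1.ne']
  rw [e, Real.norm_eq_abs, abs_div, abs_of_pos hρ.1, div_le_iff₀ hρ.1]
  exact (h ρ hρ.1 hρ.2).trans_eq (by ring)

theorem tendsto_curveLength {n : ℕ} {m : ℝ} (ha : 0 < a) (hn : 3 ≤ n)
    (hM : ContDiffAt ℝ n M 0)
    (hexp : (fun s => M s - m * s ^ n) =O[𝓝[>] 0] fun s => s ^ (n + 1)) (t φ : ℝ) :
    Tendsto (fun δρ => curveLength (ksMetric a M)
        (fun ψ => toroidalMap a ![t, δρ, ψ, φ]) 0 (2 * Real.pi) / δρ) (𝓝[>] 0)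
        (𝓝 (2 * Real.pi)) ∧
      ∀ ψ₀ : ℝ, Tendsto (fun δρ => curveLength (ksMetric a M)
        (fun ρ => toroidalMap a ![t, ρ, ψ₀, φ]) 0 δρ / δρ) (𝓝[>] 0) (𝓝 1) := by
  obtain ⟨C, δ, hδ, hlen⟩ := exists_abs_curveLength_sub_le ha hn hM hexp
  constructor
  · refine tendsto_div_of_abs_sub_le (C := C * (2 * Real.pi)) hδ fun ρ h0 h1 => ?_
    have := hlen 2 (fun ψ => ![t, ρ, ψ, φ]) 0 (2 * Real.pi) ρ ρ (Or.inr rfl)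
      (continuous_pi fun k => by fin_cases k <;> simp <;> fun_prop)
      (fun ψ k => by
        have hu : ∀ u : ℝ, Function.update ![t, ρ, ψ, φ] 2 u = ![t, ρ, u, φ] := fun u => by
          ext k
          fin_cases k <;> simp
        have h := hasDerivAt_toroidalMap a ![t, ρ, ψ, φ] 2 k
        simp only [hu] at h
        exact h)
      Real.two_pi_pos.le h1 (fun s _ => ⟨h0.le, le_rfl, rfl⟩)
    rw [sub_zero] at this
    exact this.trans_eq (by ring)
  · intro ψ
    refine tendsto_div_of_abs_sub_le (C := C) hδ fun ρ h0 h1 => ?_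
    have := hlen 1 (fun u => ![t, u, ψ, φ]) 0 ρ ρ 1 (Or.inl rfl)
      (continuous_pi fun k => by fin_cases k <;> simp <;> fun_prop)
      (fun s k => by
        have hu : ∀ u : ℝ, Function.update ![t, s, ψ, φ] 1 u = ![t, u, ψ, φ] := fun u => by
          ext k
          fin_cases k <;> simp
        have h := hasDerivAt_toroidalMap a ![t, s, ψ, φ] 1 k
        simp only [hu] at h
        exact h)
      h0.le h1 (fun s hs => ⟨hs.1.le, hs.2, rfl⟩)
    rw [sub_zero, mul_one] at this
    rw [one_mul]
    exact this.trans_eq (by ring)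

end
end RotatingBH
end

noncomputable section
namespace RotatingBH

/-! ### Limits at the ring -/

section
variable {a : ℝ} {n : ℕ} {m : ℝ} {M : ℝ → ℝ} {r θ : ℝ → ℝ → ℝ}

theorem exists_pullback_blMap (ha : 0 < a) (hM : ContDiffAt ℝ n M 0) :
    ∃ δ > 0, ∀ p : Pt, 0 < p 1 → p 1 < δ →
      pullback (blMap a M) (ksMetric a M) p = blMetric a M p := by
  have hcont : ∀ᶠ x in 𝓝 0, ContinuousAt M x :=
    (hM.eventually (by simp)).mono fun x hx => hx.continuousAt
  have hD : ∀ᶠ x in 𝓝 0, blDelta a M x ≠ 0 := by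
    have hMc := hM.continuousAt
    have : ContinuousAt (blDelta a M) 0 := by unfold blDelta; fun_prop
    refine this.eventually_ne ?_
    simp [blDelta, ha.ne']
  obtain ⟨δ, hδ, h⟩ := Metric.eventually_nhds_iff.1 (hcont.and hD)
  refine ⟨δ, hδ, fun p h0 h1 => pullback_blMap ha (fun x hx => h ?_) h0 h1⟩
  rw [dist_zero_right, Real.norm_eq_abs]
  exact abs_lt.2 hx

theorem exists_forall_blRegular (ha : 0 < a) (hM : ContDiffAt ℝ 2 M 0)
    (h : ∀ ρ > 0, ∀ ψ, AreBLCoords a ρ ψ (r ρ ψ) (θ ρ ψ)) (t φ : ℝ) :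
    ∃ δ > 0, ∀ ρ ψ : ℝ, 0 < ρ → ρ < δ → BLRegular a M ![t, r ρ ψ, θ ρ ψ, φ] := by
  obtain ⟨δ, hδ, hreg⟩ := mem_nhdsGT_iff_exists_Ioo_subset.1 (eventually_blRegular ha hM)
  exact ⟨δ, hδ, fun ρ ψ h0 h1 => hreg ⟨h0, h1⟩ ψ _ _ (h ρ h0 ψ) t φ⟩

theorem abs_one_add_cos_rpow_le {α : ℝ} (hα : 0 ≤ α) (ψ : ℝ) :
    |(1 + Real.cos ψ) ^ α| ≤ 2 ^ α := by
  simpa using abs_rpow_le one_pos hα ψ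

theorem abs_mul_one_add_cos_rpow_le {α : ℝ} (hα : 0 ≤ α) (c d ψ : ℝ) :
    |c * (1 + Real.cos ψ) ^ α * d| ≤ |c| * 2 ^ α * |d| := by
  rw [abs_mul, abs_mul]
  gcongr
  exact abs_one_add_cos_rpow_le hα ψ

theorem continuousAtRing_zero_of_ringLimit (hn : 3 < n) {t φ : ℝ} {R μ px py pz : Pt → ℝ}
    (hR : RingLimit r θ t φ R (((n : ℝ) - 3) / 2)
      (fun ψ => m * n * (1 + n) * (1 + Real.cos ψ) ^ (((n : ℝ) - 1) / 2) *
        a ^ (((n : ℝ) - 3) / 2)))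
    (hμ : RingLimit r θ t φ μ (((n : ℝ) - 3) / 2)
      (fun ψ => m * n / 2 * (1 + Real.cos ψ) ^ (((n : ℝ) + 1) / 2) * a ^ (((n : ℝ) - 3) / 2)))
    (hz : RingLimit r θ t φ pz (((n : ℝ) - 3) / 2)
      (fun ψ => -(m * n / 2 * (1 + Real.cos ψ) ^ (((n : ℝ) + 1) / 2) * a ^ (((n : ℝ) - 3) / 2))))
    (hx : RingLimit r θ t φ px (((n : ℝ) - 3) / 2)
      (fun ψ => m * n / 2 * (Real.cos ψ - n) * (1 + Real.cos ψ) ^ (((n : ℝ) - 1) / 2) *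
        a ^ (((n : ℝ) - 3) / 2)))
    (hy : RingLimit r θ t φ py (((n : ℝ) - 3) / 2)
      (fun ψ => m * n / 2 * (Real.cos ψ - n) * (1 + Real.cos ψ) ^ (((n : ℝ) - 1) / 2) *
        a ^ (((n : ℝ) - 3) / 2))) :
    ∀ F ∈ [R, μ, px, py, pz], ContinuousAtRing r θ t φ F 0 := by
  have hn' : (3 : ℝ) < n := by exact_mod_cast hn
  have hs : 0 < ((n : ℝ) - 3) / 2 := by linarith
  have h1 : 0 ≤ ((n : ℝ) - 1) / 2 := by linarith
  have h2 : 0 ≤ ((n : ℝ) + 1) / 2 := by linarith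
  have hp : ∀ ψ, |m * n / 2 * (Real.cos ψ - n) * (1 + Real.cos ψ) ^ (((n : ℝ) - 1) / 2) *
      a ^ (((n : ℝ) - 3) / 2)| ≤
      |m * n / 2| * (1 + n) * 2 ^ (((n : ℝ) - 1) / 2) * |a ^ (((n : ℝ) - 3) / 2)| := by
    intro ψ
    refine (abs_mul_one_add_cos_rpow_le h1 _ _ ψ).trans ?_
    rw [abs_mul]
    gcongr
    refine (abs_sub _ _).trans (add_le_add (Real.abs_cos_le_one ψ) ?_)
    rw [Nat.abs_cast]
  simp only [List.forall_mem_cons, List.not_mem_nil, false_imp_iff, implies_true, and_true]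
  exact ⟨continuousAtRing_zero hs hR (abs_mul_one_add_cos_rpow_le h1 _ _),
    continuousAtRing_zero hs hμ (abs_mul_one_add_cos_rpow_le h2 _ _),
    continuousAtRing_zero hs hx hp, continuousAtRing_zero hs hy hp,
    continuousAtRing_zero hs hz fun ψ => by
      rw [abs_neg]
      exact abs_mul_one_add_cos_rpow_le h2 _ _ ψ⟩

theorem RingLimit.congr {t φ s s' : ℝ} {F : Pt → ℝ} {f g : ℝ → ℝ} (h : RingLimit r θ t φ F s f)
    (hs : s = s') (hfg : ∀ ψ, f ψ = g ψ) : RingLimit r θ t φ F s' g := by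
  obtain rfl := hs
  obtain rfl := funext hfg
  exact h

end
end RotatingBH
end

/-! ### Assembly of the theorem -/

theorem mainTheorem2 (a : ℝ) (ha : 0 < a) (n : ℕ) (hn : 3 ≤ n) (m : ℝ) (M : ℝ → ℝ)
    (hM : ContDiffAt ℝ n M 0)
    (hexp : (fun s => M s - m * s ^ n) =O[𝓝[>] 0] fun s => s ^ (n + 1)) :
    -- near the ring, the Kerr-Schild and Boyer-Lindquist forms are the same metric
    (∃ δ > 0, ∀ p : RotatingBH.Pt, 0 < p 1 → p 1 < δ → 0 < p 2 → p 2 < Real.pi →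
      RotatingBH.pullback (RotatingBH.blMap a M) (RotatingBH.ksMetric a M) p =
        RotatingBH.blMetric a M p) ∧
    -- leading order of the metric in toroidal coordinates
    (∃ C, ∃ δ > 0, ∀ q : RotatingBH.Pt, 0 < q 1 → q 1 < δ → ∀ i j,
      |RotatingBH.toroidalMetric a M q i j - RotatingBH.flatRingMetric a q i j| ≤
        C * q 1 * (RotatingBH.flatRingScale a q i * RotatingBH.flatRingScale a q j)) ∧
    -- small loops around the ring: no conical singularity
    (∀ t φ : ℝ,
      Tendsto (fun δρ => RotatingBH.curveLength (RotatingBH.ksMetric a M)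
          (fun ψ => RotatingBH.toroidalMap a ![t, δρ, ψ, φ]) 0 (2 * Real.pi) / δρ)
        (𝓝[>] 0) (𝓝 (2 * Real.pi)) ∧
      ∀ ψ₀ : ℝ,
        Tendsto (fun δρ => RotatingBH.curveLength (RotatingBH.ksMetric a M)
            (fun ψ => RotatingBH.toroidalMap a ![t, δρ, ψ, φ]) 0 (2 * Real.pi) /
          RotatingBH.curveLength (RotatingBH.ksMetric a M)
            (fun ρ => RotatingBH.toroidalMap a ![t, ρ, ψ₀, φ]) 0 δρ)
          (𝓝[>] 0) (𝓝 (2 * Real.pi))) ∧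
    -- Boyer-Lindquist coordinates exist at all points off the ring
    (∀ ρ > 0, ∀ ψ : ℝ, ∃ r θ : ℝ, RotatingBH.AreBLCoords a ρ ψ r θ) ∧
    -- curvature scalar, effective density and pressures
    ∀ r θ : ℝ → ℝ → ℝ, (∀ ρ > 0, ∀ ψ, RotatingBH.AreBLCoords a ρ ψ (r ρ ψ) (θ ρ ψ)) →
      ∀ t φ : ℝ,
        (∃ δ > 0, ∀ ρ ψ : ℝ, 0 < ρ → ρ < δ →
          (∀ i j, ContDiffAt ℝ 2 (fun p => RotatingBH.blMetric a M p i j)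
            ![t, r ρ ψ, θ ρ ψ, φ]) ∧
          (RotatingBH.blMetric a M ![t, r ρ ψ, θ ρ ψ, φ]).det ≠ 0) ∧
        -- scaling with `ρ ^ ((n - 3) / 2)`
        (RotatingBH.RingLimit r θ t φ (RotatingBH.curvScalar a M) (((n : ℝ) - 3) / 2)
            (fun ψ => m * n * (1 + n) * (1 + Real.cos ψ) ^ (((n : ℝ) - 1) / 2) *
              a ^ (((n : ℝ) - 3) / 2)) ∧
          RotatingBH.RingLimit r θ t φ (RotatingBH.density a M) (((n : ℝ) - 3) / 2)
            (fun ψ => m * n / 2 * (1 + Real.cos ψ) ^ (((n : ℝ) + 1) / 2) *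
              a ^ (((n : ℝ) - 3) / 2)) ∧
          RotatingBH.RingLimit r θ t φ (RotatingBH.pressureZ a M) (((n : ℝ) - 3) / 2)
            (fun ψ => -(m * n / 2 * (1 + Real.cos ψ) ^ (((n : ℝ) + 1) / 2) *
              a ^ (((n : ℝ) - 3) / 2))) ∧
          RotatingBH.RingLimit r θ t φ (RotatingBH.pressureX a M) (((n : ℝ) - 3) / 2)
            (fun ψ => m * n / 2 * (Real.cos ψ - n) * (1 + Real.cos ψ) ^ (((n : ℝ) - 1) / 2) *
              a ^ (((n : ℝ) - 3) / 2)) ∧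
          RotatingBH.RingLimit r θ t φ (RotatingBH.pressureY a M) (((n : ℝ) - 3) / 2)
            (fun ψ => m * n / 2 * (Real.cos ψ - n) * (1 + Real.cos ψ) ^ (((n : ℝ) - 1) / 2) *
              a ^ (((n : ℝ) - 3) / 2))) ∧
        -- for `n > 3` they vanish at the ring
        (3 < n → ∀ F ∈ [RotatingBH.curvScalar a M, RotatingBH.density a M,
            RotatingBH.pressureX a M, RotatingBH.pressureY a M, RotatingBH.pressureZ a M],
          RotatingBH.ContinuousAtRing r θ t φ F 0) ∧
        -- for `n = 3` they are finite and depend on the direction of approach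
        (n = 3 →
          RotatingBH.RingLimit r θ t φ (RotatingBH.curvScalar a M) 0
            (fun ψ => 12 * m * (1 + Real.cos ψ)) ∧
          RotatingBH.RingLimit r θ t φ (RotatingBH.density a M) 0
            (fun ψ => 6 * m * Real.cos (ψ / 2) ^ 4) ∧
          RotatingBH.RingLimit r θ t φ (RotatingBH.pressureZ a M) 0
            (fun ψ => -(6 * m * Real.cos (ψ / 2) ^ 4)) ∧
          RotatingBH.RingLimit r θ t φ (RotatingBH.pressureX a M) 0
            (fun ψ => 3 * m * Real.cos (ψ / 2) ^ 2 * (Real.cos ψ - 3)) ∧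
          RotatingBH.RingLimit r θ t φ (RotatingBH.pressureY a M) 0
            (fun ψ => 3 * m * Real.cos (ψ / 2) ^ 2 * (Real.cos ψ - 3)) ∧
          (m ≠ 0 → ∀ F ∈ [RotatingBH.curvScalar a M, RotatingBH.density a M,
              RotatingBH.pressureX a M, RotatingBH.pressureY a M, RotatingBH.pressureZ a M],
            ¬ ∃ L, RotatingBH.ContinuousAtRing r θ t φ F L)) := by
  have hM2 : ContDiffAt ℝ 2 M 0 := hM.of_le (by norm_cast; omega)
  refine ⟨?_, RotatingBH.toroidalMetric_sub_flat ha hn hM hexp, fun t φ => ?_,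
    fun ρ _ ψ => RotatingBH.exists_areBLCoords ha ρ ψ, fun r θ h t φ => ?_⟩
  · obtain ⟨δ, hδ, hp⟩ := RotatingBH.exists_pullback_blMap ha hM
    exact ⟨δ, hδ, fun p h0 h1 _ _ => hp p h0 h1⟩
  · obtain ⟨hloop, hrad⟩ := RotatingBH.tendsto_curveLength ha hn hM hexp t φ
    refine ⟨hloop, fun ψ₀ => ?_⟩
    have := hloop.div (hrad ψ₀) one_ne_zero
    rw [div_one] at this
    refine this.congr' ?_
    filter_upwards [self_mem_nhdsWithin] with ρ hρ
    exact div_div_div_cancel_right₀ (ne_of_gt hρ) _ _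
  · have hR := RotatingBH.ringLimit_curvScalar ha hn hM hexp h t φ
    have hμ := RotatingBH.ringLimit_density ha hn hM hexp h t φ
    have hz := RotatingBH.ringLimit_pressureZ ha hn hM hexp h t φ
    have hx := RotatingBH.ringLimit_of_eq_neg_ricciRadial ha hn hM hexp h t φ
      fun p hp => hp.pressureX_eq
    have hy := RotatingBH.ringLimit_of_eq_neg_ricciRadial ha hn hM hexp h t φ
      fun p hp => hp.pressureY_eq
    refine ⟨?_, ⟨hR, hμ, hz, hx, hy⟩,
      fun hn3 => RotatingBH.continuousAtRing_zero_of_ringLimit hn3 hR hμ hz hx hy, fun hn3 => ?_⟩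
    · obtain ⟨δ, hδ, hreg⟩ := RotatingBH.exists_forall_blRegular ha hM2 h t φ
      exact ⟨δ, hδ, fun ρ ψ h0 h1 => ⟨(hreg ρ ψ h0 h1).contDiffAt, (hreg ρ ψ h0 h1).det_ne⟩⟩
    subst hn3
    have e1 : (((3 : ℕ) : ℝ) - 3) / 2 = 0 := by norm_num
    have e2 : (((3 : ℕ) : ℝ) - 1) / 2 = 1 := by norm_num
    have e3 : (((3 : ℕ) : ℝ) + 1) / 2 = (2 : ℕ) := by norm_num
    have hcos : ∀ ψ, Real.cos ψ = 2 * Real.cos (ψ / 2) ^ 2 - 1 := fun ψ => by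
      rw [← Real.cos_two_mul, mul_div_cancel₀ ψ two_ne_zero]
    have hR' := hR.congr (g := fun ψ => 12 * m * (1 + Real.cos ψ)) e1 fun ψ => by
      rw [e1, e2, Real.rpow_one, Real.rpow_zero]
      push_cast
      ring
    have hμ' := hμ.congr (g := fun ψ => 6 * m * Real.cos (ψ / 2) ^ 4) e1 fun ψ => by
      rw [e1, e3, Real.rpow_natCast, Real.rpow_zero, hcos]
      push_cast
      ring
    have hz' := hz.congr (g := fun ψ => -(6 * m * Real.cos (ψ / 2) ^ 4)) e1 fun ψ => by
      rw [e1, e3, Real.rpow_natCast, Real.rpow_zero, hcos]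
      push_cast
      ring
    have hp : ∀ ψ, m * ((3 : ℕ) : ℝ) / 2 * (Real.cos ψ - ((3 : ℕ) : ℝ)) *
        (1 + Real.cos ψ) ^ ((((3 : ℕ) : ℝ) - 1) / 2) * a ^ ((((3 : ℕ) : ℝ) - 3) / 2) =
        3 * m * Real.cos (ψ / 2) ^ 2 * (Real.cos ψ - 3) := fun ψ => by
      rw [e1, e2, Real.rpow_one, Real.rpow_zero, hcos]
      push_cast
      ring
    have hx' := hx.congr e1 hp
    have hy' := hy.congr e1 hp
    refine ⟨hR', hμ', hz', hx', hy', fun hm => ?_⟩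
    simp only [List.forall_mem_cons, List.not_mem_nil, false_imp_iff, implies_true, and_true]
    -- All five profiles vanish at $\psi=\pi$, whereas at $\psi=0$ they are $24m$, $6m$ and $-6m$
    -- (three times).
    refine ⟨RotatingBH.not_continuousAtRing (ψ₁ := 0) (ψ₂ := Real.pi) hR' ?_,
      RotatingBH.not_continuousAtRing (ψ₁ := 0) (ψ₂ := Real.pi) hμ' ?_,
      RotatingBH.not_continuousAtRing (ψ₁ := 0) (ψ₂ := Real.pi) hx' ?_,
      RotatingBH.not_continuousAtRing (ψ₁ := 0) (ψ₂ := Real.pi) hy' ?_,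
      RotatingBH.not_continuousAtRing (ψ₁ := 0) (ψ₂ := Real.pi) hz' ?_⟩ <;>
    norm_num [hm]
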